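/- **Setting.** Let $\Delta=\{\alpha_1,\dots,\alpha_n\}$ be a set of simple roots of type $C_n$ ($n\ge2$), $B_n$ ($n\ge3$), $G_2$ or $F_4$ spanning Euclidean $\mathbb R^n$, with short and long simple roots $\Delta_s,\Delta_l$, Weyl group $W$, root system $W\Delta$, highest root $\xi$, coroots $\alpha^\vee=2\alpha/\langle\alpha,\alpha\rangle$, dual root lattice $Q^\vee=\bigoplus_i\mathbb Z\alpha_i^\vee$ and dual weight lattice $P^\vee=\{x:\langle x,\alpha_i\rangle\in\mathbb Z\ \forall i\}$. Let $W^{\mathrm{aff}}=Q^\vee\rtimes W$, with retraction $\psi:W^{\mathrm{aff}}\to W$ (linear part) and generators $R=\{r_0,r_1,\dots,r_n\}$, where $r_i$ ($i\ge1$) is the reflection in $\alpha_i^\perp$ and $r_0a=r_\xi a+\xi^\vee$. Let $F=\{a:\langle a,\alpha_i\rangle\ge0\ \forall i,\ \langle a,\xi\rangle\le1\}$. The sign homomorphisms $W\to\{\pm1\}$ are $\mathfrak 1$, $\sigma^e=\det$, $\sigma^s$ and $\sigma^l$, where $\sigma^s(r_\alpha)=-1$ for $\alpha\in\Delta_s$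 and $1$ for $\alpha\in\Delta_l$, and $\sigma^l(r_\alpha)=-1$ for $\alpha\in\Delta_l$ and $1$ for $\alpha\in\Delta_s$. For a sign homomorphism $\sigma$ put $R^\sigma=\{r\in R:\sigma(\psi(r))=-1\}$, $W^{\mathrm{aff}}_\sigma=\ker(\sigma\circ\psi)$ and $F^\sigma=\{a\in F:\sigma\circ\psi(\mathrm{Stab}_{W^{\mathrm{aff}}}(a))=\{1\}\}$. For $\sigma\ne\mathfrak 1$ choose any $r_\sigma\in R^\sigma$ (this set is not empty). For a sign homomorphism $\widetilde\sigma$ and an integer $M\ge1$ let $$H^{\widetilde\sigma,\sigma}=\{a\in F\cup r_\sigma F^\sigma:\ \widetilde\sigma\circ\psi(\mathrm{Stab}_{W^{\mathrm{aff}}_\sigma}(a))=\{\pm1\}\},\qquad F_M^{\widetilde\sigma,\sigma}=\tfrac1M P^\vee\cap\big((F\cup r_\sigma F^\sigma)\setminus H^{\widetilde\sigma,\sigma}\big).$$ **Statement.** All the sets $F_M^{\widetilde\sigma,\sigma}$ below are finite, and for every choice of $r_\sigma\in R^\sigma$ the following hold. In the formulas, $k\ge0$ is an integer such that the index $M$ is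 at least $1$, and $\binom ab=0$ for $0\le a<b$. 1. $C_n$, $n\ge2$: $$\begin{aligned} |F_{2k}^{\mathfrak1,\sigma^s}|&=\tbinom{k+n}n+\tbinom{k+n-1}n+\tbinom{k+1}n+\tbinom kn,&|F_{2k+1}^{\mathfrak1,\sigma^s}|&=2\tbinom{k+n}n+2\tbinom{k+1}n,\\ |F_{2k}^{\mathfrak1,\sigma^l}|&=\tbinom{k+n}n+2\tbinom{n+k-1}n+\tbinom{n+k-2}n,&|F_{2k+1}^{\mathfrak1,\sigma^l}|&=2\tbinom{k+n}n+2\tbinom{n+k-1}n,\\ |F_{2k}^{\mathfrak1,\sigma^e}|&=\tbinom{k+n}n+\tbinom{k+n-1}n+\tbinom kn+\tbinom{k-1}n,&|F_{2k+1}^{\mathfrak1,\sigma^e}|&=2\tbinom{k+n}n+2\tbinom kn,\\ |F_{2k}^{\sigma^e,\sigma^s}|&=\tbinom{n+k-1}n+\tbinom{n+k-2}n+\tbinom kn+\tbinom{k-1}n,&|F_{2k+1}^{\sigma^e,\sigma^s}|&=2\tbinom{n+k-1}n+2\tbinom kn,\\ |F_{2k}^{\sigma^e,\sigma^l}|&=\tbinom{k+1}n+2\tbinom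 kn+\tbinom{k-1}n,&|F_{2k+1}^{\sigma^e,\sigma^l}|&=2\tbinom{k+1}n+2\tbinom kn,\\ |F_{2k}^{\sigma^l,\sigma^e}|&=\tbinom{k+1}n+\tbinom kn+\tbinom{n+k-1}n+\tbinom{n+k-2}n,&|F_{2k+1}^{\sigma^l,\sigma^e}|&=2\tbinom{n+k-1}n+2\tbinom{k+1}n. \end{aligned}$$ 2. $B_n$, $n\ge3$, for every $M\ge1$: $|F_M^{\mathfrak1,\sigma^s}(B_n)|=|F_M^{\mathfrak1,\sigma^l}(C_n)|$, $|F_M^{\mathfrak1,\sigma^l}(B_n)|=|F_M^{\mathfrak1,\sigma^s}(C_n)|$, $|F_M^{\mathfrak1,\sigma^e}(B_n)|=|F_M^{\mathfrak1,\sigma^e}(C_n)|$, $|F_M^{\sigma^e,\sigma^s}(B_n)|=|F_M^{\sigma^e,\sigma^l}(C_n)|$, $|F_M^{\sigma^e,\sigma^l}(B_n)|=|F_M^{\sigma^e,\sigma^s}(C_n)|$, $|F_M^{\sigma^l,\sigma^e}(B_n)|=|F_M^{\sigma^l,\sigma^e}(C_n)|$. 3. $G_2$ (values listed in the order of $j$):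 - $|F_{6k+j}^{\mathfrak 1,\sigma^s}|$ for $j=0,\dots,5$: $1+3k+6k^2$; $1+5k+6k^2$; $2+7k+6k^2$; $4+9k+6k^2$; $5+11k+6k^2$; $7+13k+6k^2$. - $|F_{6k+j}^{\mathfrak 1,\sigma^e}|$ for $j=0,\dots,5$: $2+6k^2$; $1+2k+6k^2$; $2+4k+6k^2$; $3+6k+6k^2$; $4+8k+6k^2$; $5+10k+6k^2$. - $|F_{6k+j}^{\sigma^l,\sigma^s}|$ for $j=0,\dots,5$: $1-3k+6k^2$; $-k+6k^2$; $k+6k^2$; $1+3k+6k^2$; $1+5k+6k^2$; $2+7k+6k^2$. - $|F_{6k+j}^{\sigma^l,\sigma^e}|$ for $j=0,\dots,5$: $6k^2$; $2k+6k^2$; $4k+6k^2$; $2+6k+6k^2$; $2+8k+6k^2$; $4+10k+6k^2$. Moreover, for every $M\ge1$, $|F_M^{\mathfrak1,\sigma^l}|=|F_M^{\mathfrak1,\sigma^s}|$ and $|F_M^{\sigma^s,\sigma^l}|=|F_M^{\sigma^l,\sigma^s}|$. 4. $F_4$ (values listed in the order of $j$): - $|F_{12k+j}^{\mathfrak 1,\sigma^s}|$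 for $j=0,\dots,11$: $1+8k+25k^2+36k^3+36k^4$; $1+10k+31k^2+48k^3+36k^4$; $3+20k+49k^2+60k^3+36k^4$; $4+25k+61k^2+72k^3+36k^4$; $8+42k+85k^2+84k^3+36k^4$; $10+52k+103k^2+96k^3+36k^4$; $18+78k+133k^2+108k^3+36k^4$; $22+95k+157k^2+120k^3+36k^4$; $35+132k+193k^2+132k^3+36k^4$; $43+158k+223k^2+144k^3+36k^4$; $63+208k+265k^2+156k^3+36k^4$; $76+245k+301k^2+168k^3+36k^4$. - $|F_{12k+j}^{\mathfrak 1,\sigma^e}|$ for $j=0,\dots,11$: $2+52k^2+36k^4$; $1+8k+49k^2+12k^3+36k^4$; $3+18k+58k^2+24k^3+36k^4$; $4+26k+61k^2+36k^3+36k^4$; $8+40k+76k^2+48k^3+36k^4$; $10+50k+85k^2+60k^3+36k^4$; $17+70k+106k^2+72k^3+36k^4$; $21+84k+121k^2+84k^3+36k^4$; $32+112k+148k^2+96k^3+36k^4$; $39+132k+169k^2+108k^3+36k^4$; $55+170k+202k^2+120k^3+36k^4$; $66+198k+229k^2+132k^3+36k^4$. - $|F_{12k+j}^{\sigma^l,\sigma^s}|$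 for $j=0,\dots,11$: $1-8k+25k^2-36k^3+36k^4$; $-3k+13k^2-24k^3+36k^4$; $-2k+13k^2-12k^3+36k^4$; $7k^2+36k^4$; $2k+13k^2+12k^3+36k^4$; $3k+13k^2+24k^3+36k^4$; $1+8k+25k^2+36k^3+36k^4$; $1+10k+31k^2+48k^3+36k^4$; $3+20k+49k^2+60k^3+36k^4$; $4+25k+61k^2+72k^3+36k^4$; $8+42k+85k^2+84k^3+36k^4$; $10+52k+103k^2+96k^3+36k^4$. - $|F_{12k+j}^{\sigma^l,\sigma^e}|$ for $j=0,\dots,11$: $-2k^2+36k^4$; $-k-5k^2+12k^3+36k^4$; $4k^2+24k^3+36k^4$; $-k+7k^2+36k^3+36k^4$; $4k+22k^2+48k^3+36k^4$; $5k+31k^2+60k^3+36k^4$; $2+16k+52k^2+72k^3+36k^4$; $2+21k+67k^2+84k^3+36k^4$; $6+40k+94k^2+96k^3+36k^4$; $8+51k+115k^2+108k^3+36k^4$; $16+80k+148k^2+120k^3+36k^4$; $20+99k+175k^2+132k^3+36k^4$. Moreover, for every $M\ge1$, $|F_M^{\mathfrak1,\sigma^l}|=|F_M^{\mathfrak1,\sigma^s}|$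 and $|F_M^{\sigma^s,\sigma^l}|=|F_M^{\sigma^l,\sigma^s}|$. -/

import Mathlib

/-!
Grid fragments of affine even Weyl groups of the root systems with two root lengths.

`SimpleRoots A` is a set of simple roots spanning Euclidean `ℝⁿ` whose Cartan matrix
`⟨α i, α j^∨⟩` is `A`.  Everything else is built from the simple roots.
-/

open scoped Pointwise

noncomputable section

/-- A basis `α 0, …, α (n-1)` of Euclidean `ℝⁿ` with prescribed integers
`2⟨α i, α j⟩ / ⟨α j, α j⟩ = A i j`. -/
structure SimpleRoots {n : ℕ} (A : Matrix (Fin n) (Fin n) ℤ) where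
  root : Fin n → EuclideanSpace ℝ (Fin n)
  linearIndependent : LinearIndependent ℝ root
  cartan : ∀ i j, 2 * inner ℝ (root i) (root j) / inner ℝ (root j) (root j) = (A i j : ℝ)

/-- The linear reflection in the hyperplane orthogonal to `v`. -/
def mirror {n : ℕ} (v : EuclideanSpace ℝ (Fin n)) :
    EuclideanSpace ℝ (Fin n) ≃ₗᵢ[ℝ] EuclideanSpace ℝ (Fin n) :=
  (Submodule.span ℝ {v})ᗮ.reflection

/-- The dual vector `v^∨ = 2 v / ⟨v, v⟩`. -/
def coroot {n : ℕ} (v : EuclideanSpace ℝ (Fin n)) : EuclideanSpace ℝ (Fin n) :=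
  (2 / inner ℝ v v : ℝ) • v

theorem mirror_apply {n : ℕ} (v x : EuclideanSpace ℝ (Fin n)) :
    mirror v x = x - (inner ℝ v x : ℝ) • coroot v := by
  rw [mirror, Submodule.reflection_orthogonal_apply, Submodule.reflection_singleton_apply, coroot,
    real_inner_self_eq_norm_sq, neg_sub, smul_smul, two_smul, ← add_smul]
  congr 2
  simp only [RCLike.ofReal_real_eq_id, id]
  ring

namespace SimpleRoots

variable {n : ℕ} {A : Matrix (Fin n) (Fin n) ℤ} (α : SimpleRoots A)

/-- The finite Weyl group `W`, generated by the simple reflections. -/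
def weyl : Subgroup (EuclideanSpace ℝ (Fin n) ≃ₗᵢ[ℝ] EuclideanSpace ℝ (Fin n)) :=
  Subgroup.closure (Set.range fun i => mirror (α.root i))

/-- The simple reflection `r_i` as an element of `W`. -/
def simpleReflection (i : Fin n) : α.weyl :=
  ⟨mirror (α.root i), Subgroup.subset_closure ⟨i, rfl⟩⟩

/-- The root system `Π = W Δ`. -/
def roots : Set (EuclideanSpace ℝ (Fin n)) :=
  {β | ∃ w ∈ α.weyl, ∃ i, β = w (α.root i)}

/-- The highest root: a root `ξ` such that `ξ - β` is a nonnegative integer combination of simple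
roots for every root `β`. -/
def IsHighestRoot (ξ : EuclideanSpace ℝ (Fin n)) : Prop :=
  ξ ∈ α.roots ∧ ∀ β ∈ α.roots, ∃ k : Fin n → ℕ, ξ - β = ∑ i, k i • α.root i

/-- The highest root `ξ` (it exists and is unique for irreducible root systems). -/
def highestRoot : EuclideanSpace ℝ (Fin n) :=
  Classical.epsilon α.IsHighestRoot

/-- The dual root lattice `Q^∨`. -/
def corootLattice : AddSubgroup (EuclideanSpace ℝ (Fin n)) :=
  AddSubgroup.closure (Set.range fun i => coroot (α.root i))

/-- The dual weight lattice `P^∨`, the `ℤ`-dual of the root lattice. -/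
def coweightLattice : Set (EuclideanSpace ℝ (Fin n)) :=
  {x | ∀ i, ∃ k : ℤ, inner ℝ x (α.root i) = (k : ℝ)}

theorem weyl_corootLattice {w : EuclideanSpace ℝ (Fin n) ≃ₗᵢ[ℝ] EuclideanSpace ℝ (Fin n)}
    (hw : w ∈ α.weyl) : ∀ q ∈ α.corootLattice, w q ∈ α.corootLattice := by
  have key : ∀ i, ∀ q ∈ α.corootLattice, mirror (α.root i) q ∈ α.corootLattice := by
    intro i q hq
    induction hq using AddSubgroup.closure_induction with
    | mem x hx =>
      obtain ⟨j, rfl⟩ := hx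
      have h : (inner ℝ (α.root i) (coroot (α.root j)) : ℝ) = (A i j : ℝ) := by
        rw [← α.cartan i j, coroot, inner_smul_right]
        ring
      rw [mirror_apply, h, Int.cast_smul_eq_zsmul]
      have hmem : ∀ l, coroot (α.root l) ∈ α.corootLattice :=
        fun l => AddSubgroup.subset_closure ⟨l, rfl⟩
      exact sub_mem (hmem j) (zsmul_mem (hmem i) _)
    | zero => simp
    | add x y _ _ hx hy => rw [map_add]; exact add_mem hx hy
    | neg x _ hx => rw [map_neg]; exact neg_mem hx
  induction hw using Subgroup.closure_induction_left with
  | one => exact fun q hq => hq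
  | mul_left x hx y _ ih =>
    obtain ⟨i, rfl⟩ := hx
    exact fun q hq => key i _ (ih q hq)
  | inv_mul_cancel x hx y _ ih =>
    obtain ⟨i, rfl⟩ := hx
    intro q hq
    have h : (mirror (α.root i))⁻¹ = mirror (α.root i) := by
      rw [mirror, Submodule.reflection_inv]
    rw [h]
    exact key i _ (ih q hq)

/-- The affine Weyl group `Q^∨ ⋊ W`: the maps `a ↦ w a + q` with `w ∈ W` (the linear part) and
`q ∈ Q^∨` (the image of the origin). -/
def affineWeyl : Subgroup (EuclideanSpace ℝ (Fin n) ≃ᵃⁱ[ℝ] EuclideanSpace ℝ (Fin n)) where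
  carrier := {g | g.linearIsometryEquiv ∈ α.weyl ∧ g 0 ∈ α.corootLattice}
  one_mem' := ⟨one_mem α.weyl, by simp⟩
  mul_mem' := by
    rintro g h ⟨hg, hg0⟩ ⟨hh, hh0⟩
    refine ⟨mul_mem hg hh, ?_⟩
    have h1 : (g * h) 0 = g.linearIsometryEquiv (h 0) + g 0 := by
      have := g.map_vadd 0 (h 0)
      simpa using this
    rw [h1]
    exact add_mem (α.weyl_corootLattice hg _ hh0) hg0
  inv_mem' := by
    rintro g ⟨hg, hg0⟩
    refine ⟨inv_mem hg, ?_⟩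
    have h1 : g⁻¹ 0 = -(g.linearIsometryEquiv⁻¹ (g 0)) := by
      have := g.map_vadd 0 (-(g.linearIsometryEquiv⁻¹ (g 0)))
      have h2 : g.linearIsometryEquiv (g.linearIsometryEquiv⁻¹ (g 0)) = g 0 :=
        g.linearIsometryEquiv.apply_symm_apply _
      simp only [map_neg, h2, vadd_eq_add, add_zero, neg_add_cancel] at this
      rw [← this]
      exact (g.symm_apply_apply _).trans (by rw [this])
    rw [h1]
    exact neg_mem (α.weyl_corootLattice (inv_mem hg) _ hg0)

/-- The retraction `ψ : W^aff → W`, sending `a ↦ w a + q` to `w`. -/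
def retraction : α.affineWeyl →* α.weyl where
  toFun g := ⟨g.1.linearIsometryEquiv, g.2.1⟩
  map_one' := rfl
  map_mul' _ _ := rfl

/-- The affine reflection `r_0 a = r_ξ a + 2 ξ / ⟨ξ, ξ⟩`. -/
def affineReflection : EuclideanSpace ℝ (Fin n) ≃ᵃⁱ[ℝ] EuclideanSpace ℝ (Fin n) :=
  (mirror α.highestRoot).toAffineIsometryEquiv.trans
    (AffineIsometryEquiv.constVAdd ℝ _ (coroot α.highestRoot))

/-- The generators `R = {r_0, r_1, …, r_n}` of the affine Weyl group. -/
def generators : Set α.affineWeyl :=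
  {r | (r : EuclideanSpace ℝ (Fin n) ≃ᵃⁱ[ℝ] EuclideanSpace ℝ (Fin n)) = α.affineReflection ∨
    ∃ i, (r : EuclideanSpace ℝ (Fin n) ≃ᵃⁱ[ℝ] EuclideanSpace ℝ (Fin n)) =
      (mirror (α.root i)).toAffineIsometryEquiv}

/-- The sign homomorphism `σ^e`, `σ^e(w) = det w` (which is `±1`). -/
def signDet : α.weyl →* ℤˣ :=
  (Units.map (((SignType.castHom : SignType →*₀ ℤ).comp (signHom : ℝ →*₀ SignType) :
    ℝ →*₀ ℤ) : ℝ →* ℤ)).comp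
  (LinearEquiv.det.comp
    { toFun := fun w : α.weyl => w.1.toLinearEquiv
      map_one' := rfl
      map_mul' := fun _ _ => rfl })

/-- `α i` is a short simple root. -/
def IsShort (i : Fin n) : Prop := ∃ j, ‖α.root i‖ < ‖α.root j‖

/-- `α i` is a long simple root. -/
def IsLong (i : Fin n) : Prop := ∃ j, ‖α.root j‖ < ‖α.root i‖

open Classical in
/-- The sign homomorphism `σ^s`: the homomorphism with value `-1` at the reflections in short simple
roots and `1` at the other simple reflections. -/
def signShort : α.weyl →* ℤˣ :=
  Classical.epsilon fun σ : α.weyl →* ℤˣ =>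
    ∀ i, σ (α.simpleReflection i) = if α.IsShort i then -1 else 1

open Classical in
/-- The sign homomorphism `σ^l`: the homomorphism with value `-1` at the reflections in long simple
roots and `1` at the other simple reflections. -/
def signLong : α.weyl →* ℤˣ :=
  Classical.epsilon fun σ : α.weyl →* ℤˣ =>
    ∀ i, σ (α.simpleReflection i) = if α.IsLong i then -1 else 1

/-- The negative generators `R^σ = {r ∈ R | σ (ψ r) = -1}`. -/
def negGenerators (σ : α.weyl →* ℤˣ) : Set α.affineWeyl :=
  {r ∈ α.generators | σ (α.retraction r) = -1}

/-- The fundamental region `F` of the affine Weyl group. -/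
def fundamentalRegion : Set (EuclideanSpace ℝ (Fin n)) :=
  {a | (∀ i, 0 ≤ inner ℝ a (α.root i)) ∧ inner ℝ a α.highestRoot ≤ 1}

/-- The stabilizer of `a` in `W^aff_σ = {g ∈ W^aff | σ (ψ g) = 1}`. For `σ = 1` this is the
stabilizer in `W^aff`. -/
def stab (σ : α.weyl →* ℤˣ) (a : EuclideanSpace ℝ (Fin n)) : Set α.affineWeyl :=
  {g | σ (α.retraction g) = 1 ∧
    (g : EuclideanSpace ℝ (Fin n) ≃ᵃⁱ[ℝ] EuclideanSpace ℝ (Fin n)) a = a}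

/-- `F^σ = {a ∈ F | σ (ψ (Stab a)) = {1}}`, with the stabilizer taken in `W^aff`. -/
def signRegion (σ : α.weyl →* ℤˣ) : Set (EuclideanSpace ℝ (Fin n)) :=
  {a ∈ α.fundamentalRegion | (fun g => σ (α.retraction g)) '' α.stab 1 a = {1}}

/-- The fundamental domain `F ∪ r F^σ` of `W^aff_σ`, where `r ∈ R^σ`. -/
def evenRegion (σ : α.weyl →* ℤˣ) (r : α.affineWeyl) : Set (EuclideanSpace ℝ (Fin n)) :=
  α.fundamentalRegion ∪
    (r : EuclideanSpace ℝ (Fin n) ≃ᵃⁱ[ℝ] EuclideanSpace ℝ (Fin n)) '' α.signRegion σ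

/-- The boundary part
`H^{τ,σ} = {a ∈ F ∪ r F^σ | τ (ψ (Stab a)) = {±1}}`, with the stabilizer taken in `W^aff_σ`. -/
def evenBoundary (τ σ : α.weyl →* ℤˣ) (r : α.affineWeyl) : Set (EuclideanSpace ℝ (Fin n)) :=
  {a ∈ α.evenRegion σ r | (fun g => τ (α.retraction g)) '' α.stab σ a = {1, -1}}

/-- The grid fragment `F_M^{τ,σ} = (1/M) P^∨ ∩ F^{τ,σ}`, where
`F^{τ,σ} = (F ∪ r F^σ) \ H^{τ,σ}`, formed with the generator `r ∈ R^σ`. -/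
def gridFragment (τ σ : α.weyl →* ℤˣ) (r : α.affineWeyl) (M : ℕ) :
    Set (EuclideanSpace ℝ (Fin n)) :=
  ((M : ℝ)⁻¹ • α.coweightLattice) ∩ (α.evenRegion σ r \ α.evenBoundary τ σ r)

/-- `|F_M^{τ,σ}| = N`: the set `R^σ` is not empty and, for every choice of `r ∈ R^σ`, the set
`F_M^{τ,σ}` is finite with exactly `N` elements. -/
def GridCount (τ σ : α.weyl →* ℤˣ) (M : ℕ) (N : ℤ) : Prop :=
  (α.negGenerators σ).Nonempty ∧ ∀ r ∈ α.negGenerators σ,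
    (α.gridFragment τ σ r M).Finite ∧
      ((α.gridFragment τ σ r M).ncard : ℤ) = N

end SimpleRoots

/-- `|F_M^{τ,σ}(α)| = |F_M^{τ',σ'}(β)|`: the sets `R^σ` and `R^{σ'}` are not empty and the equality
holds for every choice of `r ∈ R^σ` and `r' ∈ R^{σ'}`. -/
def SameGridCount {n : ℕ} {A B : Matrix (Fin n) (Fin n) ℤ} (α : SimpleRoots A)
    (τ σ : α.weyl →* ℤˣ) (β : SimpleRoots B) (τ' σ' : β.weyl →* ℤˣ) (M : ℕ) : Prop :=
  (α.negGenerators σ).Nonempty ∧ (β.negGenerators σ').Nonempty ∧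
  ∀ r ∈ α.negGenerators σ, ∀ r' ∈ β.negGenerators σ',
    (α.gridFragment τ σ r M).encard = (β.gridFragment τ' σ' r' M).encard

/-- The `j`-th entry is the polynomial in `k` for resolution `M = 6 k + j`. -/
def cardG₂OneShort (k : ℤ) : Fin 6 → ℤ :=
  ![
    1 + 3 * k + 6 * k ^ 2,
    1 + 5 * k + 6 * k ^ 2,
    2 + 7 * k + 6 * k ^ 2,
    4 + 9 * k + 6 * k ^ 2,
    5 + 11 * k + 6 * k ^ 2,
    7 + 13 * k + 6 * k ^ 2]

/-- The `j`-th entry is the polynomial in `k` for resolution `M = 6 k + j`. -/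
def cardG₂OneDet (k : ℤ) : Fin 6 → ℤ :=
  ![
    2 + 6 * k ^ 2,
    1 + 2 * k + 6 * k ^ 2,
    2 + 4 * k + 6 * k ^ 2,
    3 + 6 * k + 6 * k ^ 2,
    4 + 8 * k + 6 * k ^ 2,
    5 + 10 * k + 6 * k ^ 2]

/-- The `j`-th entry is the polynomial in `k` for resolution `M = 6 k + j`. -/
def cardG₂LongShort (k : ℤ) : Fin 6 → ℤ :=
  ![
    1 - 3 * k + 6 * k ^ 2,
    -k + 6 * k ^ 2,
    k + 6 * k ^ 2,
    1 + 3 * k + 6 * k ^ 2,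
    1 + 5 * k + 6 * k ^ 2,
    2 + 7 * k + 6 * k ^ 2]

/-- The `j`-th entry is the polynomial in `k` for resolution `M = 6 k + j`. -/
def cardG₂LongDet (k : ℤ) : Fin 6 → ℤ :=
  ![
    6 * k ^ 2,
    2 * k + 6 * k ^ 2,
    4 * k + 6 * k ^ 2,
    2 + 6 * k + 6 * k ^ 2,
    2 + 8 * k + 6 * k ^ 2,
    4 + 10 * k + 6 * k ^ 2]

/-- The `j`-th entry is the polynomial in `k` for resolution `M = 12 k + j`. -/
def cardF₄OneShort (k : ℤ) : Fin 12 → ℤ :=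
  ![
    1 + 8 * k + 25 * k ^ 2 + 36 * k ^ 3 + 36 * k ^ 4,
    1 + 10 * k + 31 * k ^ 2 + 48 * k ^ 3 + 36 * k ^ 4,
    3 + 20 * k + 49 * k ^ 2 + 60 * k ^ 3 + 36 * k ^ 4,
    4 + 25 * k + 61 * k ^ 2 + 72 * k ^ 3 + 36 * k ^ 4,
    8 + 42 * k + 85 * k ^ 2 + 84 * k ^ 3 + 36 * k ^ 4,
    10 + 52 * k + 103 * k ^ 2 + 96 * k ^ 3 + 36 * k ^ 4,
    18 + 78 * k + 133 * k ^ 2 + 108 * k ^ 3 + 36 * k ^ 4,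
    22 + 95 * k + 157 * k ^ 2 + 120 * k ^ 3 + 36 * k ^ 4,
    35 + 132 * k + 193 * k ^ 2 + 132 * k ^ 3 + 36 * k ^ 4,
    43 + 158 * k + 223 * k ^ 2 + 144 * k ^ 3 + 36 * k ^ 4,
    63 + 208 * k + 265 * k ^ 2 + 156 * k ^ 3 + 36 * k ^ 4,
    76 + 245 * k + 301 * k ^ 2 + 168 * k ^ 3 + 36 * k ^ 4]

/-- The `j`-th entry is the polynomial in `k` for resolution `M = 12 k + j`. -/
def cardF₄OneDet (k : ℤ) : Fin 12 → ℤ :=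
  ![
    2 + 52 * k ^ 2 + 36 * k ^ 4,
    1 + 8 * k + 49 * k ^ 2 + 12 * k ^ 3 + 36 * k ^ 4,
    3 + 18 * k + 58 * k ^ 2 + 24 * k ^ 3 + 36 * k ^ 4,
    4 + 26 * k + 61 * k ^ 2 + 36 * k ^ 3 + 36 * k ^ 4,
    8 + 40 * k + 76 * k ^ 2 + 48 * k ^ 3 + 36 * k ^ 4,
    10 + 50 * k + 85 * k ^ 2 + 60 * k ^ 3 + 36 * k ^ 4,
    17 + 70 * k + 106 * k ^ 2 + 72 * k ^ 3 + 36 * k ^ 4,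
    21 + 84 * k + 121 * k ^ 2 + 84 * k ^ 3 + 36 * k ^ 4,
    32 + 112 * k + 148 * k ^ 2 + 96 * k ^ 3 + 36 * k ^ 4,
    39 + 132 * k + 169 * k ^ 2 + 108 * k ^ 3 + 36 * k ^ 4,
    55 + 170 * k + 202 * k ^ 2 + 120 * k ^ 3 + 36 * k ^ 4,
    66 + 198 * k + 229 * k ^ 2 + 132 * k ^ 3 + 36 * k ^ 4]

/-- The `j`-th entry is the polynomial in `k` for resolution `M = 12 k + j`. -/
def cardF₄LongShort (k : ℤ) : Fin 12 → ℤ :=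
  ![
    1 - 8 * k + 25 * k ^ 2 - 36 * k ^ 3 + 36 * k ^ 4,
    -3 * k + 13 * k ^ 2 - 24 * k ^ 3 + 36 * k ^ 4,
    -2 * k + 13 * k ^ 2 - 12 * k ^ 3 + 36 * k ^ 4,
    7 * k ^ 2 + 36 * k ^ 4,
    2 * k + 13 * k ^ 2 + 12 * k ^ 3 + 36 * k ^ 4,
    3 * k + 13 * k ^ 2 + 24 * k ^ 3 + 36 * k ^ 4,
    1 + 8 * k + 25 * k ^ 2 + 36 * k ^ 3 + 36 * k ^ 4,
    1 + 10 * k + 31 * k ^ 2 + 48 * k ^ 3 + 36 * k ^ 4,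
    3 + 20 * k + 49 * k ^ 2 + 60 * k ^ 3 + 36 * k ^ 4,
    4 + 25 * k + 61 * k ^ 2 + 72 * k ^ 3 + 36 * k ^ 4,
    8 + 42 * k + 85 * k ^ 2 + 84 * k ^ 3 + 36 * k ^ 4,
    10 + 52 * k + 103 * k ^ 2 + 96 * k ^ 3 + 36 * k ^ 4]

/-- The `j`-th entry is the polynomial in `k` for resolution `M = 12 k + j`. -/
def cardF₄LongDet (k : ℤ) : Fin 12 → ℤ :=
  ![
    -2 * k ^ 2 + 36 * k ^ 4,
    -k - 5 * k ^ 2 + 12 * k ^ 3 + 36 * k ^ 4,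
    4 * k ^ 2 + 24 * k ^ 3 + 36 * k ^ 4,
    -k + 7 * k ^ 2 + 36 * k ^ 3 + 36 * k ^ 4,
    4 * k + 22 * k ^ 2 + 48 * k ^ 3 + 36 * k ^ 4,
    5 * k + 31 * k ^ 2 + 60 * k ^ 3 + 36 * k ^ 4,
    2 + 16 * k + 52 * k ^ 2 + 72 * k ^ 3 + 36 * k ^ 4,
    2 + 21 * k + 67 * k ^ 2 + 84 * k ^ 3 + 36 * k ^ 4,
    6 + 40 * k + 94 * k ^ 2 + 96 * k ^ 3 + 36 * k ^ 4,
    8 + 51 * k + 115 * k ^ 2 + 108 * k ^ 3 + 36 * k ^ 4,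
    16 + 80 * k + 148 * k ^ 2 + 120 * k ^ 3 + 36 * k ^ 4,
    20 + 99 * k + 175 * k ^ 2 + 132 * k ^ 3 + 36 * k ^ 4]

end

/-! Every count reduces to counting lattice points in dilated simplices. Conjugation by `r` carries
the stabilizer of `a` to that of `r a` and does not change signs. So the fragment is the disjoint
union of the grid points of `F` where `τ` is trivial on the part of the stabilizer with `σ = 1`, and
the `r`-image of the grid points of `F` where `σ` and `τ` are both trivial on the whole stabilizer
(`gridFragment_eq`, `gridCount_of_ncard`).

These conditions depend only on the walls through `a`: `σ^s` (resp. `σ^l`) is trivial on the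
stabilizer of `a ∈ F` exactly when `a` is on no short (resp. long) wall, the affine wall being long
because the highest root is long (`signShort_stab`, `signLong_stab`). One implication is given by
wall reflections. The other does not use that stabilizers are generated by reflections: each sign is
the parity of the number of positive roots of one length made negative, and a parity count with
floors of root values (`char_eq_one_of_fixed`) shows that it is `1` on the stabilizer of a point
where no root of that length is integral. Arithmetic of coefficients modulo the squared length ratio
`p` turns integrality of a root at `a ∈ F` into a wall of the same length.

In coordinates `s_i = M⟨a, α_i⟩` the grid points of `F` are the `s ∈ ℕⁿ` with `∑ m_i s_i ≤ M`, where
the `m_i` are the marks (coefficients of the highest root). Leaving out walls means `s_i ≥ 1` or a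
strict inequality; translating, the bound drops by `hs` (sum of the short marks) or `hl` (one plus
the sum of the long marks). With `L` the lattice point count, all cardinalities are sums of two of
`L(M)`, `L(M - hs)`, `L(M - hl)`, `L(M - hs - hl)` (`gridCounts`).

The pair `(hs, hl)` is `(2(n-1), 2)` for `C_n`, the reverse for `B_n` with the same marks up to
order, `(3, 3)` for `G₂` and `(6, 6)` for `F₄`; this explains all the coincidences between families.
`L` is computed by adjoining the marks one at a time: Pascal's rule gives the binomials of `C_n`,
and quasi-polynomials of period 6 and 12 serve `G₂` and `F₄`. -/

noncomputable section

/-! ### Integral combinations of simple roots, the Weyl group and the roots -/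

namespace SimpleRoots

variable {n : ℕ} {A : Matrix (Fin n) (Fin n) ℤ} (α : SimpleRoots A)

/-- The integral combination of the simple roots with coefficients `k`. -/
def comb (k : Fin n → ℤ) : EuclideanSpace ℝ (Fin n) := ∑ i, k i • α.root i

theorem comb_add (k l : Fin n → ℤ) : α.comb (k + l) = α.comb k + α.comb l := by
  simp [comb, add_smul, Finset.sum_add_distrib]

theorem comb_neg (k : Fin n → ℤ) : α.comb (-k) = -α.comb k := by
  simp [comb]

theorem comb_sub (k l : Fin n → ℤ) : α.comb (k - l) = α.comb k - α.comb l := by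
  rw [sub_eq_add_neg, comb_add, comb_neg, sub_eq_add_neg]

theorem comb_single (i : Fin n) (c : ℤ) : α.comb (Pi.single i c) = c • α.root i := by
  rw [comb, Finset.sum_eq_single i]
  · simp
  · intro j _ hj; simp [hj]
  · simp

theorem comb_injective : Function.Injective α.comb := by
  intro k l h
  have h1 := Fintype.linearIndependent_iff.1 α.linearIndependent (fun i => ((k i - l i : ℤ) : ℝ))
    (by
      have : α.comb (k - l) = 0 := by rw [comb_sub, h, sub_self]
      simpa only [comb, Pi.sub_apply, ← Int.cast_smul_eq_zsmul ℝ] using this)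
  funext i
  have := h1 i
  rw [Int.cast_eq_zero] at this
  omega

theorem inner_comb (k : Fin n → ℤ) (a : EuclideanSpace ℝ (Fin n)) :
    inner ℝ a (α.comb k) = ∑ i, (k i : ℝ) * inner ℝ a (α.root i) := by
  simp only [comb, inner_sum, ← Int.cast_smul_eq_zsmul ℝ, inner_smul_right]

theorem root_ne_zero (i : Fin n) : α.root i ≠ 0 := α.linearIndependent.ne_zero i

theorem inner_root_coroot (i j : Fin n) :
    inner ℝ (α.root i) (coroot (α.root j)) = (A i j : ℝ) := by
  rw [← α.cartan i j, coroot, inner_smul_right]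
  ring

theorem inner_comb_coroot (k : Fin n → ℤ) (j : Fin n) :
    inner ℝ (α.comb k) (coroot (α.root j)) = ((∑ i, k i * A i j : ℤ) : ℝ) := by
  simp only [comb, sum_inner, ← Int.cast_smul_eq_zsmul ℝ, inner_smul_left, inner_root_coroot]
  simp

theorem mirror_eq_sub (v x : EuclideanSpace ℝ (Fin n)) :
    mirror v x = x - (inner ℝ x (coroot v) : ℝ) • v := by
  rw [mirror_apply, coroot, smul_smul, inner_smul_right, real_inner_comm]
  ring_nf

theorem mirror_self (v : EuclideanSpace ℝ (Fin n)) : mirror v v = -v := by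
  rw [mirror, Submodule.reflection_orthogonal_apply, Submodule.reflection_mem_subspace_eq_self]
  exact Submodule.mem_span_singleton_self v

theorem mirror_mirror (v x : EuclideanSpace ℝ (Fin n)) : mirror v (mirror v x) = x :=
  Submodule.reflection_reflection _ _

theorem mirror_comb (k : Fin n → ℤ) (j : Fin n) :
    mirror (α.root j) (α.comb k) = α.comb (k - Pi.single j (∑ i, k i * A i j)) := by
  rw [mirror_eq_sub, inner_comb_coroot, comb_sub, comb_single, Int.cast_smul_eq_zsmul]

theorem root_eq_comb (i : Fin n) : α.root i = α.comb (Pi.single i 1) := by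
  rw [comb_single, one_smul]

theorem mirror_mem_weyl (i : Fin n) : mirror (α.root i) ∈ α.weyl :=
  Subgroup.subset_closure ⟨i, rfl⟩

theorem root_mem_roots (i : Fin n) : α.root i ∈ α.roots := ⟨1, one_mem _, i, rfl⟩

variable {α} in
theorem weyl_apply_mem_roots {w : EuclideanSpace ℝ (Fin n) ≃ₗᵢ[ℝ] EuclideanSpace ℝ (Fin n)}
    (hw : w ∈ α.weyl) {β : EuclideanSpace ℝ (Fin n)} (hβ : β ∈ α.roots) : w β ∈ α.roots := by
  obtain ⟨v, hv, i, rfl⟩ := hβ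
  exact ⟨w * v, mul_mem hw hv, i, rfl⟩

variable {α} in
theorem neg_mem_roots {β : EuclideanSpace ℝ (Fin n)} (hβ : β ∈ α.roots) : -β ∈ α.roots := by
  obtain ⟨v, hv, i, rfl⟩ := hβ
  refine ⟨v * mirror (α.root i), mul_mem hv (α.mirror_mem_weyl i), i, ?_⟩
  change -v (α.root i) = v (mirror (α.root i) (α.root i))
  rw [mirror_self, map_neg]

variable {α} in
theorem weyl_induction
    {p : (EuclideanSpace ℝ (Fin n) ≃ₗᵢ[ℝ] EuclideanSpace ℝ (Fin n)) → Prop} (one : p 1)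
    (mul : ∀ i w, w ∈ α.weyl → p w → p (mirror (α.root i) * w))
    {w : EuclideanSpace ℝ (Fin n) ≃ₗᵢ[ℝ] EuclideanSpace ℝ (Fin n)} (hw : w ∈ α.weyl) : p w := by
  induction hw using Subgroup.closure_induction_left with
  | one => exact one
  | mul_left x hx y hy ih =>
    obtain ⟨i, rfl⟩ := hx
    exact mul i y hy ih
  | inv_mul_cancel x hx y hy ih =>
    obtain ⟨i, rfl⟩ := hx
    have h : (mirror (α.root i))⁻¹ = mirror (α.root i) := by
      rw [mirror, Submodule.reflection_inv]
    rw [h]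
    exact mul i y hy ih

variable {α} in
theorem roots_induction {p : EuclideanSpace ℝ (Fin n) → Prop} (root : ∀ i, p (α.root i))
    (mirror : ∀ j β, β ∈ α.roots → p β → p (mirror (α.root j) β))
    {β : EuclideanSpace ℝ (Fin n)} (hβ : β ∈ α.roots) : p β := by
  obtain ⟨w, hw, i, rfl⟩ := hβ
  refine weyl_induction (p := fun w => p (w (α.root i))) (root i) ?_ hw
  intro j w hw ih
  exact mirror j _ ⟨w, hw, i, rfl⟩ ih

theorem mirror_map (w : EuclideanSpace ℝ (Fin n) ≃ₗᵢ[ℝ] EuclideanSpace ℝ (Fin n))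
    (v : EuclideanSpace ℝ (Fin n)) : mirror (w v) = w * mirror v * w⁻¹ := by
  ext1 x
  have hx : w (w⁻¹ x) = x := w.apply_symm_apply x
  change mirror (w v) x = w (mirror v (w⁻¹ x))
  rw [mirror_apply, mirror_apply,
    map_sub, map_smul, hx, coroot, coroot, map_smul, LinearIsometryEquiv.inner_map_map]
  congr 2
  conv_lhs => rw [← hx, LinearIsometryEquiv.inner_map_map]

variable {α} in
theorem mirror_mem_weyl_of_mem_roots {β : EuclideanSpace ℝ (Fin n)} (hβ : β ∈ α.roots) :
    mirror β ∈ α.weyl := by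
  obtain ⟨w, hw, i, rfl⟩ := hβ
  rw [mirror_map]
  exact mul_mem (mul_mem hw (α.mirror_mem_weyl i)) (inv_mem hw)

variable {α} in
theorem exists_comb_of_mem_roots {β : EuclideanSpace ℝ (Fin n)} (hβ : β ∈ α.roots) :
    ∃ k : Fin n → ℤ, β = α.comb k := by
  refine roots_induction (p := fun β => ∃ k : Fin n → ℤ, β = α.comb k)
    (fun i => ⟨_, α.root_eq_comb i⟩) ?_ hβ
  rintro j _ _ ⟨k, rfl⟩
  exact ⟨_, α.mirror_comb k j⟩

variable {α} in
theorem coroot_mem_corootLattice {β : EuclideanSpace ℝ (Fin n)} (hβ : β ∈ α.roots) :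
    coroot β ∈ α.corootLattice := by
  obtain ⟨w, hw, i, rfl⟩ := hβ
  have : coroot (w (α.root i)) = w (coroot (α.root i)) := by
    rw [coroot, coroot, LinearIsometryEquiv.inner_map_map, map_smul]
  rw [this]
  exact α.weyl_corootLattice hw _ (AddSubgroup.subset_closure ⟨i, rfl⟩)

theorem inner_comb_corootLattice (k : Fin n → ℤ) {q : EuclideanSpace ℝ (Fin n)}
    (hq : q ∈ α.corootLattice) : ∃ z : ℤ, inner ℝ (α.comb k) q = (z : ℝ) := by
  induction hq using AddSubgroup.closure_induction with
  | mem x hx => obtain ⟨j, rfl⟩ := hx; exact ⟨_, α.inner_comb_coroot k j⟩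
  | zero => exact ⟨0, by simp⟩
  | add x y _ _ hx hy =>
    obtain ⟨a, ha⟩ := hx
    obtain ⟨b, hb⟩ := hy
    exact ⟨a + b, by rw [inner_add_right, ha, hb]; push_cast; ring⟩
  | neg x _ hx =>
    obtain ⟨a, ha⟩ := hx
    exact ⟨-a, by rw [inner_neg_right, ha]; push_cast; ring⟩

/-! ### Sign characters as parities of inversions -/

/-- A choice of positive elements in a Weyl-invariant symmetric set of integral vectors which is
preserved by every simple reflection `r_i` up to the vector `α_i`. -/
structure IsHalfSystem (P : Finset (EuclideanSpace ℝ (Fin n))) : Prop where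
  neg_notMem : ∀ β ∈ P, -β ∉ P
  weyl_mem : ∀ w ∈ α.weyl, ∀ β ∈ P, w β ∈ P ∨ -w β ∈ P
  mirror_mem : ∀ i, ∀ β ∈ P, β ≠ α.root i → mirror (α.root i) β ∈ P
  exists_comb : ∀ β ∈ P, ∃ k, β = α.comb k

open Classical in
/-- The sign of `β` relative to the set `P` of positive vectors. -/
def halfSign (P : Finset (EuclideanSpace ℝ (Fin n))) (β : EuclideanSpace ℝ (Fin n)) : ℤˣ :=
  if β ∈ P then 1 else -1

namespace IsHalfSystem

variable {α} {P : Finset (EuclideanSpace ℝ (Fin n))} (hP : α.IsHalfSystem P)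
include hP

omit hP in
theorem halfSign_of_mem {β : EuclideanSpace ℝ (Fin n)} (h : β ∈ P) : halfSign P β = 1 := if_pos h

theorem halfSign_of_neg_mem {β : EuclideanSpace ℝ (Fin n)} (h : -β ∈ P) : halfSign P β = -1 :=
  if_neg fun h' => hP.neg_notMem _ h' h

theorem smul_mem {w : EuclideanSpace ℝ (Fin n) ≃ₗᵢ[ℝ] EuclideanSpace ℝ (Fin n)} (hw : w ∈ α.weyl)
    {β : EuclideanSpace ℝ (Fin n)} (h : β ∈ P) : ((halfSign P (w β) : ℤˣ) : ℤ) • w β ∈ P := by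
  rcases hP.weyl_mem w hw β h with h1 | h1
  · rw [halfSign_of_mem h1]; simpa using h1
  · rw [hP.halfSign_of_neg_mem h1]; simpa using h1

/-- This makes `β ↦ ± w β` and `β ↦ ± w⁻¹ β` mutually inverse permutations of `P`. -/
theorem smul_smul_cancel
    {w v : EuclideanSpace ℝ (Fin n) ≃ₗᵢ[ℝ] EuclideanSpace ℝ (Fin n)} (hw : w ∈ α.weyl)
    (hv : ∀ x, v (w x) = x) {β : EuclideanSpace ℝ (Fin n)} (h : β ∈ P) :
    ((halfSign P (v (((halfSign P (w β) : ℤˣ) : ℤ) • w β)) : ℤˣ) : ℤ) •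
      v (((halfSign P (w β) : ℤˣ) : ℤ) • w β) = β := by
  rcases hP.weyl_mem w hw β h with h1 | h1
  · rw [halfSign_of_mem h1]
    simp [hv, halfSign_of_mem h]
  · rw [hP.halfSign_of_neg_mem h1]
    simp [hv, hP.halfSign_of_neg_mem (β := -β) (by simpa using h)]

/-- Reindexing a product over `P` by `β ↦ ± w β`. -/
theorem prod_reindex {M : Type*} [CommMonoid M]
    {w : EuclideanSpace ℝ (Fin n) ≃ₗᵢ[ℝ] EuclideanSpace ℝ (Fin n)} (hw : w ∈ α.weyl)
    (f : EuclideanSpace ℝ (Fin n) → M) :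
    ∏ β ∈ P, f (((halfSign P (w β) : ℤˣ) : ℤ) • w β) = ∏ β ∈ P, f β :=
  Finset.prod_nbij' (fun β => ((halfSign P (w β) : ℤˣ) : ℤ) • w β)
    (fun β => ((halfSign P (w⁻¹ β) : ℤˣ) : ℤ) • w⁻¹ β)
    (fun _ h => hP.smul_mem hw h) (fun _ h => hP.smul_mem (inv_mem hw) h)
    (fun _ h => hP.smul_smul_cancel hw (fun x => w.symm_apply_apply x) h)
    (fun _ h => hP.smul_smul_cancel (inv_mem hw) (fun x => w.apply_symm_apply x) h)
    (fun _ _ => rfl)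

/-- The character of the Weyl group given by the parity of the number of positive vectors
made negative. -/
def char : α.weyl →* ℤˣ where
  toFun w := ∏ β ∈ P, halfSign P (w.1 β)
  map_one' := Finset.prod_eq_one fun β h => halfSign_of_mem h
  map_mul' w v := by
    -- Reindexing the inversions of `w` along `β ↦ ± v β` makes multiplicativity hold factor by
    -- factor: the sign of `w v β` is that of `w (± v β)` times that of `v β`.
    rw [← hP.prod_reindex v.2 (fun β => halfSign P (w.1 β)), ← Finset.prod_mul_distrib]
    refine Finset.prod_congr rfl fun β h => ?_
    change halfSign P (w.1 (v.1 β)) = _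
    rcases hP.weyl_mem v.1 v.2 β h with h1 | h1
    · simp [halfSign_of_mem h1]
    · rw [hP.halfSign_of_neg_mem h1]
      rcases hP.weyl_mem w.1 w.2 _ h1 with h2 | h2
      · have h3 := h2
        rw [map_neg] at h3
        simp [halfSign_of_mem h3, hP.halfSign_of_neg_mem h3]
      · have h3 := h2
        rw [map_neg, neg_neg] at h3
        simp [halfSign_of_mem h3, hP.halfSign_of_neg_mem (β := -w.1 (v.1 β)) (by simpa using h3)]

theorem char_simpleReflection_of_mem {i : Fin n} (h : α.root i ∈ P) :
    hP.char (α.simpleReflection i) = -1 := by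
  change ∏ β ∈ P, halfSign P (mirror (α.root i) β) = -1
  rw [Finset.prod_eq_single_of_mem _ h]
  · rw [mirror_self]
    exact hP.halfSign_of_neg_mem (by simpa using h)
  · exact fun β hβ hne => halfSign_of_mem (hP.mirror_mem i β hβ hne)

theorem char_simpleReflection_of_notMem {i : Fin n} (h : α.root i ∉ P) :
    hP.char (α.simpleReflection i) = 1 :=
  Finset.prod_eq_one fun β hβ =>
    halfSign_of_mem (hP.mirror_mem i β hβ fun h' => h (h' ▸ hβ))

/-- The reflection `r_i` permutes `P` without `α_i`; if `α_i` belongs to `P`, it is negated and the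
sum loses `2 α_i`. -/
theorem mirror_sum (i : Fin n) :
    ∃ z : ℤ, mirror (α.root i) (∑ β ∈ P, β) = ∑ β ∈ P, β - (2 * z) • α.root i := by
  classical
  have hinj : ∀ Q : Finset (EuclideanSpace ℝ (Fin n)), (∀ β ∈ Q, mirror (α.root i) β ∈ Q) →
      mirror (α.root i) (∑ β ∈ Q, β) = ∑ β ∈ Q, β := by
    intro Q hQ
    rw [map_sum]
    exact Finset.sum_nbij' (fun β => mirror (α.root i) β) (fun β => mirror (α.root i) β) hQ hQ
      (fun β _ => mirror_mirror _ β) (fun β _ => mirror_mirror _ β) (fun _ _ => rfl)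
  by_cases h : α.root i ∈ P
  · refine ⟨1, ?_⟩
    rw [← Finset.add_sum_erase P _ h, map_add, hinj (P.erase (α.root i)), mirror_self]
    · module
    · intro β hβ
      obtain ⟨h1, h2⟩ := Finset.mem_erase.1 hβ
      refine Finset.mem_erase.2 ⟨fun h3 => ?_, hP.mirror_mem i β h2 h1⟩
      have h4 : β = -α.root i := by rw [← mirror_mirror (α.root i) β, h3, mirror_self]
      exact hP.neg_notMem _ h (h4 ▸ h2)
  · refine ⟨0, ?_⟩
    rw [hinj P fun β hβ => hP.mirror_mem i β hβ fun h' => h (h' ▸ hβ)]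
    simp

/-- The sum of `P` plays the part of `2ρ`: by `mirror_sum` its pairing with each simple coroot is
even. -/
theorem even_inner_sum {q : EuclideanSpace ℝ (Fin n)} (hq : q ∈ α.corootLattice) :
    ∃ z : ℤ, inner ℝ (∑ β ∈ P, β) q = ((2 * z : ℤ) : ℝ) := by
  induction hq using AddSubgroup.closure_induction with
  | mem x hx =>
    obtain ⟨i, rfl⟩ := hx
    obtain ⟨z, hz⟩ := hP.mirror_sum i
    refine ⟨z, ?_⟩
    rw [mirror_eq_sub] at hz
    have h1 := sub_right_injective hz
    rw [← Int.cast_smul_eq_zsmul ℝ] at h1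
    exact smul_left_injective ℝ (α.root_ne_zero i) h1
  | zero => exact ⟨0, by simp⟩
  | add x y _ _ hx hy =>
    obtain ⟨a, ha⟩ := hx
    obtain ⟨b, hb⟩ := hy
    exact ⟨a + b, by rw [inner_add_right, ha, hb]; push_cast; ring⟩
  | neg x _ hx =>
    obtain ⟨a, ha⟩ := hx
    exact ⟨-a, by rw [inner_neg_right, ha]; push_cast; ring⟩

omit hP in
theorem prod_negOnePow (Q : Finset (EuclideanSpace ℝ (Fin n)))
    (z : EuclideanSpace ℝ (Fin n) → ℤ) :
    ∏ β ∈ Q, (z β).negOnePow = (∑ β ∈ Q, z β).negOnePow := by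
  classical
  induction Q using Finset.induction_on with
  | empty => simp
  | insert b s hb ih => rw [Finset.prod_insert hb, Finset.sum_insert hb, Int.negOnePow_add, ih]

omit hP in
theorem affine_apply (g : EuclideanSpace ℝ (Fin n) ≃ᵃⁱ[ℝ] EuclideanSpace ℝ (Fin n))
    (a : EuclideanSpace ℝ (Fin n)) : g a = g.linearIsometryEquiv a + g 0 := by
  simpa using g.map_vadd 0 a

/-- If no vector of `P` takes an integral value at `a`, then the character is trivial on the
stabilizer of `a` in the affine Weyl group. -/
theorem char_eq_one_of_fixed {a : EuclideanSpace ℝ (Fin n)}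
    (ha : ∀ β ∈ P, ∀ z : ℤ, inner ℝ β a ≠ (z : ℝ)) {g : α.affineWeyl} (hg : g.1 a = a) :
    hP.char (α.retraction g) = 1 := by
  have hw : g.1.linearIsometryEquiv ∈ α.weyl := g.2.1
  have hq : g.1 0 ∈ α.corootLattice := g.2.2
  set w := g.1.linearIsometryEquiv with hw_def
  set q := g.1 0 with hq_def
  have hga : w a + q = a := by rw [hw_def, hq_def, ← affine_apply, hg]
  have hz : ∀ β ∈ P, ∃ z : ℤ, inner ℝ β q = (z : ℝ) := by
    intro β hβ
    obtain ⟨k, rfl⟩ := hP.exists_comb β hβ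
    exact α.inner_comb_corootLattice k hq
  choose! z hz using hz
  have heven : Even (∑ β ∈ P, z β) := by
    obtain ⟨y, hy⟩ := hP.even_inner_sum hq
    refine ⟨y, ?_⟩
    rw [sum_inner, Finset.sum_congr rfl hz] at hy
    rw [← two_mul]
    exact_mod_cast hy
  -- From `w a + q = a` one gets `⟨w β, a⟩ = ⟨β, a⟩ + ⟨w β, q⟩` with an integral last term. The
  -- floor therefore changes by that integer, and by one more modulo 2 when `w β` is negative.
  have key : ∀ β ∈ P, (⌊(inner ℝ (((halfSign P (w β) : ℤˣ) : ℤ) • w β) a : ℝ)⌋).negOnePow =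
      (⌊(inner ℝ β a : ℝ)⌋).negOnePow * halfSign P (w β) *
        (z (((halfSign P (w β) : ℤˣ) : ℤ) • w β)).negOnePow := by
    intro β hβ
    have e1 : (inner ℝ (w β) a : ℝ) = inner ℝ β a + inner ℝ (w β) q := by
      conv_lhs => rw [← hga]
      rw [inner_add_right, LinearIsometryEquiv.inner_map_map]
    rcases hP.weyl_mem w hw β hβ with h1 | h1
    · rw [halfSign_of_mem h1]
      simp only [Units.val_one, one_smul, mul_one]
      rw [e1, hz _ h1, Int.floor_add_intCast, Int.negOnePow_add]
    · rw [hP.halfSign_of_neg_mem h1]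
      simp only [Units.val_neg, Units.val_one, neg_smul, one_smul]
      have e2 : (inner ℝ (-w β) a : ℝ) = -inner ℝ β a + (z (-w β) : ℤ) := by
        rw [← hz _ h1, inner_neg_left, inner_neg_left, e1]
        ring
      -- `⌊-x⌋ = -⌊x⌋ - 1` holds because `x` is not an integer.
      have e3 : ⌊-(inner ℝ β a : ℝ)⌋ = -⌊(inner ℝ β a : ℝ)⌋ - 1 := by
        rw [Int.floor_eq_iff]
        have l1 := Int.floor_le (inner ℝ β a : ℝ)
        have l2 := Int.lt_floor_add_one (inner ℝ β a : ℝ)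
        have l3 := lt_of_le_of_ne l1 (ha β hβ _).symm
        push_cast
        constructor <;> linarith
      rw [e2, Int.floor_add_intCast, e3, Int.negOnePow_add, Int.negOnePow_sub, Int.negOnePow_neg,
        Int.negOnePow_one]
  -- In the product over `P` the floor signs occur on both sides up to the permutation `± w` and
  -- cancel. What remains is the character of `w` times `(-1)` to the power `⟨∑ β, q⟩`, which is
  -- even.
  have h2 := Finset.prod_congr rfl key
  rw [hP.prod_reindex hw (fun β => (⌊(inner ℝ β a : ℝ)⌋).negOnePow), Finset.prod_mul_distrib,
    Finset.prod_mul_distrib, hP.prod_reindex hw (fun β => (z β).negOnePow)] at h2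
  rw [prod_negOnePow P z, Int.negOnePow_even _ heven, mul_one] at h2
  exact (mul_eq_left.1 h2.symm)

end IsHalfSystem

end SimpleRoots

/-! ### Two root lengths: divisibility of coefficients and the characters `σ^s`, `σ^l` -/

namespace SimpleRoots

variable {n : ℕ} {A : Matrix (Fin n) (Fin n) ℤ} (α : SimpleRoots A)

/-- `α` is a system of simple roots with two root lengths of ratio `√p`, with long simple roots
those satisfying `lng`, and highest root with coefficients `m`. -/
structure HasTwoLengths (m : Fin n → ℕ) (lng : Fin n → Prop) (p : ℕ) (c : ℝ) : Prop where
  prime : p.Prime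
  pos : 0 < c
  inner_long : ∀ i, lng i → inner ℝ (α.root i) (α.root i) = p * c
  inner_short : ∀ i, ¬ lng i → inner ℝ (α.root i) (α.root i) = c
  exists_long : ∃ i, lng i
  exists_short : ∃ i, ¬ lng i
  marks_pos : ∀ i, 0 < m i
  highest_mem : ∃ w ∈ α.weyl, ∃ i, lng i ∧ α.comb (fun i => (m i : ℤ)) = w (α.root i)
  bounds : ∀ β ∈ α.roots, ∃ k : Fin n → ℤ, β = α.comb k ∧
    ((∀ i, 0 ≤ k i ∧ k i ≤ m i) ∨ ∀ i, -(m i : ℤ) ≤ k i ∧ k i ≤ 0)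

/-- The positive roots of squared length `d`. -/
def posRoots (d : ℝ) : Set (EuclideanSpace ℝ (Fin n)) :=
  {β | β ∈ α.roots ∧ inner ℝ β β = d ∧ ∃ k : Fin n → ℤ, (∀ i, 0 ≤ k i) ∧ β = α.comb k}

theorem weyl_hom_ext {M : Type*} [Monoid M] {σ τ : α.weyl →* M}
    (h : ∀ i, σ (α.simpleReflection i) = τ (α.simpleReflection i)) : σ = τ := by
  ext ⟨w, hw⟩
  refine weyl_induction (α := α) (p := fun w => ∀ hw : w ∈ α.weyl, σ ⟨w, hw⟩ = τ ⟨w, hw⟩)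
    ?_ ?_ hw hw
  · intro h1
    exact (map_one σ).trans (map_one τ).symm
  · intro i w hw ih h1
    have : (⟨mirror (α.root i) * w, h1⟩ : α.weyl) = α.simpleReflection i * ⟨w, hw⟩ := rfl
    rw [this, map_mul, map_mul, h, ih]

/-- The squared length of elements of a lattice whose generators have Gram matrix with entries
in `d / 2` times the integers, and diagonal entries in `d` times the integers. -/
theorem inner_self_closure {G : Set (EuclideanSpace ℝ (Fin n))} {d : ℝ}
    (h1 : ∀ x ∈ G, ∃ z : ℤ, inner ℝ x x = d * z)
    (h2 : ∀ x ∈ G, ∀ y ∈ G, ∃ z : ℤ, 2 * inner ℝ x y = d * z)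
    {x : EuclideanSpace ℝ (Fin n)} (hx : x ∈ AddSubgroup.closure G) :
    ∃ z : ℤ, inner ℝ x x = d * z := by
  have h3 : ∀ x ∈ AddSubgroup.closure G, ∀ y ∈ G, ∃ z : ℤ, 2 * inner ℝ x y = d * z := by
    intro x hx y hy
    induction hx using AddSubgroup.closure_induction with
    | mem x hx => exact h2 x hx y hy
    | zero => exact ⟨0, by simp⟩
    | add x x' _ _ hx hx' =>
      obtain ⟨a, ha⟩ := hx
      obtain ⟨b, hb⟩ := hx'
      exact ⟨a + b, by rw [inner_add_left, mul_add, ha, hb]; push_cast; ring⟩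
    | neg x _ hx =>
      obtain ⟨a, ha⟩ := hx
      exact ⟨-a, by rw [inner_neg_left, mul_neg, ha]; push_cast; ring⟩
  have h4 : ∀ x ∈ AddSubgroup.closure G, ∀ y ∈ AddSubgroup.closure G,
      ∃ z : ℤ, 2 * inner ℝ x y = d * z := by
    intro x hx y hy
    induction hy using AddSubgroup.closure_induction with
    | mem y hy => exact h3 x hx y hy
    | zero => exact ⟨0, by simp⟩
    | add y y' _ _ hy hy' =>
      obtain ⟨a, ha⟩ := hy
      obtain ⟨b, hb⟩ := hy'
      exact ⟨a + b, by rw [inner_add_right, mul_add, ha, hb]; push_cast; ring⟩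
    | neg y _ hy =>
      obtain ⟨a, ha⟩ := hy
      exact ⟨-a, by rw [inner_neg_right, mul_neg, ha]; push_cast; ring⟩
  induction hx using AddSubgroup.closure_induction with
  | mem x hx => exact h1 x hx
  | zero => exact ⟨0, by simp⟩
  | add x y hx hy ihx ihy =>
    obtain ⟨a, ha⟩ := ihx
    obtain ⟨b, hb⟩ := ihy
    obtain ⟨e, he⟩ := h4 x hx y hy
    refine ⟨a + b + e, ?_⟩
    rw [inner_add_add_self, ha, hb, real_inner_comm x y]
    push_cast
    linarith
  | neg x _ hx =>
    obtain ⟨a, ha⟩ := hx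
    exact ⟨a, by rw [inner_neg_neg, ha]⟩

theorem two_inner_root (i j : Fin n) : 2 * inner ℝ (α.root i) (α.root j) =
    (A i j : ℝ) * inner ℝ (α.root j) (α.root j) := by
  rw [← α.cartan i j, div_mul_cancel₀]
  exact (inner_self_ne_zero (𝕜 := ℝ)).2 (α.root_ne_zero j)

theorem signDet_simpleReflection (i : Fin n) : α.signDet (α.simpleReflection i) = -1 := by
  have h : LinearMap.det ((mirror (α.root i)).toLinearEquiv.toLinearMap) = -1 := by
    have := Submodule.det_reflection (Submodule.span ℝ {α.root i})ᗮ
    rw [Submodule.orthogonal_orthogonal, finrank_span_singleton (α.root_ne_zero i), pow_one] at this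
    exact this
  ext
  have h1 : ((α.signDet (α.simpleReflection i) : ℤˣ) : ℤ) = ((SignType.sign
      ((LinearEquiv.det (mirror (α.root i)).toLinearEquiv : ℝˣ) : ℝ) : SignType) : ℤ) := rfl
  rw [h1, LinearEquiv.coe_det, h]
  simp

namespace HasTwoLengths

variable {α} {m : Fin n → ℕ} {lng : Fin n → Prop} {p : ℕ} {c : ℝ} (h : α.HasTwoLengths m lng p c)
include h

theorem pc_pos : 0 < (p : ℝ) * c := mul_pos (by exact_mod_cast h.prime.pos) h.pos

theorem lt_pc : c < (p : ℝ) * c := by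
  have h1 : (1 : ℝ) < p := by exact_mod_cast h.prime.one_lt
  nlinarith [h.pos]

theorem norm_lt_iff (i j : Fin n) : ‖α.root i‖ < ‖α.root j‖ ↔ ¬ lng i ∧ lng j := by
  rw [← sq_lt_sq₀ (norm_nonneg _) (norm_nonneg _), ← real_inner_self_eq_norm_sq,
    ← real_inner_self_eq_norm_sq]
  have := h.lt_pc
  by_cases hi : lng i <;> by_cases hj : lng j <;>
    simp only [hi, hj, h.inner_long, h.inner_short, not_true_eq_false, not_false_eq_true,
      iff_false, iff_true, and_false, and_true] <;> linarith

theorem isShort_iff (i : Fin n) : α.IsShort i ↔ ¬ lng i := by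
  obtain ⟨j, hj⟩ := h.exists_long
  exact ⟨fun ⟨j, hj⟩ => ((h.norm_lt_iff i j).1 hj).1, fun hi => ⟨j, (h.norm_lt_iff i j).2 ⟨hi, hj⟩⟩⟩

theorem isLong_iff (i : Fin n) : α.IsLong i ↔ lng i := by
  obtain ⟨j, hj⟩ := h.exists_short
  exact ⟨fun ⟨j, hj⟩ => ((h.norm_lt_iff j i).1 hj).2, fun hi => ⟨j, (h.norm_lt_iff j i).2 ⟨hj, hi⟩⟩⟩

theorem isHighestRoot : α.IsHighestRoot (α.comb fun i => (m i : ℤ)) := by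
  obtain ⟨w, hw, i, hi, e⟩ := h.highest_mem
  refine ⟨⟨w, hw, i, e⟩, fun β hβ => ?_⟩
  obtain ⟨k, rfl, hk⟩ := h.bounds β hβ
  have hk' : ∀ i, 0 ≤ (m i : ℤ) - k i := by
    intro i
    rcases hk with hk | hk
    · have := (hk i).2; omega
    · have := (hk i).2; omega
  refine ⟨fun i => ((m i : ℤ) - k i).toNat, ?_⟩
  rw [← comb_sub, comb]
  refine Finset.sum_congr rfl fun i _ => ?_
  rw [← natCast_zsmul, Int.toNat_of_nonneg (hk' i)]
  rfl

/-- The definition chooses some highest root. Two highest roots exceed each other by nonnegative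
combinations whose sum is zero, so they agree by linear independence. -/
theorem highestRoot_eq : α.highestRoot = α.comb fun i => (m i : ℤ) := by
  have h1 : α.IsHighestRoot α.highestRoot := Classical.epsilon_spec ⟨_, h.isHighestRoot⟩
  obtain ⟨k, hk⟩ := h1.2 _ h.isHighestRoot.1
  obtain ⟨l, hl⟩ := h.isHighestRoot.2 _ h1.1
  have h2 : α.comb (fun i => (k i : ℤ) + l i) = α.comb 0 := by
    have e : ∀ k : Fin n → ℕ, ∑ i, k i • α.root i = α.comb fun i => (k i : ℤ) := fun k => by
      simp [comb]
    rw [e] at hk hl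
    have := α.comb_add (fun i => (k i : ℤ)) (fun i => (l i : ℤ))
    rw [← hk, ← hl] at this
    refine (Eq.trans (congrArg _ rfl) this).trans ?_
    simp [comb]
  have h3 := α.comb_injective h2
  have h4 : k = 0 := by
    funext i
    have := congrFun h3 i
    simp only [Pi.zero_apply] at this ⊢
    omega
  rw [h4] at hk
  simpa [sub_eq_zero] using hk

theorem highestRoot_mem : α.highestRoot ∈ α.roots := h.highestRoot_eq ▸ h.isHighestRoot.1

theorem cartan_long_short {l s : Fin n} (hl : lng l) (hs : ¬ lng s) : A l s = p * A s l := by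
  have h1 := α.two_inner_root l s
  have h2 := α.two_inner_root s l
  rw [real_inner_comm, h2, h.inner_long l hl, h.inner_short s hs] at h1
  have : (A l s : ℝ) = p * A s l := by
    have := h.pos.ne'
    apply mul_right_cancel₀ this
    linarith
  exact_mod_cast this

omit h in
theorem inner_weyl_apply (w : EuclideanSpace ℝ (Fin n) ≃ₗᵢ[ℝ] EuclideanSpace ℝ (Fin n))
    (x : EuclideanSpace ℝ (Fin n)) : (inner ℝ (w x) (w x) : ℝ) = inner ℝ x x :=
  w.inner_map_map x x

/-- The coefficients of a long root at the short simple roots are divisible by `p`. -/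
theorem dvd_of_long {k : Fin n → ℤ} (hβ : α.comb k ∈ α.roots)
    (hk : inner ℝ (α.comb k) (α.comb k) = p * c) {i : Fin n} (hi : ¬ lng i) : (p : ℤ) ∣ k i := by
  obtain ⟨w, hw, j, e⟩ := hβ
  have hj : lng j := by
    by_contra hj
    rw [e, inner_weyl_apply, h.inner_short j hj] at hk
    exact h.lt_pc.ne hk
  -- Divisibility survives each simple reflection. Only the coefficient at the reflecting root `s`
  -- changes, by `∑ l_t A t s`; for short `s`, a long `t` contributes a multiple of `p` through `A t
  -- s = p A s t`, a short `t` through `l_t`.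
  have key : ∃ l, w (α.root j) = α.comb l ∧ ∀ i, ¬ lng i → (p : ℤ) ∣ l i := by
    refine weyl_induction (α := α)
      (p := fun w => ∃ l, w (α.root j) = α.comb l ∧ ∀ i, ¬ lng i → (p : ℤ) ∣ l i) ?_ ?_ hw
    · refine ⟨_, α.root_eq_comb j, fun i hi => ?_⟩
      rw [Pi.single_eq_of_ne (fun e : i = j => hi (e ▸ hj))]
      exact dvd_zero _
    · rintro s w - ⟨l, hl, hd⟩
      refine ⟨l - Pi.single s (∑ i, l i * A i s), ?_, fun i hi => ?_⟩
      · rw [← mirror_comb, ← hl]; rfl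
      · rw [Pi.sub_apply]
        refine dvd_sub (hd i hi) ?_
        by_cases his : i = s
        · subst his
          rw [Pi.single_eq_same]
          refine Finset.dvd_sum fun t _ => ?_
          by_cases ht : lng t
          · rw [h.cartan_long_short ht hi]
            exact (Dvd.intro _ rfl : (p : ℤ) ∣ p * A i t).mul_left _
          · exact (hd t ht).mul_right _
        · rw [Pi.single_eq_of_ne his]
          exact dvd_zero _
  obtain ⟨l, hl, hd⟩ := key
  rw [α.comb_injective (e.trans hl)]
  exact hd i hi

/-- A short root has a coefficient at a short simple root which is not divisible by `p`. -/
theorem exists_not_dvd_of_short {k : Fin n → ℤ} (hk : inner ℝ (α.comb k) (α.comb k) = c) :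
    ∃ i, ¬ lng i ∧ ¬ (p : ℤ) ∣ k i := by
  by_contra! hd
  -- If `p` divided all short coefficients, the root would lie in the lattice spanned by the long
  -- simple roots and `p` times the short ones. Squared lengths there are multiples of `p c`, and
  -- `c` is not one.
  let G : Set (EuclideanSpace ℝ (Fin n)) :=
    {x | (∃ i, lng i ∧ x = α.root i) ∨ ∃ i, ¬ lng i ∧ x = (p : ℝ) • α.root i}
  have hmem : α.comb k ∈ AddSubgroup.closure G := by
    refine sum_mem fun i _ => ?_
    by_cases hi : lng i
    · have hG : α.root i ∈ G := Or.inl ⟨i, hi, rfl⟩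
      exact zsmul_mem (AddSubgroup.subset_closure hG) _
    · obtain ⟨y, hy⟩ := hd i hi
      have : k i • α.root i = y • ((p : ℝ) • α.root i) := by
        rw [hy, mul_comm, mul_smul, Nat.cast_smul_eq_nsmul ℝ, natCast_zsmul]
      rw [this]
      have hG : (p : ℝ) • α.root i ∈ G := Or.inr ⟨i, hi, rfl⟩
      exact zsmul_mem (AddSubgroup.subset_closure hG) _
  have hdiag : ∀ x ∈ G, ∃ z : ℤ, inner ℝ x x = (p * c) * z := by
    rintro x (⟨i, hi, rfl⟩ | ⟨i, hi, rfl⟩)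
    · exact ⟨1, by rw [h.inner_long i hi]; simp⟩
    · refine ⟨p, ?_⟩
      rw [inner_smul_left, inner_smul_right, h.inner_short i hi]
      simp only [conj_trivial, Int.cast_natCast]
      ring
  have hgram : ∀ x ∈ G, ∀ y ∈ G, ∃ z : ℤ, 2 * inner ℝ x y = (p * c) * z := by
    rintro x (⟨i, hi, rfl⟩ | ⟨i, hi, rfl⟩) y (⟨j, hj, rfl⟩ | ⟨j, hj, rfl⟩)
    · exact ⟨A i j, by rw [two_inner_root, h.inner_long j hj]; ring⟩
    · refine ⟨A i j, ?_⟩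
      rw [inner_smul_right, mul_left_comm, two_inner_root, h.inner_short j hj]
      ring
    · refine ⟨A j i, ?_⟩
      rw [real_inner_comm, inner_smul_right, mul_left_comm, two_inner_root, h.inner_short i hi]
      ring
    · refine ⟨p * A i j, ?_⟩
      rw [inner_smul_right, inner_smul_left, mul_left_comm, mul_left_comm 2, two_inner_root,
        h.inner_short j hj]
      simp only [conj_trivial, Int.cast_mul, Int.cast_natCast]
      ring
  obtain ⟨z, hz⟩ := inner_self_closure hdiag hgram hmem
  rw [hk] at hz
  have : (1 : ℝ) = p * z := by
    apply mul_right_cancel₀ h.pos.ne'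
    linarith
  have h1 : (1 : ℤ) = p * z := by exact_mod_cast this
  have h2 := Int.eq_one_of_dvd_one (by positivity) (Dvd.intro _ h1.symm)
  exact h.prime.one_lt.ne' (by exact_mod_cast h2)

/-- A long root has a nonzero coefficient at a long simple root. -/
theorem exists_ne_zero_of_long {k : Fin n → ℤ} (hβ : α.comb k ∈ α.roots)
    (hk : inner ℝ (α.comb k) (α.comb k) = p * c) : ∃ i, lng i ∧ k i ≠ 0 := by
  by_contra! hd
  -- With no long coefficient, the root is by `dvd_of_long` `p` times a vector of the short lattice.
  -- Its squared length is then a multiple of `p² c`, which `p c` is not.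
  let G : Set (EuclideanSpace ℝ (Fin n)) := {x | ∃ i, ¬ lng i ∧ x = α.root i}
  have hdvd : ∀ i, ∃ y : ℤ, k i = p * y ∧ (lng i → y = 0) := by
    intro i
    by_cases hi : lng i
    · exact ⟨0, by simp [hd i hi]⟩
    · obtain ⟨y, hy⟩ := h.dvd_of_long hβ hk hi
      exact ⟨y, hy, fun h' => absurd h' hi⟩
  choose y hy hy0 using hdvd
  have hmem : α.comb y ∈ AddSubgroup.closure G := by
    refine sum_mem fun i _ => ?_
    by_cases hi : lng i
    · rw [hy0 i hi, zero_smul]; exact zero_mem _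
    · have hG : α.root i ∈ G := ⟨i, hi, rfl⟩
      exact zsmul_mem (AddSubgroup.subset_closure hG) _
  have hky : α.comb k = (p : ℝ) • α.comb y := by
    rw [comb, comb, Finset.smul_sum]
    refine Finset.sum_congr rfl fun i _ => ?_
    rw [hy, mul_smul, Nat.cast_smul_eq_nsmul ℝ, natCast_zsmul]
  have hdiag : ∀ x ∈ G, ∃ z : ℤ, inner ℝ x x = c * z := by
    rintro x ⟨i, hi, rfl⟩
    exact ⟨1, by rw [h.inner_short i hi]; simp⟩
  have hgram : ∀ x ∈ G, ∀ y ∈ G, ∃ z : ℤ, 2 * inner ℝ x y = c * z := by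
    rintro x ⟨i, hi, rfl⟩ y ⟨j, hj, rfl⟩
    exact ⟨A i j, by rw [two_inner_root, h.inner_short j hj]; ring⟩
  obtain ⟨z, hz⟩ := inner_self_closure hdiag hgram hmem
  rw [hky, inner_smul_left, inner_smul_right, hz] at hk
  have hp : (p : ℝ) ≠ 0 := by exact_mod_cast h.prime.ne_zero
  have : (1 : ℝ) = p * z := by
    apply mul_right_cancel₀ h.pos.ne'
    apply mul_left_cancel₀ hp
    simp only [conj_trivial] at hk
    linarith
  have h1 : (1 : ℤ) = p * z := by exact_mod_cast this
  have h2 := Int.eq_one_of_dvd_one (by positivity) (Dvd.intro _ h1.symm)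
  exact h.prime.one_lt.ne' (by exact_mod_cast h2)

theorem finite_roots : α.roots.Finite := by
  refine ((Set.finite_Icc (fun i => -(m i : ℤ)) (fun i => (m i : ℤ))).image α.comb).subset ?_
  intro β hβ
  obtain ⟨k, rfl, hk⟩ := h.bounds β hβ
  refine ⟨k, ⟨fun i => ?_, fun i => ?_⟩, rfl⟩ <;> rcases hk with hk | hk <;> have := hk i <;>
    simp only <;> omega

theorem finite_posRoots (d : ℝ) : (α.posRoots d).Finite := h.finite_roots.subset fun _ hβ => hβ.1

theorem isHalfSystem {d : ℝ} (hd : d = c ∨ d = p * c) :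
    α.IsHalfSystem (h.finite_posRoots d).toFinset where
  neg_notMem β hβ hβ' := by
    rw [Set.Finite.mem_toFinset] at hβ hβ'
    obtain ⟨-, hn, k, hk, rfl⟩ := hβ
    obtain ⟨-, -, l, hl, e⟩ := hβ'
    rw [← comb_neg] at e
    have e := α.comb_injective e
    have : k = 0 := by
      funext i
      have h1 := congrFun e i
      have h2 := hk i
      have h3 := hl i
      simp only [Pi.neg_apply, Pi.zero_apply] at *
      omega
    rw [this] at hn
    simp [comb] at hn
    have h1 := h.pos
    have h2 := h.pc_pos
    rcases hd with rfl | rfl <;> linarith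
  weyl_mem w hw β hβ := by
    rw [Set.Finite.mem_toFinset] at hβ ⊢
    rw [Set.Finite.mem_toFinset]
    obtain ⟨hr, hn, -⟩ := hβ
    have hr' := weyl_apply_mem_roots hw hr
    have hn' : inner ℝ (w β) (w β) = d := by rw [inner_weyl_apply, hn]
    obtain ⟨k, e, hk⟩ := h.bounds _ hr'
    rcases hk with hk | hk
    · exact Or.inl ⟨hr', hn', k, fun i => (hk i).1, e⟩
    · refine Or.inr ⟨neg_mem_roots hr', by rw [inner_neg_neg, hn'], -k, fun i => ?_, ?_⟩
      · have := (hk i).2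
        simp only [Pi.neg_apply]
        omega
      · rw [e, comb_neg]
  mirror_mem i β hβ hne := by
    rw [Set.Finite.mem_toFinset] at hβ ⊢
    obtain ⟨hr, hn, k, hk, rfl⟩ := hβ
    have hr' := weyl_apply_mem_roots (α.mirror_mem_weyl i) hr
    refine ⟨hr', by rw [inner_weyl_apply, hn], ?_⟩
    -- The coefficient at some `j ≠ i` is positive and untouched by `r_i`, which forces the
    -- reflected root to be positive. Otherwise the root is a multiple `k α_i`, and comparing
    -- lengths leaves only `α_i` itself.
    have hj : ∃ j, j ≠ i ∧ k j ≠ 0 := by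
      by_contra! hj
      have hki : k = Pi.single i (k i) := by
        funext j
        by_cases hji : j = i
        · subst hji; simp
        · rw [Pi.single_eq_of_ne hji, hj j hji]
      rw [hki, comb_single] at hn hne
      rw [← Int.cast_smul_eq_zsmul ℝ, inner_smul_left, inner_smul_right] at hn
      have hsq : ((k i * k i : ℤ) : ℝ) * inner ℝ (α.root i) (α.root i) = d := by
        rw [← hn]; simp; ring
      have hone : k i * k i = 1 → False := by
        intro h1
        have h2 : k i = 1 := by
          have := hk i
          nlinarith
        rw [h2, one_smul] at hne
        exact hne rfl
      have hcc := h.pos.ne'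
      by_cases hi : lng i
      · rw [h.inner_long i hi] at hsq
        rcases hd with rfl | rfl
        · have : ((k i * k i * p : ℤ) : ℝ) = 1 := by
            apply mul_right_cancel₀ hcc
            push_cast at hsq ⊢
            linarith
          have h1 : k i * k i * p = 1 := by exact_mod_cast this
          have h2 := Int.eq_one_of_dvd_one (by positivity) (Dvd.intro_left _ h1)
          exact h.prime.one_lt.ne' (by exact_mod_cast h2)
        · have : ((k i * k i : ℤ) : ℝ) = 1 := by
            apply mul_right_cancel₀ h.pc_pos.ne'
            linarith
          exact hone (by exact_mod_cast this)
      · rw [h.inner_short i hi] at hsq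
        rcases hd with rfl | rfl
        · have : ((k i * k i : ℤ) : ℝ) = 1 := by
            apply mul_right_cancel₀ hcc
            linarith
          exact hone (by exact_mod_cast this)
        · have h1 : ((k i * k i : ℤ) : ℝ) = p := mul_right_cancel₀ hcc hsq
          have h2 : k i * k i = p := by exact_mod_cast h1
          have h3 := Nat.prime_iff_prime_int.1 h.prime
          rw [← h2] at h3
          -- A short `α_i` with a long multiple would make the prime `p` a square.
          exact h3.irreducible.not_isSquare ⟨k i, rfl⟩
    obtain ⟨j, hji, hkj⟩ := hj
    obtain ⟨l, e, hl⟩ := h.bounds _ hr'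
    refine ⟨l, fun s => ?_, e⟩
    rcases hl with hl | hl
    · exact (hl s).1
    · exfalso
      rw [mirror_comb] at e
      have e := congrFun (α.comb_injective e) j
      rw [Pi.sub_apply, Pi.single_eq_of_ne hji, sub_zero] at e
      have h1 := hk j
      have h2 := (hl j).2
      omega
  exists_comb β hβ := by
    rw [Set.Finite.mem_toFinset] at hβ
    obtain ⟨-, -, k, -, e⟩ := hβ
    exact ⟨k, e⟩

theorem root_mem_posRoots_iff (i : Fin n) (d : ℝ) :
    α.root i ∈ (h.finite_posRoots d).toFinset ↔ inner ℝ (α.root i) (α.root i) = d := by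
  rw [Set.Finite.mem_toFinset]
  refine ⟨fun h1 => h1.2.1, fun h1 => ⟨α.root_mem_roots i, h1, _, fun j => ?_, α.root_eq_comb i⟩⟩
  by_cases hj : j = i
  · subst hj; simp
  · simp [hj]

theorem char_long_apply (i : Fin n) [Decidable (lng i)] :
    (h.isHalfSystem (Or.inr rfl)).char (α.simpleReflection i) = if lng i then -1 else 1 := by
  split_ifs with hi
  · exact (h.isHalfSystem (Or.inr rfl)).char_simpleReflection_of_mem
      ((h.root_mem_posRoots_iff i _).2 (h.inner_long i hi))
  · refine (h.isHalfSystem (Or.inr rfl)).char_simpleReflection_of_notMem fun h1 => ?_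
    rw [h.root_mem_posRoots_iff, h.inner_short i hi] at h1
    exact h.lt_pc.ne h1

theorem char_short_apply (i : Fin n) [Decidable (lng i)] :
    (h.isHalfSystem (Or.inl rfl)).char (α.simpleReflection i) = if lng i then 1 else -1 := by
  split_ifs with hi
  · refine (h.isHalfSystem (Or.inl rfl)).char_simpleReflection_of_notMem fun h1 => ?_
    rw [h.root_mem_posRoots_iff, h.inner_long i hi] at h1
    exact h.lt_pc.ne' h1
  · exact (h.isHalfSystem (Or.inl rfl)).char_simpleReflection_of_mem
      ((h.root_mem_posRoots_iff i _).2 (h.inner_short i hi))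

/-- The inversion character witnesses that a homomorphism with the prescribed values exists, so the
chosen one has these values, and generators determine it. -/
theorem signLong_eq : α.signLong = (h.isHalfSystem (Or.inr rfl)).char := by
  classical
  have hspec : ∀ i, α.signLong (α.simpleReflection i) = if α.IsLong i then -1 else 1 := by
    refine Classical.epsilon_spec (p := fun σ : α.weyl →* ℤˣ =>
      ∀ i, σ (α.simpleReflection i) = if α.IsLong i then -1 else 1)
      ⟨(h.isHalfSystem (Or.inr rfl)).char, fun i => ?_⟩
    rw [h.char_long_apply]
    simp only [h.isLong_iff]
  refine α.weyl_hom_ext fun i => ?_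
  rw [hspec, h.char_long_apply]
  simp only [h.isLong_iff]

theorem signShort_eq : α.signShort = (h.isHalfSystem (Or.inl rfl)).char := by
  classical
  have hspec : ∀ i, α.signShort (α.simpleReflection i) = if α.IsShort i then -1 else 1 := by
    refine Classical.epsilon_spec (p := fun σ : α.weyl →* ℤˣ =>
      ∀ i, σ (α.simpleReflection i) = if α.IsShort i then -1 else 1)
      ⟨(h.isHalfSystem (Or.inl rfl)).char, fun i => ?_⟩
    rw [h.char_short_apply]
    simp only [h.isShort_iff, ite_not]
  refine α.weyl_hom_ext fun i => ?_
  rw [hspec, h.char_short_apply]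
  simp only [h.isShort_iff, ite_not]

theorem signLong_apply (i : Fin n) [Decidable (lng i)] :
    α.signLong (α.simpleReflection i) = if lng i then -1 else 1 := by
  rw [h.signLong_eq, h.char_long_apply]

theorem signShort_apply (i : Fin n) [Decidable (lng i)] :
    α.signShort (α.simpleReflection i) = if lng i then 1 else -1 := by
  rw [h.signShort_eq, h.char_short_apply]

theorem signDet_eq : α.signDet = α.signShort * α.signLong := by
  classical
  refine α.weyl_hom_ext fun i => ?_
  rw [signDet_simpleReflection, MonoidHom.mul_apply, h.signLong_apply, h.signShort_apply]
  split_ifs <;> simp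

end HasTwoLengths

end SimpleRoots

/-! ### Fundamental region, decomposition of grid fragments, stabilizers and walls -/

namespace SimpleRoots

variable {n : ℕ} {A : Matrix (Fin n) (Fin n) ℤ} (α : SimpleRoots A)

theorem inner_coroot_self {v : EuclideanSpace ℝ (Fin n)} (hv : v ≠ 0) :
    inner ℝ v (coroot v) = (2 : ℝ) := by
  rw [coroot, inner_smul_right]
  exact div_mul_cancel₀ _ (inner_self_ne_zero.2 hv)

theorem inner_mirror_self (v x : EuclideanSpace ℝ (Fin n)) :
    inner ℝ (mirror v x) v = -(inner ℝ x v : ℝ) := by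
  rw [← LinearIsometryEquiv.inner_map_map (mirror v), mirror_mirror, mirror_self, inner_neg_right]

theorem affineReflection_apply (a : EuclideanSpace ℝ (Fin n)) :
    α.affineReflection a = mirror α.highestRoot a + coroot α.highestRoot := by
  change coroot α.highestRoot + mirror α.highestRoot a = _
  rw [add_comm]

theorem mirror_eq_self_iff {v a : EuclideanSpace ℝ (Fin n)} (hv : v ≠ 0) :
    mirror v a = a ↔ inner ℝ a v = (0 : ℝ) := by
  have hc : coroot v ≠ 0 := by
    intro h0
    have := inner_coroot_self hv
    rw [h0, inner_zero_right] at this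
    norm_num at this
  rw [mirror_apply, sub_eq_self, smul_eq_zero, or_iff_left hc, real_inner_comm]

theorem affineReflection_eq_self_iff (h0 : α.highestRoot ≠ 0) {a : EuclideanSpace ℝ (Fin n)} :
    α.affineReflection a = a ↔ inner ℝ a α.highestRoot = (1 : ℝ) := by
  have hc : coroot α.highestRoot ≠ 0 := by
    intro h1
    have := inner_coroot_self h0
    rw [h1, inner_zero_right] at this
    norm_num at this
  have h2 : mirror α.highestRoot a + coroot α.highestRoot =
      a - (inner ℝ a α.highestRoot - 1 : ℝ) • coroot α.highestRoot := by
    rw [mirror_apply, real_inner_comm]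
    module
  rw [affineReflection_apply, h2, sub_eq_self, smul_eq_zero, or_iff_left hc, sub_eq_zero]

variable {α}

/-- A generator negates the affine function vanishing on its wall (`1 - ⟨a, ξ⟩` for `r_0`), so it
sends every point of `F` off that wall to the wrong side. -/
theorem apply_notMem_fundamentalRegion (h0 : α.highestRoot ≠ 0) {r : α.affineWeyl}
    (hr : r ∈ α.generators) {a : EuclideanSpace ℝ (Fin n)} (ha : a ∈ α.fundamentalRegion)
    (hra : r.1 a ≠ a) : r.1 a ∉ α.fundamentalRegion := by
  intro hF
  rcases hr with e | ⟨i, e⟩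
  · rw [e, Ne, α.affineReflection_eq_self_iff h0] at hra
    rw [e, affineReflection_apply] at hF
    have h1 := hF.2
    rw [inner_add_left, inner_mirror_self, real_inner_comm α.highestRoot (coroot _),
      inner_coroot_self h0] at h1
    have h2 := ha.2
    exact hra (le_antisymm h2 (by linarith))
  · have e' : r.1 a = mirror (α.root i) a := by rw [e]; rfl
    rw [e', Ne, mirror_eq_self_iff (α.root_ne_zero i)] at hra
    rw [e'] at hF
    have h1 := hF.1 i
    rw [inner_mirror_self] at h1
    exact hra (le_antisymm (by linarith) (ha.1 i))

theorem stab_one_mem {g : α.affineWeyl} {a : EuclideanSpace ℝ (Fin n)} :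
    g ∈ α.stab 1 a ↔ g.1 a = a := ⟨fun h => h.2, fun h => ⟨rfl, h⟩⟩

theorem mem_signRegion_iff {σ : α.weyl →* ℤˣ} {a : EuclideanSpace ℝ (Fin n)} :
    a ∈ α.signRegion σ ↔ a ∈ α.fundamentalRegion ∧
      ∀ g : α.affineWeyl, g.1 a = a → σ (α.retraction g) = 1 := by
  refine and_congr_right fun _ => ⟨fun h g hg => ?_, fun h => ?_⟩
  · have : σ (α.retraction g) ∈ ({1} : Set ℤˣ) := h ▸ ⟨g, stab_one_mem.2 hg, rfl⟩
    simpa using this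
  · ext x
    constructor
    · rintro ⟨g, hg, rfl⟩
      exact h g hg.2
    · rintro rfl
      exact ⟨1, stab_one_mem.2 rfl, by simp⟩

/-- The identity always contributes the value `1`, so the image is `{1, -1}` exactly when `-1` is
attained. -/
theorem notMem_evenBoundary_iff {τ σ : α.weyl →* ℤˣ} {r : α.affineWeyl}
    {a : EuclideanSpace ℝ (Fin n)} (ha : a ∈ α.evenRegion σ r) :
    a ∉ α.evenBoundary τ σ r ↔ ∀ g : α.affineWeyl, g.1 a = a → σ (α.retraction g) = 1 →
      τ (α.retraction g) = 1 := by
  constructor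
  · intro h g hg hσ
    by_contra hne
    have hneg := (Int.units_eq_one_or _).resolve_left hne
    refine h ⟨ha, Set.Subset.antisymm ?_ ?_⟩
    · rintro _ ⟨g', -, rfl⟩
      exact Int.units_eq_one_or _
    · rintro _ (rfl | rfl)
      · exact ⟨1, ⟨by simp, rfl⟩, by simp⟩
      · exact ⟨g, ⟨hσ, hg⟩, hneg⟩
  · rintro h ⟨-, he⟩
    have : (-1 : ℤˣ) ∈ (fun g => τ (α.retraction g)) '' α.stab σ a := by
      rw [he]; simp
    obtain ⟨g, hg, hg'⟩ := this
    have h1 := h g hg.2 hg.1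
    simp only at hg'
    rw [h1] at hg'
    exact absurd hg' (by decide)

variable (α) in
/-- The points of the grid `(1/M) P^∨` in the fundamental region. -/
def gridRegion (M : ℕ) : Set (EuclideanSpace ℝ (Fin n)) :=
  ((M : ℝ)⁻¹ • α.coweightLattice) ∩ α.fundamentalRegion

theorem mem_grid_iff {M : ℕ} (hM : 1 ≤ M) {a : EuclideanSpace ℝ (Fin n)} :
    a ∈ (M : ℝ)⁻¹ • α.coweightLattice ↔ ∀ i, ∃ k : ℤ, (M : ℝ) * inner ℝ a (α.root i) = k := by
  have hM0 : (M : ℝ) ≠ 0 := by exact_mod_cast (by omega : M ≠ 0)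
  rw [Set.mem_inv_smul_set_iff₀ hM0]
  simp only [coweightLattice, Set.mem_ofPred_eq, inner_smul_left, conj_trivial]

theorem exists_inner_comb_of_mem_grid {M : ℕ} (hM : 1 ≤ M) {a : EuclideanSpace ℝ (Fin n)}
    (ha : a ∈ (M : ℝ)⁻¹ • α.coweightLattice) (k : Fin n → ℤ) :
    ∃ z : ℤ, (M : ℝ) * inner ℝ a (α.comb k) = z := by
  choose l hl using (mem_grid_iff hM).1 ha
  refine ⟨∑ i, k i * l i, ?_⟩
  rw [inner_comb, Finset.mul_sum]
  push_cast
  refine Finset.sum_congr rfl fun i _ => ?_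
  rw [← hl]
  ring

/-- The linear part can be moved onto the simple root, giving an integral combination of simple
roots; the translation in `Q^∨` adds an integer. -/
theorem affineWeyl_apply_mem_grid {M : ℕ} (hM : 1 ≤ M) (g : α.affineWeyl)
    {a : EuclideanSpace ℝ (Fin n)} (ha : a ∈ (M : ℝ)⁻¹ • α.coweightLattice) :
    g.1 a ∈ (M : ℝ)⁻¹ • α.coweightLattice := by
  refine (mem_grid_iff hM).2 fun i => ?_
  have hw : g.1.linearIsometryEquiv ∈ α.weyl := g.2.1
  rw [IsHalfSystem.affine_apply, inner_add_left]
  obtain ⟨k, hk⟩ := exists_comb_of_mem_roots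
    (weyl_apply_mem_roots (inv_mem hw) (α.root_mem_roots i))
  have h1 : (inner ℝ (g.1.linearIsometryEquiv a) (α.root i) : ℝ) = inner ℝ a (α.comb k) := by
    have h2 : α.root i = g.1.linearIsometryEquiv (g.1.linearIsometryEquiv⁻¹ (α.root i)) :=
      (g.1.linearIsometryEquiv.apply_symm_apply _).symm
    rw [← hk]
    conv_lhs => rw [h2, LinearIsometryEquiv.inner_map_map]
  obtain ⟨z, hz⟩ := exists_inner_comb_of_mem_grid hM ha k
  obtain ⟨y, hy⟩ := α.inner_comb_corootLattice (Pi.single i 1) g.2.2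
  rw [← root_eq_comb, real_inner_comm] at hy
  refine ⟨z + M * y, ?_⟩
  rw [h1, hy, mul_add, hz]
  push_cast
  ring

/-- Stabilizers of `a` and `r a` are conjugate by `r`, and characters ignore conjugation. On `r F^σ`
the whole stabilizer has `σ = 1`, so the condition on `τ` there concerns every element fixing the
point. -/
theorem gridFragment_eq {M : ℕ} (hM : 1 ≤ M) (τ σ : α.weyl →* ℤˣ) (r : α.affineWeyl) :
    α.gridFragment τ σ r M =
      {a ∈ α.gridRegion M | ∀ g : α.affineWeyl, g.1 a = a → σ (α.retraction g) = 1 →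
        τ (α.retraction g) = 1} ∪
      r.1 '' {a ∈ α.gridRegion M | (∀ g : α.affineWeyl, g.1 a = a → σ (α.retraction g) = 1) ∧
        ∀ g : α.affineWeyl, g.1 a = a → τ (α.retraction g) = 1} := by
  have hconj : ∀ a, ∀ g : α.affineWeyl, g.1 a = a ↔ (r * g * r⁻¹).1 (r.1 a) = r.1 a := by
    intro a g
    have h1 : (r * g * r⁻¹).1 (r.1 a) = r.1 (g.1 a) := by
      change r.1 (g.1 (r.1.symm (r.1 a))) = _
      rw [r.1.symm_apply_apply]
    rw [h1]
    exact (r.1.injective.eq_iff).symm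
  have hret : ∀ ρ : α.weyl →* ℤˣ, ∀ g : α.affineWeyl,
      ρ (α.retraction (r * g * r⁻¹)) = ρ (α.retraction g) := by
    intro ρ g
    simp only [map_mul, map_inv]
    rw [mul_right_comm, mul_inv_cancel, one_mul]
  have hsurj : ∀ g : α.affineWeyl, ∃ g', g = r * g' * r⁻¹ := fun g => ⟨r⁻¹ * g * r, by group⟩
  ext x
  constructor
  · rintro ⟨hgrid, hx, hb⟩
    rw [notMem_evenBoundary_iff hx] at hb
    rcases hx with hx | ⟨a, ha, rfl⟩
    · exact Or.inl ⟨⟨hgrid, hx⟩, hb⟩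
    · rw [mem_signRegion_iff] at ha
      refine Or.inr ⟨a, ⟨⟨?_, ha.1⟩, ha.2, fun g hg => ?_⟩, rfl⟩
      · have := affineWeyl_apply_mem_grid hM r⁻¹ hgrid
        rwa [show (r⁻¹).1 (r.1 a) = a from r.1.symm_apply_apply a] at this
      · rw [← hret]
        exact hb _ ((hconj a g).1 hg) (by rw [hret]; exact ha.2 g hg)
  · rintro (⟨⟨hgrid, hF⟩, hb⟩ | ⟨a, ⟨⟨hgrid, hF⟩, hσ, hτ⟩, rfl⟩)
    · have hx : x ∈ α.evenRegion σ r := Or.inl hF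
      exact ⟨hgrid, hx, (notMem_evenBoundary_iff hx).2 hb⟩
    · have hx : r.1 a ∈ α.evenRegion σ r := Or.inr ⟨a, mem_signRegion_iff.2 ⟨hF, hσ⟩, rfl⟩
      refine ⟨affineWeyl_apply_mem_grid hM r hgrid, hx, (notMem_evenBoundary_iff hx).2 ?_⟩
      intro g hg _
      obtain ⟨g, rfl⟩ := hsurj g
      rw [hret]
      exact hτ g ((hconj a g).2 hg)

/-- The two pieces of `gridFragment_eq` are disjoint: since `σ(r) = -1`, the generator `r` fixes no
point of `F^σ`, and therefore moves each of them out of `F`. -/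
theorem gridCount_of_ncard (h0 : α.highestRoot ≠ 0) {M : ℕ} (hM : 1 ≤ M) {τ σ : α.weyl →* ℤˣ}
    (hne : (α.negGenerators σ).Nonempty) (hfin : (α.gridRegion M).Finite) {X Y : ℕ}
    (hX : {a ∈ α.gridRegion M | ∀ g : α.affineWeyl, g.1 a = a → σ (α.retraction g) = 1 →
        τ (α.retraction g) = 1}.ncard = X)
    (hY : {a ∈ α.gridRegion M | (∀ g : α.affineWeyl, g.1 a = a → σ (α.retraction g) = 1) ∧
        ∀ g : α.affineWeyl, g.1 a = a → τ (α.retraction g) = 1}.ncard = Y) :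
    α.GridCount τ σ M (X + Y) := by
  refine ⟨hne, fun r hr => ?_⟩
  have f1 := hfin.subset (Set.sep_subset (α.gridRegion M) fun a => ∀ g : α.affineWeyl,
    g.1 a = a → σ (α.retraction g) = 1 → τ (α.retraction g) = 1)
  have f2 := (hfin.subset (Set.sep_subset (α.gridRegion M) fun a =>
    (∀ g : α.affineWeyl, g.1 a = a → σ (α.retraction g) = 1) ∧
      ∀ g : α.affineWeyl, g.1 a = a → τ (α.retraction g) = 1))
  rw [gridFragment_eq hM]
  refine ⟨f1.union (f2.image _), ?_⟩
  rw [Set.ncard_union_eq ?_ f1 (f2.image _), Set.ncard_image_of_injective _ r.1.injective, hX, hY]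
  · push_cast; rfl
  · rw [Set.disjoint_left]
    rintro _ ⟨⟨-, hF⟩, -⟩ ⟨a, ⟨⟨-, ha⟩, hσ, -⟩, rfl⟩
    refine apply_notMem_fundamentalRegion h0 hr.1 ha (fun hfix => ?_) hF
    have := hσ r hfix
    rw [hr.2] at this
    exact absurd this (by decide)

variable (α) in
/-- `a` lies on no wall of the fundamental region orthogonal to a short root. -/
def OffShortWalls (lng : Fin n → Prop) (a : EuclideanSpace ℝ (Fin n)) : Prop :=
  ∀ i, ¬ lng i → inner ℝ a (α.root i) ≠ (0 : ℝ)

variable (α) in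
/-- `a` lies on no wall of the fundamental region orthogonal to a long root. -/
def OffLongWalls (lng : Fin n → Prop) (a : EuclideanSpace ℝ (Fin n)) : Prop :=
  (∀ i, lng i → inner ℝ a (α.root i) ≠ (0 : ℝ)) ∧ inner ℝ a α.highestRoot ≠ (1 : ℝ)

variable (α) in
/-- The simple reflection `r_i` as an element of the affine Weyl group. -/
def affineSimple (i : Fin n) : α.affineWeyl :=
  ⟨(mirror (α.root i)).toAffineIsometryEquiv, α.mirror_mem_weyl i, by
    change mirror (α.root i) 0 ∈ _
    rw [map_zero]; exact zero_mem _⟩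

theorem affineSimple_mem (i : Fin n) : α.affineSimple i ∈ α.generators := Or.inr ⟨i, rfl⟩

theorem retraction_affineSimple (i : Fin n) :
    α.retraction (α.affineSimple i) = α.simpleReflection i := rfl

namespace HasTwoLengths

variable {m : Fin n → ℕ} {lng : Fin n → Prop} {p : ℕ} {c : ℝ} (h : α.HasTwoLengths m lng p c)
include h

theorem highestRoot_ne_zero : α.highestRoot ≠ 0 := by
  obtain ⟨w, hw, i, hi, e⟩ := h.highest_mem
  rw [h.highestRoot_eq, e]
  exact (w.toLinearEquiv.map_ne_zero_iff).2 (α.root_ne_zero i)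

/-- The reflection `r_0` as an element of the affine Weyl group. -/
def affineZero : α.affineWeyl :=
  ⟨α.affineReflection, mirror_mem_weyl_of_mem_roots h.highestRoot_mem, by
    rw [affineReflection_apply, map_zero, zero_add]
    exact coroot_mem_corootLattice h.highestRoot_mem⟩

/-- The highest root is the image of a long simple root under some `w`, so its reflection is
conjugate to a long simple one; this makes the affine wall a long wall. -/
theorem retraction_affineZero : ∃ w i, lng i ∧
    α.retraction h.affineZero = w * α.simpleReflection i * w⁻¹ := by
  obtain ⟨w, hw, i, hi, e⟩ := h.highest_mem
  refine ⟨⟨w, hw⟩, i, hi, Subtype.ext ?_⟩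
  change mirror α.highestRoot = w * mirror (α.root i) * w⁻¹
  rw [h.highestRoot_eq, e, mirror_map]

theorem sign_affineZero : α.signShort (α.retraction h.affineZero) = 1 ∧
    α.signLong (α.retraction h.affineZero) = -1 := by
  classical
  obtain ⟨w, i, hi, e⟩ := h.retraction_affineZero
  rw [e]
  simp only [map_mul, map_inv, h.signShort_apply, h.signLong_apply, hi, if_true]
  constructor
  · simp
  · rw [mul_right_comm, mul_inv_cancel, one_mul]

theorem sign_affineSimple_long {i : Fin n} (hi : lng i) :
    α.signShort (α.retraction (α.affineSimple i)) = 1 ∧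
      α.signLong (α.retraction (α.affineSimple i)) = -1 := by
  classical
  simp only [retraction_affineSimple, h.signShort_apply, h.signLong_apply, hi, if_true, and_self]

theorem sign_affineSimple_short {i : Fin n} (hi : ¬ lng i) :
    α.signShort (α.retraction (α.affineSimple i)) = -1 ∧
      α.signLong (α.retraction (α.affineSimple i)) = 1 := by
  classical
  simp only [retraction_affineSimple, h.signShort_apply, h.signLong_apply, hi, if_false, and_self]

/-- A point of the fundamental region at which a positive root takes an integral value: the value
is `0` or `1`, and the coefficients off the walls through the point are `0` or maximal. -/
theorem coeff_of_integral {a : EuclideanSpace ℝ (Fin n)} (ha : a ∈ α.fundamentalRegion)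
    {k : Fin n → ℤ} (hk0 : ∀ i, 0 ≤ k i) (hk : α.comb k ∈ α.roots) {z : ℤ}
    (hz : inner ℝ (α.comb k) a = (z : ℝ)) :
    (∀ i, k i = 0 ∨ inner ℝ a (α.root i) = (0 : ℝ)) ∨
      inner ℝ a α.highestRoot = (1 : ℝ) ∧ ∀ i, k i = m i ∨ inner ℝ a (α.root i) = (0 : ℝ) := by
  obtain ⟨l, e, hl⟩ := h.bounds _ hk
  have e := α.comb_injective e
  subst e
  have hkm : ∀ i, k i ≤ m i := by
    intro i
    rcases hl with hl | hl
    · exact (hl i).2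
    · have := (hl i).2; omega
  rw [real_inner_comm, inner_comb] at hz
  have ha2 := ha.2
  rw [h.highestRoot_eq, inner_comb] at ha2 ⊢
  have hd : ∑ i, (((m i : ℤ) : ℝ) - k i) * inner ℝ a (α.root i) =
      ∑ i, ((m i : ℤ) : ℝ) * inner ℝ a (α.root i) - z := by
    rw [← hz, ← Finset.sum_sub_distrib]
    exact Finset.sum_congr rfl fun i _ => by ring
  -- Both `⟨β, a⟩` and `⟨ξ - β, a⟩` are sums of nonnegative terms with total at most `1`. So `z` is
  -- `0` or `1`, and in each case one of the two sums vanishes term by term.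
  have p1 : ∀ i ∈ Finset.univ, 0 ≤ (k i : ℝ) * inner ℝ a (α.root i) := fun i _ =>
    mul_nonneg (by exact_mod_cast hk0 i) (ha.1 i)
  have p2 : ∀ i ∈ Finset.univ, 0 ≤ (((m i : ℤ) : ℝ) - k i) * inner ℝ a (α.root i) := fun i _ =>
    mul_nonneg (sub_nonneg.2 (by exact_mod_cast hkm i)) (ha.1 i)
  have z0 : (0 : ℝ) ≤ z := hz ▸ Finset.sum_nonneg p1
  have z1 : (z : ℝ) ≤ 1 := by
    have := Finset.sum_nonneg p2
    linarith
  have z0' : 0 ≤ z := by exact_mod_cast z0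
  have z1' : z ≤ 1 := by exact_mod_cast z1
  obtain rfl | rfl : z = 0 ∨ z = 1 := by omega
  · left
    intro i
    have := (Finset.sum_eq_zero_iff_of_nonneg p1).1 (by rw [hz]; simp) i (Finset.mem_univ i)
    rcases mul_eq_zero.1 this with h1 | h1
    · exact Or.inl (by exact_mod_cast h1)
    · exact Or.inr h1
  · right
    have h3 := Finset.sum_nonneg p2
    push_cast at hd h3 ha2 ⊢
    have h1 : ∑ i, (m i : ℝ) * inner ℝ a (α.root i) = 1 := by linarith
    refine ⟨h1, fun i => ?_⟩
    rw [h1, sub_self] at hd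
    push_cast at p2
    rcases mul_eq_zero.1 ((Finset.sum_eq_zero_iff_of_nonneg p2).1 hd i (Finset.mem_univ i))
      with h4 | h4
    · left
      have : (k i : ℝ) = m i := by linarith
      exact_mod_cast this
    · exact Or.inr h4

theorem dvd_marks {i : Fin n} (hi : ¬ lng i) : p ∣ m i := by
  obtain ⟨w, hw, j, hj, e⟩ := h.highest_mem
  have := h.dvd_of_long (k := fun i => (m i : ℤ)) ⟨w, hw, j, e⟩
    (by rw [e, inner_weyl_apply, h.inner_long j hj]) hi
  exact_mod_cast this

/-- The character `σ^l` is trivial on the stabilizer of a point of the fundamental region if and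
only if the point lies on no long wall. -/
theorem signLong_stab {a : EuclideanSpace ℝ (Fin n)} (ha : a ∈ α.fundamentalRegion) :
    (∀ g : α.affineWeyl, g.1 a = a → α.signLong (α.retraction g) = 1) ↔ α.OffLongWalls lng a := by
  constructor
  · refine fun H => ⟨fun i hi h1 => ?_, fun h1 => ?_⟩
    · have h2 := H (α.affineSimple i) ((mirror_eq_self_iff (α.root_ne_zero i)).2 h1)
      rw [(h.sign_affineSimple_long hi).2] at h2
      exact absurd h2 (by decide)
    · have h2 := H h.affineZero ((α.affineReflection_eq_self_iff h.highestRoot_ne_zero).2 h1)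
      rw [h.sign_affineZero.2] at h2
      exact absurd h2 (by decide)
  · intro H g hg
    rw [h.signLong_eq]
    refine (h.isHalfSystem (Or.inr rfl)).char_eq_one_of_fixed (fun β hβ z hz => ?_) hg
    rw [Set.Finite.mem_toFinset] at hβ
    obtain ⟨hr, hn, k, hk, rfl⟩ := hβ
    -- Value `0` puts `a` on the wall of a long simple root occurring in the long root; value `1`
    -- puts it on the affine wall.
    rcases h.coeff_of_integral ha hk hr hz with h1 | ⟨h1, -⟩
    · obtain ⟨i, hi, hne⟩ := h.exists_ne_zero_of_long hr hn
      exact H.1 i hi ((h1 i).resolve_left hne)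
    · exact H.2 h1

/-- The character `σ^s` is trivial on the stabilizer of a point of the fundamental region if and
only if the point lies on no short wall. -/
theorem signShort_stab {a : EuclideanSpace ℝ (Fin n)} (ha : a ∈ α.fundamentalRegion) :
    (∀ g : α.affineWeyl, g.1 a = a → α.signShort (α.retraction g) = 1) ↔
      α.OffShortWalls lng a := by
  constructor
  · refine fun H i hi h1 => ?_
    have h2 := H (α.affineSimple i) ((mirror_eq_self_iff (α.root_ne_zero i)).2 h1)
    rw [(h.sign_affineSimple_short hi).1] at h2
    exact absurd h2 (by decide)
  · intro H g hg
    rw [h.signShort_eq]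
    refine (h.isHalfSystem (Or.inl rfl)).char_eq_one_of_fixed (fun β hβ z hz => ?_) hg
    rw [Set.Finite.mem_toFinset] at hβ
    obtain ⟨hr, hn, k, hk, rfl⟩ := hβ
    obtain ⟨i, hi, hd⟩ := h.exists_not_dvd_of_short hn
    -- At a short `i` with `p ∤ k_i`, the coefficient is neither `0` nor `m_i`, because `p ∣ m_i`.
    -- So in both cases `a` lies on the short wall of `α_i`; the affine wall alone cannot account
    -- for an integral short root.
    rcases h.coeff_of_integral ha hk hr hz with h1 | ⟨-, h1⟩
    · refine H i hi ((h1 i).resolve_left fun h2 => hd ?_)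
      rw [h2]; exact dvd_zero _
    · refine H i hi ((h1 i).resolve_left fun h2 => hd ?_)
      rw [h2]; exact_mod_cast h.dvd_marks hi

/-- A point of the fundamental region on a long wall is fixed by an element with signs
`σ^s = 1` and `σ^l = -1`. -/
theorem exists_of_not_offLongWalls {a : EuclideanSpace ℝ (Fin n)}
    (H : ¬ α.OffLongWalls lng a) : ∃ g : α.affineWeyl, g.1 a = a ∧
      α.signShort (α.retraction g) = 1 ∧ α.signLong (α.retraction g) = -1 := by
  by_cases H1 : inner ℝ a α.highestRoot = (1 : ℝ)
  · exact ⟨h.affineZero, (α.affineReflection_eq_self_iff h.highestRoot_ne_zero).2 H1,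
      h.sign_affineZero⟩
  · have : ∃ i, lng i ∧ inner ℝ a (α.root i) = (0 : ℝ) := by
      by_contra! H2
      exact H ⟨H2, H1⟩
    obtain ⟨i, hi, h1⟩ := this
    exact ⟨α.affineSimple i, (mirror_eq_self_iff (α.root_ne_zero i)).2 h1,
      h.sign_affineSimple_long hi⟩

/-- A point of the fundamental region on a short wall is fixed by an element with signs
`σ^s = -1` and `σ^l = 1`. -/
theorem exists_of_not_offShortWalls {a : EuclideanSpace ℝ (Fin n)}
    (H : ¬ α.OffShortWalls lng a) : ∃ g : α.affineWeyl, g.1 a = a ∧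
      α.signShort (α.retraction g) = -1 ∧ α.signLong (α.retraction g) = 1 := by
  rw [OffShortWalls] at H
  push Not at H
  obtain ⟨i, hi, h1⟩ := H
  exact ⟨α.affineSimple i, (mirror_eq_self_iff (α.root_ne_zero i)).2 h1,
    h.sign_affineSimple_short hi⟩

theorem nonempty_negGenerators_short : (α.negGenerators α.signShort).Nonempty := by
  obtain ⟨i, hi⟩ := h.exists_short
  exact ⟨α.affineSimple i, affineSimple_mem i, (h.sign_affineSimple_short hi).1⟩

theorem nonempty_negGenerators_long : (α.negGenerators α.signLong).Nonempty := by
  obtain ⟨i, hi⟩ := h.exists_long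
  exact ⟨α.affineSimple i, affineSimple_mem i, (h.sign_affineSimple_long hi).2⟩

theorem nonempty_negGenerators_det : (α.negGenerators α.signDet).Nonempty := by
  obtain ⟨i, hi⟩ := h.exists_long
  exact ⟨α.affineSimple i, affineSimple_mem i, α.signDet_simpleReflection i⟩

end HasTwoLengths

end SimpleRoots

/-! ### Grid points as lattice points of a simplex, and the master count -/

/-- The number of tuples of natural numbers `s` with `∑ m i * s i ≤ N`. -/
def latticeCount {n : ℕ} (m : Fin n → ℕ) (N : ℤ) : ℕ :=
  {s : Fin n → ℕ | ∑ i, (m i : ℤ) * s i ≤ N}.ncard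

theorem finite_latticePoints {n : ℕ} {m : Fin n → ℕ} (hm : ∀ i, 0 < m i) (N : ℤ) :
    {s : Fin n → ℕ | ∑ i, (m i : ℤ) * s i ≤ N}.Finite := by
  refine (Set.finite_Iic (fun _ : Fin n => N.toNat)).subset fun s hs i => ?_
  have h1 : (m i : ℤ) * s i ≤ ∑ i, (m i : ℤ) * s i :=
    Finset.single_le_sum (f := fun i => (m i : ℤ) * s i) (fun i _ => by positivity)
      (Finset.mem_univ i)
  have h2 : (s i : ℤ) ≤ m i * s i := by
    have := hm i
    nlinarith
  have h3 := Set.mem_ofPred.1 hs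
  simp only
  omega

theorem ncard_latticePoints_ge {n : ℕ} (m u : Fin n → ℕ) (N : ℤ) :
    {s : Fin n → ℕ | ∑ i, (m i : ℤ) * s i ≤ N ∧ ∀ i, u i ≤ s i}.ncard =
      latticeCount m (N - ∑ i, (m i : ℤ) * u i) := by
  rw [latticeCount]
  conv_rhs => rw [← Set.ncard_image_of_injective _ (add_left_injective u)]
  congr 1
  ext s
  simp only [Set.mem_ofPred_eq, Set.mem_image]
  constructor
  · rintro ⟨h1, h2⟩
    refine ⟨s - u, ?_, ?_⟩
    · rw [le_sub_iff_add_le, ← Finset.sum_add_distrib]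
      refine le_trans (Finset.sum_le_sum fun i _ => ?_) h1
      rw [← mul_add, Pi.sub_apply, Nat.cast_sub (h2 i)]
      simp
    · funext i
      simp [h2 i]
  · rintro ⟨t, h1, rfl⟩
    refine ⟨?_, fun i => by simp⟩
    rw [le_sub_iff_add_le, ← Finset.sum_add_distrib] at h1
    refine le_trans (Finset.sum_le_sum fun i _ => ?_) h1
    rw [← mul_add]
    simp

namespace SimpleRoots

variable {n : ℕ} {A : Matrix (Fin n) (Fin n) ℤ} {α : SimpleRoots A}

variable (α) in
/-- The linear equivalence taking `x` to its inner products with the simple roots. -/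
theorem exists_innerEquiv : ∃ T : EuclideanSpace ℝ (Fin n) ≃ₗ[ℝ] (Fin n → ℝ),
    ∀ x i, T x i = inner ℝ x (α.root i) := by
  let T : EuclideanSpace ℝ (Fin n) →ₗ[ℝ] (Fin n → ℝ) :=
    LinearMap.pi fun i => (innerSL ℝ (α.root i)).toLinearMap
  have hT : ∀ x i, T x i = inner ℝ x (α.root i) := fun x i => by
    change inner ℝ (α.root i) x = _
    exact real_inner_comm _ _
  have hinj : Function.Injective T := by
    rw [injective_iff_map_eq_zero]
    intro x hx
    have hspan := α.linearIndependent.span_eq_top_of_card_eq_finrank' (by simp)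
    have hmem : x ∈ Submodule.span ℝ (Set.range α.root) := hspan ▸ Submodule.mem_top
    have h0 : ∀ y ∈ Submodule.span ℝ (Set.range α.root), inner ℝ x y = (0 : ℝ) := by
      intro y hy
      induction hy using Submodule.span_induction with
      | mem y hy =>
        obtain ⟨i, rfl⟩ := hy
        rw [← hT, hx]; rfl
      | zero => exact inner_zero_right _
      | add y z _ _ hy hz => rw [inner_add_right, hy, hz, add_zero]
      | smul r y _ hy => rw [inner_smul_right, hy, mul_zero]
    exact inner_self_eq_zero.1 (h0 x hmem)
  exact ⟨LinearEquiv.ofBijective T ⟨hinj, (LinearMap.injective_iff_surjective_of_finrank_eq_finrank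
    (by simp)).1 hinj⟩, hT⟩

namespace HasTwoLengths

variable {m : Fin n → ℕ} {lng : Fin n → Prop} {p : ℕ} {c : ℝ} (h : α.HasTwoLengths m lng p c)
include h

/-- Parametrization of the grid points of the fundamental region by their coordinates. -/
theorem exists_gridPoint {M : ℕ} (hM : 1 ≤ M) : ∃ pt : (Fin n → ℕ) → EuclideanSpace ℝ (Fin n),
    Function.Injective pt ∧ (∀ s i, (inner ℝ (pt s) (α.root i) : ℝ) = s i / M) ∧
    (∀ s, (inner ℝ (pt s) α.highestRoot : ℝ) = ((∑ i, (m i : ℤ) * s i : ℤ) : ℝ) / M) ∧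
    α.gridRegion M = pt '' {s | ∑ i, (m i : ℤ) * s i ≤ (M : ℤ)} := by
  obtain ⟨T, hT⟩ := α.exists_innerEquiv
  have hM0 : (0 : ℝ) < M := by exact_mod_cast hM
  let pt : (Fin n → ℕ) → EuclideanSpace ℝ (Fin n) := fun s => T.symm fun i => (s i : ℝ) / M
  have hpt : ∀ s i, (inner ℝ (pt s) (α.root i) : ℝ) = s i / M := fun s i => by
    rw [← hT, T.apply_symm_apply]
  have hhigh : ∀ s, (inner ℝ (pt s) α.highestRoot : ℝ) =
      ((∑ i, (m i : ℤ) * s i : ℤ) : ℝ) / M := fun s => by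
    rw [h.highestRoot_eq, inner_comb]
    push_cast
    rw [Finset.sum_div]
    exact Finset.sum_congr rfl fun i _ => by rw [hpt]; ring
  refine ⟨pt, fun s t hst => ?_, hpt, hhigh, ?_⟩
  · funext i
    have h1 := hpt s i
    rw [hst, hpt, div_left_inj' hM0.ne'] at h1
    exact_mod_cast h1.symm
  · ext a
    constructor
    · rintro ⟨hgrid, hF, hF0⟩
      choose k hk using (mem_grid_iff hM).1 hgrid
      have hk0 : ∀ i, 0 ≤ k i := fun i => by
        have : (0 : ℝ) ≤ k i := by
          rw [← hk]; exact mul_nonneg hM0.le (hF i)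
        exact_mod_cast this
      have ha : a = pt fun i => (k i).toNat := by
        apply T.injective
        funext i
        rw [hT, hT, hpt, eq_div_iff hM0.ne', mul_comm, hk]
        exact_mod_cast (Int.toNat_of_nonneg (hk0 i)).symm
      refine ⟨_, ?_, ha.symm⟩
      rw [ha, hhigh, div_le_one hM0] at hF0
      exact_mod_cast hF0
    · rintro ⟨s, hs, rfl⟩
      refine ⟨(mem_grid_iff hM).2 fun i => ⟨s i, ?_⟩, fun i => ?_, ?_⟩
      · rw [hpt, mul_div_cancel₀ _ hM0.ne']; simp
      · rw [hpt]; positivity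
      · rw [hhigh, div_le_one hM0]
        exact_mod_cast hs

theorem finite_gridRegion {M : ℕ} (hM : 1 ≤ M) : (α.gridRegion M).Finite := by
  obtain ⟨pt, -, -, -, e⟩ := h.exists_gridPoint hM
  rw [e]
  exact (finite_latticePoints h.marks_pos _).image _

theorem ncard_gridRegion {M : ℕ} (hM : 1 ≤ M) : (α.gridRegion M).ncard = latticeCount m M := by
  obtain ⟨pt, hinj, -, -, e⟩ := h.exists_gridPoint hM
  rw [e, Set.ncard_image_of_injective _ hinj, latticeCount]

/-- Common form of the wall counts: `u` marks the simple walls to be avoided, and `N` is `M` or, if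
the affine wall is avoided as well, `M - 1`. Translating by `u` lowers the bound by the marks
involved. -/
theorem ncard_sep_gridRegion {M : ℕ} (hM : 1 ≤ M) {P : EuclideanSpace ℝ (Fin n) → Prop}
    (u : Fin n → ℕ) {N : ℤ}
    (hP : ∀ a (s : Fin n → ℕ), (∀ i, (inner ℝ a (α.root i) : ℝ) = s i / M) →
      ((inner ℝ a α.highestRoot : ℝ) = ((∑ i, (m i : ℤ) * s i : ℤ) : ℝ) / M) →
      (∑ i, (m i : ℤ) * s i ≤ (M : ℤ) ∧ P a ↔ ∑ i, (m i : ℤ) * s i ≤ N ∧ ∀ i, u i ≤ s i)) :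
    {a ∈ α.gridRegion M | P a}.ncard = latticeCount m (N - ∑ i, (m i : ℤ) * u i) := by
  obtain ⟨pt, hinj, h1, h2, e⟩ := h.exists_gridPoint hM
  rw [← ncard_latticePoints_ge, ← Set.ncard_image_of_injective _ hinj]
  congr 1
  ext a
  simp only [e, Set.mem_ofPred_eq, Set.mem_image]
  constructor
  · rintro ⟨⟨s, hs, rfl⟩, ha⟩
    exact ⟨s, (hP _ s (h1 s) (h2 s)).1 ⟨hs, ha⟩, rfl⟩
  · rintro ⟨s, hs, rfl⟩
    have := (hP _ s (h1 s) (h2 s)).2 hs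
    exact ⟨⟨s, this.1, rfl⟩, this.2⟩

variable [DecidablePred lng]

theorem ncard_offShortWalls {M : ℕ} (hM : 1 ≤ M) :
    {a ∈ α.gridRegion M | α.OffShortWalls lng a}.ncard =
      latticeCount m (M - ∑ i, (m i : ℤ) * (if lng i then 0 else 1 : ℕ)) := by
  have hM0 : (M : ℝ) ≠ 0 := by exact_mod_cast (by omega : M ≠ 0)
  refine h.ncard_sep_gridRegion hM (fun i => if lng i then 0 else 1) fun a s h1 h2 => ?_
  refine and_congr_right fun _ => forall_congr' fun i => ?_
  rw [h1, Ne, div_eq_zero_iff, or_iff_left hM0, Nat.cast_eq_zero]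
  split_ifs with hi
  · simp [hi]
  · simp [hi, Nat.one_le_iff_ne_zero]

theorem ncard_offLongWalls {M : ℕ} (hM : 1 ≤ M) :
    {a ∈ α.gridRegion M | α.OffLongWalls lng a}.ncard =
      latticeCount m (M - 1 - ∑ i, (m i : ℤ) * (if lng i then 1 else 0 : ℕ)) := by
  have hM0 : (M : ℝ) ≠ 0 := by exact_mod_cast (by omega : M ≠ 0)
  refine h.ncard_sep_gridRegion hM (fun i => if lng i then 1 else 0) fun a s h1 h2 => ?_
  rw [OffLongWalls, and_comm (a := ∀ i, _), ← and_assoc]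
  refine and_congr ?_ (forall_congr' fun i => ?_)
  · rw [h2, Ne, div_eq_one_iff_eq hM0]
    norm_cast
    omega
  · rw [h1, Ne, div_eq_zero_iff, or_iff_left hM0, Nat.cast_eq_zero]
    split_ifs with hi
    · simp [hi, Nat.one_le_iff_ne_zero]
    · simp [hi]

theorem ncard_offWalls {M : ℕ} (hM : 1 ≤ M) :
    {a ∈ α.gridRegion M | α.OffShortWalls lng a ∧ α.OffLongWalls lng a}.ncard =
      latticeCount m (M - 1 - ∑ i, (m i : ℤ) * (1 : ℕ)) := by
  have hM0 : (M : ℝ) ≠ 0 := by exact_mod_cast (by omega : M ≠ 0)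
  refine h.ncard_sep_gridRegion hM (fun _ => 1) fun a s h1 h2 => ?_
  have h3 : α.OffShortWalls lng a ∧ α.OffLongWalls lng a ↔
      inner ℝ a α.highestRoot ≠ (1 : ℝ) ∧ ∀ i, inner ℝ a (α.root i) ≠ (0 : ℝ) := by
    constructor
    · rintro ⟨hs, hl, h0⟩
      exact ⟨h0, fun i => if hi : lng i then hl i hi else hs i hi⟩
    · rintro ⟨h0, hr⟩
      exact ⟨fun i _ => hr i, fun i _ => hr i, h0⟩
  rw [h3, ← and_assoc]
  refine and_congr ?_ (forall_congr' fun i => ?_)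
  · rw [h2, Ne, div_eq_one_iff_eq hM0]
    norm_cast
    omega
  · rw [h1, Ne, div_eq_zero_iff, or_iff_left hM0, Nat.cast_eq_zero]
    simp [Nat.one_le_iff_ne_zero]

omit [DecidablePred lng] in
theorem signDet_stab {a : EuclideanSpace ℝ (Fin n)} (ha : a ∈ α.fundamentalRegion) :
    (∀ g : α.affineWeyl, g.1 a = a → α.signDet (α.retraction g) = 1) ↔
      α.OffShortWalls lng a ∧ α.OffLongWalls lng a := by
  rw [h.signDet_eq]
  constructor
  · intro H
    constructor
    · by_contra H1
      obtain ⟨g, hg, hs, hl⟩ := h.exists_of_not_offShortWalls H1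
      have := H g hg
      rw [MonoidHom.mul_apply, hs, hl] at this
      exact absurd this (by decide)
    · by_contra H1
      obtain ⟨g, hg, hs, hl⟩ := h.exists_of_not_offLongWalls H1
      have := H g hg
      rw [MonoidHom.mul_apply, hs, hl] at this
      exact absurd this (by decide)
  · rintro ⟨H1, H2⟩ g hg
    rw [MonoidHom.mul_apply, (h.signShort_stab ha).2 H1 g hg, (h.signLong_stab ha).2 H2 g hg,
      mul_one]

-- Restricting to `σ^s = 1` loses nothing, since a long wall reflection already satisfies it.
omit [DecidablePred lng] in
theorem signLong_stab_short {a : EuclideanSpace ℝ (Fin n)} (ha : a ∈ α.fundamentalRegion) :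
    (∀ g : α.affineWeyl, g.1 a = a → α.signShort (α.retraction g) = 1 →
      α.signLong (α.retraction g) = 1) ↔ α.OffLongWalls lng a := by
  refine ⟨fun H => ?_, fun H g hg _ => (h.signLong_stab ha).2 H g hg⟩
  by_contra H1
  obtain ⟨g, hg, hs, hl⟩ := h.exists_of_not_offLongWalls H1
  have := H g hg hs
  rw [hl] at this
  exact absurd this (by decide)

omit [DecidablePred lng] in
theorem signShort_stab_long {a : EuclideanSpace ℝ (Fin n)} (ha : a ∈ α.fundamentalRegion) :
    (∀ g : α.affineWeyl, g.1 a = a → α.signLong (α.retraction g) = 1 →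
      α.signShort (α.retraction g) = 1) ↔ α.OffShortWalls lng a := by
  refine ⟨fun H => ?_, fun H g hg _ => (h.signShort_stab ha).2 H g hg⟩
  by_contra H1
  obtain ⟨g, hg, hs, hl⟩ := h.exists_of_not_offShortWalls H1
  have := H g hg hl
  rw [hs] at this
  exact absurd this (by decide)

-- On both a short and a long wall, the product of the two reflections has determinant `1` and `σ^l
-- = -1`. Off the short walls `σ^s` is trivial, so the determinant equals `σ^l`.
omit [DecidablePred lng] in
theorem signLong_stab_det {a : EuclideanSpace ℝ (Fin n)} (ha : a ∈ α.fundamentalRegion) :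
    (∀ g : α.affineWeyl, g.1 a = a → α.signDet (α.retraction g) = 1 →
      α.signLong (α.retraction g) = 1) ↔ α.OffShortWalls lng a ∨ α.OffLongWalls lng a := by
  rw [h.signDet_eq]
  constructor
  · intro H
    by_contra! H1
    obtain ⟨g, hg, hs, hl⟩ := h.exists_of_not_offShortWalls H1.1
    obtain ⟨g', hg', hs', hl'⟩ := h.exists_of_not_offLongWalls H1.2
    have := H (g * g') (by change g.1 (g'.1 a) = a; rw [hg', hg])
      (by simp only [MonoidHom.mul_apply, map_mul, hs, hl, hs', hl']; decide)
    simp only [map_mul, hl, hl'] at this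
    exact absurd this (by decide)
  · rintro (H | H) g hg hd
    · rwa [MonoidHom.mul_apply, (h.signShort_stab ha).2 H g hg, one_mul] at hd
    · exact (h.signLong_stab ha).2 H g hg

/-- The cardinalities of the grid fragments in terms of numbers of lattice points in simplices. -/
theorem gridCounts {M : ℕ} (hM : 1 ≤ M) {hs hl : ℤ}
    (hhs : ∑ i, (m i : ℤ) * (if lng i then 0 else 1 : ℕ) = hs)
    (hhl : 1 + ∑ i, (m i : ℤ) * (if lng i then 1 else 0 : ℕ) = hl) :
    α.GridCount 1 α.signShort M (latticeCount m M + latticeCount m (M - hs)) ∧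
    α.GridCount 1 α.signLong M (latticeCount m M + latticeCount m (M - hl)) ∧
    α.GridCount 1 α.signDet M (latticeCount m M + latticeCount m (M - hs - hl)) ∧
    α.GridCount α.signDet α.signShort M
      (latticeCount m (M - hl) + latticeCount m (M - hs - hl)) ∧
    α.GridCount α.signDet α.signLong M
      (latticeCount m (M - hs) + latticeCount m (M - hs - hl)) ∧
    α.GridCount α.signLong α.signShort M
      (latticeCount m (M - hl) + latticeCount m (M - hs - hl)) ∧
    α.GridCount α.signShort α.signLong M
      (latticeCount m (M - hs) + latticeCount m (M - hs - hl)) ∧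
    α.GridCount α.signLong α.signDet M
      (latticeCount m (M - hs) + latticeCount m (M - hl)) := by
  have h0 := h.highestRoot_ne_zero
  have hfin := h.finite_gridRegion hM
  have c1 := h.ncard_gridRegion hM
  have cs := h.ncard_offShortWalls hM
  have cl := h.ncard_offLongWalls hM
  have ce := h.ncard_offWalls hM
  rw [hhs] at cs
  rw [sub_sub, hhl] at cl
  have hsum : (M : ℤ) - 1 - ∑ i, (m i : ℤ) * (1 : ℕ) = M - hs - hl := by
    rw [← hhs, ← hhl]
    have : ∑ i, (m i : ℤ) * (1 : ℕ) = ∑ i, (m i : ℤ) * (if lng i then 0 else 1 : ℕ) +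
        ∑ i, (m i : ℤ) * (if lng i then 1 else 0 : ℕ) := by
      rw [← Finset.sum_add_distrib]
      refine Finset.sum_congr rfl fun i _ => ?_
      split_ifs <;> simp
    rw [this]
    ring
  rw [hsum] at ce
  have key : ∀ {P Q : EuclideanSpace ℝ (Fin n) → Prop} {N : ℕ},
      {a ∈ α.gridRegion M | Q a}.ncard = N → (∀ a ∈ α.fundamentalRegion, (P a ↔ Q a)) →
      {a ∈ α.gridRegion M | P a}.ncard = N := by
    intro P Q N hN hPQ
    rw [← hN]
    congr 1
    ext a
    exact and_congr_right fun ha => hPQ a ha.2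
  have call : {a ∈ α.gridRegion M | True}.ncard = latticeCount m M := by
    rw [← c1]; simp
  refine ⟨?_, ?_, ?_, ?_, ?_, ?_, ?_, ?_⟩
  · refine gridCount_of_ncard h0 hM h.nonempty_negGenerators_short hfin
      (key call fun a _ => ?_) (key cs fun a ha => ?_)
    · simp
    · simpa using h.signShort_stab ha
  · refine gridCount_of_ncard h0 hM h.nonempty_negGenerators_long hfin
      (key call fun a _ => ?_) (key cl fun a ha => ?_)
    · simp
    · simpa using h.signLong_stab ha
  · refine gridCount_of_ncard h0 hM h.nonempty_negGenerators_det hfin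
      (key call fun a _ => ?_) (key ce fun a ha => ?_)
    · simp
    · simpa using h.signDet_stab ha
  · refine gridCount_of_ncard h0 hM h.nonempty_negGenerators_short hfin
      (key cl fun a ha => ?_) (key ce fun a ha => ?_)
    · rw [← h.signLong_stab_short ha, h.signDet_eq]
      refine forall_congr' fun g => forall_congr' fun _ => forall_congr' fun h1 => ?_
      rw [MonoidHom.mul_apply, h1, one_mul]
    · rw [h.signShort_stab ha, h.signDet_stab ha]; tauto
  · refine gridCount_of_ncard h0 hM h.nonempty_negGenerators_long hfin
      (key cs fun a ha => ?_) (key ce fun a ha => ?_)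
    · rw [← h.signShort_stab_long ha, h.signDet_eq]
      refine forall_congr' fun g => forall_congr' fun _ => forall_congr' fun h1 => ?_
      rw [MonoidHom.mul_apply, h1, mul_one]
    · rw [h.signLong_stab ha, h.signDet_stab ha]; tauto
  · refine gridCount_of_ncard h0 hM h.nonempty_negGenerators_short hfin
      (key cl fun a ha => h.signLong_stab_short ha) (key ce fun a ha => ?_)
    rw [h.signShort_stab ha, h.signLong_stab ha]
  · refine gridCount_of_ncard h0 hM h.nonempty_negGenerators_long hfin
      (key cs fun a ha => h.signShort_stab_long ha) (key ce fun a ha => ?_)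
    rw [h.signShort_stab ha, h.signLong_stab ha, and_comm]
  -- The piece in `F` is the union of the points off short walls and those off long walls, the
  -- translated piece is their intersection; the sizes of union and intersection add up to those of
  -- the two sets.
  · have hu := Set.ncard_union_add_ncard_inter {a ∈ α.gridRegion M | α.OffShortWalls lng a}
      {a ∈ α.gridRegion M | α.OffLongWalls lng a}
      (hfin.subset (Set.sep_subset _ _)) (hfin.subset (Set.sep_subset _ _))
    rw [← Set.sep_or, ← Set.sep_and, cs, cl, ce] at hu
    have := gridCount_of_ncard h0 hM h.nonempty_negGenerators_det hfin
      (key rfl fun a ha => h.signLong_stab_det ha)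
      (key ce fun a ha => by
        rw [h.signLong_stab ha, h.signDet_stab ha]; tauto)
    rw [← Nat.cast_add] at this ⊢
    rwa [hu] at this

end HasTwoLengths

end SimpleRoots

theorem SimpleRoots.GridCount.sameGridCount {n : ℕ} {A B : Matrix (Fin n) (Fin n) ℤ}
    {α : SimpleRoots A} {τ σ : α.weyl →* ℤˣ} {β : SimpleRoots B} {τ' σ' : β.weyl →* ℤˣ} {M : ℕ}
    {N : ℤ} (hα : α.GridCount τ σ M N) (hβ : β.GridCount τ' σ' M N) :
    SameGridCount α τ σ β τ' σ' M := by
  refine ⟨hα.1, hβ.1, fun r hr r' hr' => ?_⟩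
  obtain ⟨f1, e1⟩ := hα.2 r hr
  obtain ⟨f2, e2⟩ := hβ.2 r' hr'
  rw [← f1.cast_ncard_eq, ← f2.cast_ncard_eq]
  rw [← e2] at e1
  exact_mod_cast e1

/-! ### Types `C_n` and `B_n` through signed permutations of a frame -/

namespace SimpleRoots

variable {n : ℕ} {A : Matrix (Fin n) (Fin n) ℤ} {α : SimpleRoots A}

variable (α) in
/-- Vectors `e 0, e 1, …` permuted up to sign by the Weyl group, such that the simple roots are
`e 0 - e 1, …, e (n - 2) - e (n - 1), κ • e (n - 1)`. -/
structure IsFrame (e : ℕ → EuclideanSpace ℝ (Fin n)) (κ : ℝ) : Prop where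
  root_lt : ∀ i : Fin n, i.val + 1 < n → α.root i = e i - e (i + 1)
  root_last : ∀ i : Fin n, i.val + 1 = n → α.root i = κ • e i
  mirror_lt : ∀ i : Fin n, i.val + 1 < n → ∀ j < n,
    mirror (α.root i) (e j) = e (Equiv.swap i.val (i.val + 1) j)
  mirror_last : ∀ i : Fin n, i.val + 1 = n → ∀ j < n,
    mirror (α.root i) (e j) = if j = i then -e j else e j

variable (α) in
/-- The sum of the simple roots from the `j`-th on, the last one with coefficient `t`. -/
def tailSum (t : ℝ) (j : ℕ) : EuclideanSpace ℝ (Fin n) :=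
  ∑ i : Fin n, (if i.val < j then 0 else if i.val + 1 = n then t else 1 : ℝ) • α.root i

theorem tailSum_of_le (t : ℝ) {j : ℕ} (hj : n ≤ j) : α.tailSum t j = 0 :=
  Finset.sum_eq_zero fun i _ => by rw [if_pos (by omega), zero_smul]

theorem tailSum_eq_add (t : ℝ) (j : Fin n) :
    α.tailSum t j = (if j.val + 1 = n then t else 1 : ℝ) • α.root j + α.tailSum t (j + 1) := by
  rw [tailSum, tailSum, ← Finset.add_sum_erase Finset.univ _ (Finset.mem_univ j),
    ← Finset.add_sum_erase Finset.univ _ (Finset.mem_univ j)]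
  simp only [lt_irrefl, if_false, Nat.lt_succ_self, if_true, zero_smul, zero_add]
  congr 1
  refine Finset.sum_congr rfl fun i hi => ?_
  have hne : i.val ≠ j.val := fun h => (Finset.mem_erase.1 hi).1 (Fin.ext h)
  by_cases h : i.val < j.val
  · rw [if_pos h, if_pos (by omega)]
  · rw [if_neg h, if_neg (show ¬ i.val < j.val + 1 by omega)]

/-- The pairing of `e j` with the `k`-th simple coroot. -/
def framePairing (n : ℕ) (t : ℝ) (j k : ℕ) : ℝ :=
  if n ≤ j then 0 else if k + 1 = n then (if j = k then 2 * t else 0) else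
    if j = k then 1 else if j = k + 1 then -1 else 0

theorem inner_tailSum {t : ℝ} (hA : ∀ j k : Fin n, (if j.val + 1 = n then t else 1 : ℝ) * A j k =
    framePairing n t j k - framePairing n t (j + 1) k) (k : Fin n) {j : ℕ} (hj : j ≤ n) :
    inner ℝ (α.tailSum t j) (coroot (α.root k)) = framePairing n t j k := by
  induction hj using Nat.decreasingInduction with
  | self => rw [tailSum_of_le t le_rfl, inner_zero_left, framePairing, if_pos le_rfl]
  | of_succ j hj ih =>
    have h1 := α.tailSum_eq_add t ⟨j, hj⟩
    have h2 := hA ⟨j, hj⟩ k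
    simp only at h1 h2
    rw [h1, inner_add_left, ih, inner_smul_left, inner_root_coroot, conj_trivial, h2,
      sub_add_cancel]

/-- Tail sums are chosen so that consecutive differences are the simple roots, with the tail sum at
`n` being zero. The hypothesis says that `framePairing` telescopes to the Cartan matrix, so it gives
the pairings of the frame with simple coroots and hence the reflections. -/
theorem isFrame_tailSum {t : ℝ} (ht : t ≠ 0)
    (hA : ∀ j k : Fin n, (if j.val + 1 = n then t else 1 : ℝ) * A j k =
      framePairing n t j k - framePairing n t (j + 1) k) :
    α.IsFrame (α.tailSum t) t⁻¹ := by
  have h1 : ∀ i : Fin n, i.val + 1 < n → α.root i = α.tailSum t i - α.tailSum t (i + 1) := by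
    intro i hi
    rw [tailSum_eq_add, if_neg hi.ne, one_smul, add_sub_cancel_right]
  have h2 : ∀ i : Fin n, i.val + 1 = n → α.root i = t⁻¹ • α.tailSum t i := by
    intro i hi
    rw [tailSum_eq_add, if_pos hi, tailSum_of_le t hi.ge, add_zero, smul_smul,
      inv_mul_cancel₀ ht, one_smul]
  refine ⟨h1, h2, fun i hi j hj => ?_, fun i hi j hj => ?_⟩
  · rw [mirror_eq_sub, inner_tailSum hA i hj.le, h1 i hi, framePairing, if_neg (by omega),
      if_neg (by omega)]
    by_cases hji : j = i
    · rw [if_pos hji, hji, Equiv.swap_apply_left]; simp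
    · by_cases hji' : j = i + 1
      · rw [if_neg hji, if_pos hji', hji', Equiv.swap_apply_right]; simp
      · rw [if_neg hji, if_neg hji', Equiv.swap_apply_of_ne_of_ne hji hji']; simp
  · rw [mirror_eq_sub, inner_tailSum hA i hj.le, h2 i hi, framePairing, if_neg (by omega),
      if_pos hi]
    split_ifs with hji
    · rw [hji, smul_smul, mul_assoc, mul_inv_cancel₀ ht]; module
    · simp

theorem isFrame_C {n : ℕ} (α : SimpleRoots (CartanMatrix.C n)) :
    α.IsFrame (α.tailSum (1 / 2)) 2 := by
  have := α.isFrame_tailSum (t := 1 / 2) (by norm_num) fun j k => by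
    have := j.2
    have := k.2
    simp only [framePairing, CartanMatrix.C, Matrix.of_apply, Fin.ext_iff]
    split_ifs <;> first | omega | norm_num
  simpa using this

theorem isFrame_B {n : ℕ} (α : SimpleRoots (CartanMatrix.B n)) : α.IsFrame (α.tailSum 1) 1 := by
  have := α.isFrame_tailSum (t := 1) one_ne_zero fun j k => by
    have := j.2
    have := k.2
    simp only [framePairing, CartanMatrix.B, Matrix.of_apply, Fin.ext_iff]
    split_ifs <;> first | omega | norm_num
  simpa using this

variable (α) in
/-- The monoid of nonnegative integral combinations of simple roots. -/
def posCone : AddSubmonoid (EuclideanSpace ℝ (Fin n)) := AddSubmonoid.closure (Set.range α.root)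

theorem root_mem_posCone (i : Fin n) : α.root i ∈ α.posCone :=
  AddSubmonoid.subset_closure ⟨i, rfl⟩

theorem exists_comb_of_mem_posCone {x : EuclideanSpace ℝ (Fin n)} (hx : x ∈ α.posCone) :
    ∃ k : Fin n → ℤ, (∀ i, 0 ≤ k i) ∧ x = α.comb k := by
  obtain ⟨k, rfl⟩ := AddSubmonoid.mem_closure_range_iff_of_fintype.1 hx
  exact ⟨fun i => k i, fun i => by positivity, by simp [comb]⟩

/-- Comparing `±β` with `0` and the vector of marks in the cone order amounts to comparing
coefficients, by linear independence. -/
theorem bounds_of_posCone {m : Fin n → ℕ} {β : EuclideanSpace ℝ (Fin n)}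
    (hβ : (β ∈ α.posCone ∧ α.comb (fun i => (m i : ℤ)) - β ∈ α.posCone) ∨
      (-β ∈ α.posCone ∧ α.comb (fun i => (m i : ℤ)) + β ∈ α.posCone)) :
    ∃ k : Fin n → ℤ, β = α.comb k ∧
      ((∀ i, 0 ≤ k i ∧ k i ≤ m i) ∨ ∀ i, -(m i : ℤ) ≤ k i ∧ k i ≤ 0) := by
  have key : ∀ x ∈ α.posCone, α.comb (fun i => (m i : ℤ)) - x ∈ α.posCone →
      ∃ k : Fin n → ℤ, x = α.comb k ∧ ∀ i, 0 ≤ k i ∧ k i ≤ m i := by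
    intro x hx hx'
    obtain ⟨k, hk, rfl⟩ := exists_comb_of_mem_posCone hx
    obtain ⟨l, hl, e⟩ := exists_comb_of_mem_posCone hx'
    rw [← comb_sub] at e
    have e := α.comb_injective e
    refine ⟨k, rfl, fun i => ⟨hk i, ?_⟩⟩
    have h1 := congrFun e i
    have h2 := hl i
    simp only [Pi.sub_apply] at h1
    omega
  rcases hβ with ⟨h1, h2⟩ | ⟨h1, h2⟩
  · obtain ⟨k, e, hk⟩ := key β h1 h2
    exact ⟨k, e, Or.inl hk⟩
  · obtain ⟨k, e, hk⟩ := key (-β) h1 (by rwa [sub_neg_eq_add])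
    refine ⟨-k, by rw [comb_neg, ← e, neg_neg], Or.inr fun i => ?_⟩
    have := hk i
    simp only [Pi.neg_apply]
    omega

namespace IsFrame

variable {e : ℕ → EuclideanSpace ℝ (Fin n)} {κ : ℝ} (hf : α.IsFrame e κ)
include hf

theorem exists_perm (i : Fin n) : ∃ π : Equiv.Perm ℕ, (∀ j < n, π j < n) ∧
    ∀ j < n, ∃ s : ℤ, (s = 1 ∨ s = -1) ∧ mirror (α.root i) (e j) = s • e (π j) := by
  by_cases hi : i.val + 1 = n
  · refine ⟨1, fun j hj => hj, fun j hj => ?_⟩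
    rw [hf.mirror_last i hi j hj]
    split_ifs
    · exact ⟨-1, Or.inr rfl, by simp⟩
    · exact ⟨1, Or.inl rfl, by simp⟩
  · have hi' : i.val + 1 < n := by have := i.2; omega
    refine ⟨Equiv.swap i.val (i.val + 1), fun j hj => ?_, fun j hj => ⟨1, Or.inl rfl, ?_⟩⟩
    · rw [Equiv.swap_apply_def]
      split_ifs <;> omega
    · rw [hf.mirror_lt i hi' j hj, one_smul]

theorem sub_mem {j l : ℕ} (hjl : j ≤ l) (hl : l < n) : e j - e l ∈ α.posCone := by
  induction l, hjl using Nat.le_induction with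
  | base => rw [sub_self]; exact zero_mem _
  | succ l hjl ih =>
    have h1 := hf.root_lt ⟨l, by omega⟩ hl
    rw [← sub_add_sub_cancel, ← h1]
    exact add_mem (ih (by omega)) (root_mem_posCone _)

end IsFrame

theorem smul_inner_root_comm (i j : Fin n) : (A i j : ℝ) * inner ℝ (α.root j) (α.root j) =
    A j i * inner ℝ (α.root i) (α.root i) := by
  rw [← two_inner_root, ← two_inner_root, real_inner_comm]

section TypeC

variable {n : ℕ} (α : SimpleRoots (CartanMatrix.C n))

theorem inner_root_C_short (hn : 2 ≤ n) (i : ℕ) (hi : i + 1 < n) :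
    inner ℝ (α.root ⟨i, by omega⟩) (α.root ⟨i, by omega⟩) =
      (inner ℝ (α.root ⟨0, by omega⟩) (α.root ⟨0, by omega⟩) : ℝ) := by
  induction i with
  | zero => rfl
  | succ i ih =>
    rw [← ih (by omega)]
    have h1 := α.smul_inner_root_comm ⟨i, by omega⟩ ⟨i + 1, by omega⟩
    have e1 : CartanMatrix.C n ⟨i, by omega⟩ ⟨i + 1, by omega⟩ = -1 := by
      simp [CartanMatrix.C]
    have e2 : CartanMatrix.C n ⟨i + 1, by omega⟩ ⟨i, by omega⟩ = -1 := by
      simp only [CartanMatrix.C, Matrix.of_apply, Fin.ext_iff]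
      split_ifs <;> omega
    rw [e1, e2] at h1
    push_cast at h1
    linarith

/-- In the frame `e` the roots are of the form `±e_j ± e_l`, the long ones being `±2 e_j`, and the
highest root is `2 e_0`. The bounds follow by splitting `2 e_0 ∓ β` into two vectors `e_0 ± e_l`. -/
theorem hasTwoLengths_C (hn : 2 ≤ n) : α.HasTwoLengths (fun i => if i.val + 1 = n then 1 else 2)
    (fun i => i.val + 1 = n) 2 (inner ℝ (α.root ⟨0, by omega⟩) (α.root ⟨0, by omega⟩)) := by
  have hf := α.isFrame_C
  set e := α.tailSum (1 / 2) with he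
  obtain ⟨last, hlast⟩ : ∃ l : Fin n, l.val + 1 = n := ⟨⟨n - 1, by omega⟩, by simp; omega⟩
  have hξ : α.comb (fun i => ((if i.val + 1 = n then 1 else 2 : ℕ) : ℤ)) = (2 : ℤ) • e 0 := by
    rw [he, tailSum, comb, Finset.smul_sum]
    refine Finset.sum_congr rfl fun i _ => ?_
    rw [← Int.cast_smul_eq_zsmul ℝ, ← Int.cast_smul_eq_zsmul ℝ, smul_smul]
    split_ifs <;> first | omega | norm_num
  have htwo : ∀ j < n, (2 : ℤ) • e j ∈ α.posCone := by
    intro j hj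
    have h1 := hf.sub_mem (j := j) (l := last) (by omega) last.2
    have h2 : (2 : ℤ) • e j = (e j - e last) + (e j - e last) + α.root last := by
      rw [hf.root_last last hlast]; module
    rw [h2]
    exact add_mem (add_mem h1 h1) (root_mem_posCone _)
  have hadd : ∀ j l : ℕ, j ≤ l → l < n → ∀ s : ℤ, s = 1 ∨ s = -1 →
      e j - s • e l ∈ α.posCone := by
    rintro j l hjl hl s (rfl | rfl)
    · rw [one_smul]; exact hf.sub_mem hjl hl
    · have : e j - (-1 : ℤ) • e l = (e j - e l) + (2 : ℤ) • e l := by module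
      rw [this]
      exact add_mem (hf.sub_mem hjl hl) (htwo l hl)
  -- Equality `j = l` is allowed, so the description also contains the zero vector; only the
  -- containment of the roots is needed.
  have hroots : ∀ β ∈ α.roots, ∃ j < n, ∃ l < n, ∃ s t : ℤ, (s = 1 ∨ s = -1) ∧
      (t = 1 ∨ t = -1) ∧ β = s • e j - t • e l := by
    intro β hβ
    refine roots_induction (p := fun β => ∃ j < n, ∃ l < n, ∃ s t : ℤ, (s = 1 ∨ s = -1) ∧
      (t = 1 ∨ t = -1) ∧ β = s • e j - t • e l) ?_ ?_ hβ
    · intro i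
      by_cases hi : i.val + 1 = n
      · refine ⟨i, i.2, i, i.2, 1, -1, Or.inl rfl, Or.inr rfl, ?_⟩
        rw [hf.root_last i hi]; module
      · refine ⟨i, i.2, i + 1, by omega, 1, 1, Or.inl rfl, Or.inl rfl, ?_⟩
        rw [hf.root_lt i (by omega)]; module
    · rintro i _ - ⟨j, hj, l, hl, s, t, hs, ht, rfl⟩
      obtain ⟨π, hπ, hm⟩ := hf.exists_perm i
      obtain ⟨s', hs', e1⟩ := hm j hj
      obtain ⟨t', ht', e2⟩ := hm l hl
      refine ⟨π j, hπ j hj, π l, hπ l hl, s * s', t * t', ?_, ?_, ?_⟩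
      · rcases hs with rfl | rfl <;> rcases hs' with rfl | rfl <;> simp
      · rcases ht with rfl | rfl <;> rcases ht' with rfl | rfl <;> simp
      · rw [map_sub, map_zsmul, map_zsmul, e1, e2, smul_smul, smul_smul]
  refine ⟨Nat.prime_two, ?_, ?_, ?_, ⟨last, hlast⟩, ⟨⟨0, by omega⟩, by simp; omega⟩,
    fun i => by split_ifs <;> norm_num, ?_, ?_⟩
  · exact real_inner_self_pos.2 (α.root_ne_zero _)
  · intro i hi
    rw [← α.inner_root_C_short hn (n - 2) (by omega)]
    have h1 := α.smul_inner_root_comm i ⟨n - 2, by omega⟩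
    have e1 : CartanMatrix.C n i ⟨n - 2, by omega⟩ = -2 := by
      simp only [CartanMatrix.C, Matrix.of_apply, Fin.ext_iff]
      split_ifs <;> omega
    have e2 : CartanMatrix.C n ⟨n - 2, by omega⟩ i = -1 := by
      simp only [CartanMatrix.C, Matrix.of_apply, Fin.ext_iff]
      split_ifs <;> omega
    rw [e1, e2] at h1
    push_cast at h1 ⊢
    linarith
  · intro i hi
    exact α.inner_root_C_short hn i (by omega)
  · rw [hξ]
    have hstep : ∀ (k : Fin n) (x : EuclideanSpace ℝ (Fin n)),
        (∃ w ∈ α.weyl, x = w (α.root last)) →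
        ∃ w ∈ α.weyl, mirror (α.root k) x = w (α.root last) := by
      rintro k _ ⟨w, hw, rfl⟩
      exact ⟨mirror (α.root k) * w, mul_mem (α.mirror_mem_weyl _) hw, rfl⟩
    -- Adjacent transpositions carry the last simple root `2 e_last` down to `2 e_0`.
    suffices ∀ j ≤ last.val, ∃ w ∈ α.weyl, (2 : ℤ) • e j = w (α.root last) by
      obtain ⟨w, hw, h1⟩ := this 0 (Nat.zero_le _)
      exact ⟨w, hw, last, hlast, h1⟩
    intro j hj
    induction hj using Nat.decreasingInduction with
    | self =>
      refine ⟨1, one_mem _, ?_⟩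
      change _ = α.root last
      rw [hf.root_last last hlast]; module
    | of_succ j hj ih =>
      have h1 := hstep ⟨j, by omega⟩ _ ih
      rwa [map_zsmul, hf.mirror_lt _ (by simp only; omega) _ (by omega),
        Equiv.swap_apply_right] at h1
  · intro β hβ
    apply bounds_of_posCone
    rw [hξ]
    have key : ∀ j l : ℕ, j ≤ l → l < n → ∀ s t : ℤ, (s = 1 ∨ s = -1) → (t = 1 ∨ t = -1) →
        β = s • e j - t • e l → (β ∈ α.posCone ∧ (2 : ℤ) • e 0 - β ∈ α.posCone) ∨
          (-β ∈ α.posCone ∧ (2 : ℤ) • e 0 + β ∈ α.posCone) := by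
      rintro j l hjl hl s t hs ht rfl
      have hneg : ∀ t : ℤ, t = 1 ∨ t = -1 → -t = 1 ∨ -t = -1 := by
        rintro t (rfl | rfl) <;> simp
      rcases hs with rfl | rfl
      · left
        refine ⟨by rw [one_smul]; exact hadd j l hjl hl t ht, ?_⟩
        have : (2 : ℤ) • e 0 - ((1 : ℤ) • e j - t • e l) =
            (e 0 - (1 : ℤ) • e j) + (e 0 - (-t) • e l) := by module
        rw [this]
        exact add_mem (hadd 0 j (by omega) (by omega) _ (by simp))
          (hadd 0 l (by omega) hl _ (hneg t ht))
      · right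
        constructor
        · have : -((-1 : ℤ) • e j - t • e l) = e j - (-t) • e l := by module
          rw [this]
          exact hadd j l hjl hl _ (hneg t ht)
        · have : (2 : ℤ) • e 0 + ((-1 : ℤ) • e j - t • e l) =
              (e 0 - (1 : ℤ) • e j) + (e 0 - t • e l) := by module
          rw [this]
          exact add_mem (hadd 0 j (by omega) (by omega) _ (by simp))
            (hadd 0 l (by omega) hl _ ht)
    obtain ⟨j, hj, l, hl, s, t, hs, ht, e1⟩ := hroots β hβ
    rcases le_total j l with hjl | hjl
    · exact key j l hjl hl s t hs ht e1
    · refine key l j hjl hj (-t) (-s) ?_ ?_ (by rw [e1]; module)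
      · rcases ht with rfl | rfl <;> simp
      · rcases hs with rfl | rfl <;> simp

end TypeC

section TypeB

variable {n : ℕ} (α : SimpleRoots (CartanMatrix.B n))

theorem inner_root_B_long (hn : 2 ≤ n) (i : ℕ) (hi : i + 1 < n) :
    inner ℝ (α.root ⟨i, by omega⟩) (α.root ⟨i, by omega⟩) =
      (inner ℝ (α.root ⟨0, by omega⟩) (α.root ⟨0, by omega⟩) : ℝ) := by
  induction i with
  | zero => rfl
  | succ i ih =>
    rw [← ih (by omega)]
    have h1 := α.smul_inner_root_comm ⟨i, by omega⟩ ⟨i + 1, by omega⟩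
    have e1 : CartanMatrix.B n ⟨i, by omega⟩ ⟨i + 1, by omega⟩ = -1 := by
      simp only [CartanMatrix.B, Matrix.of_apply, Fin.ext_iff]
      split_ifs <;> omega
    have e2 : CartanMatrix.B n ⟨i + 1, by omega⟩ ⟨i, by omega⟩ = -1 := by
      simp only [CartanMatrix.B, Matrix.of_apply, Fin.ext_iff]
      split_ifs <;> omega
    rw [e1, e2] at h1
    push_cast at h1
    linarith

/-- In the frame `e` the short roots are `±e_j`, the long ones `±e_j ± e_l` with `j ≠ l`, and the
highest root is `e_0 + e_1`. -/
theorem hasTwoLengths_B (hn : 2 ≤ n) : α.HasTwoLengths (fun i => if i.val = 0 then 1 else 2)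
    (fun i => i.val + 1 ≠ n) 2
    (1 / 2 * inner ℝ (α.root ⟨0, by omega⟩) (α.root ⟨0, by omega⟩)) := by
  have hf := α.isFrame_B
  set e := α.tailSum 1 with he
  obtain ⟨last, hlast⟩ : ∃ l : Fin n, l.val + 1 = n := ⟨⟨n - 1, by omega⟩, by simp; omega⟩
  have hξ : α.comb (fun i => ((if i.val = 0 then 1 else 2 : ℕ) : ℤ)) = e 0 + e 1 := by
    rw [he, tailSum, tailSum, comb, ← Finset.sum_add_distrib]
    refine Finset.sum_congr rfl fun i _ => ?_
    rw [← Int.cast_smul_eq_zsmul ℝ, ← add_smul]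
    split_ifs <;> first | omega | norm_num
  have hone : ∀ j < n, e j ∈ α.posCone := by
    intro j hj
    have h1 := hf.sub_mem (j := j) (l := last) (by omega) last.2
    have h2 : e j = (e j - e last) + α.root last := by
      rw [hf.root_last last hlast]; module
    rw [h2]
    exact add_mem h1 (root_mem_posCone _)
  have hadd : ∀ j l : ℕ, j ≤ l → l < n → ∀ s : ℤ, s = 1 ∨ s = -1 →
      e j - s • e l ∈ α.posCone := by
    rintro j l hjl hl s (rfl | rfl)
    · rw [one_smul]; exact hf.sub_mem hjl hl
    · have : e j - (-1 : ℤ) • e l = e j + e l := by module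
      rw [this]
      exact add_mem (hone j (by omega)) (hone l hl)
  -- The condition `j ≠ l` has to be carried along, since `2 e_0` is not below `e_0 + e_1`.
  have hroots : ∀ β ∈ α.roots, (∃ j < n, ∃ s : ℤ, (s = 1 ∨ s = -1) ∧ β = s • e j) ∨
      ∃ j < n, ∃ l < n, ∃ s t : ℤ, j ≠ l ∧ (s = 1 ∨ s = -1) ∧
      (t = 1 ∨ t = -1) ∧ β = s • e j - t • e l := by
    intro β hβ
    refine roots_induction (p := fun β => (∃ j < n, ∃ s : ℤ, (s = 1 ∨ s = -1) ∧ β = s • e j) ∨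
      ∃ j < n, ∃ l < n, ∃ s t : ℤ, j ≠ l ∧ (s = 1 ∨ s = -1) ∧
      (t = 1 ∨ t = -1) ∧ β = s • e j - t • e l) ?_ ?_ hβ
    · intro i
      by_cases hi : i.val + 1 = n
      · refine Or.inl ⟨i, i.2, 1, Or.inl rfl, ?_⟩
        rw [hf.root_last i hi, one_smul, one_smul]
      · refine Or.inr ⟨i, i.2, i + 1, by omega, 1, 1, by omega, Or.inl rfl, Or.inl rfl, ?_⟩
        rw [hf.root_lt i (by omega)]; module
    · rintro i _ - (⟨j, hj, s, hs, rfl⟩ | ⟨j, hj, l, hl, s, t, hjl, hs, ht, rfl⟩)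
      · obtain ⟨π, hπ, hm⟩ := hf.exists_perm i
        obtain ⟨s', hs', e1⟩ := hm j hj
        refine Or.inl ⟨π j, hπ j hj, s * s', ?_, ?_⟩
        · rcases hs with rfl | rfl <;> rcases hs' with rfl | rfl <;> simp
        · rw [map_zsmul, e1, smul_smul]
      · obtain ⟨π, hπ, hm⟩ := hf.exists_perm i
        obtain ⟨s', hs', e1⟩ := hm j hj
        obtain ⟨t', ht', e2⟩ := hm l hl
        refine Or.inr ⟨π j, hπ j hj, π l, hπ l hl, s * s', t * t', π.injective.ne hjl, ?_, ?_, ?_⟩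
        · rcases hs with rfl | rfl <;> rcases hs' with rfl | rfl <;> simp
        · rcases ht with rfl | rfl <;> rcases ht' with rfl | rfl <;> simp
        · rw [map_sub, map_zsmul, map_zsmul, e1, e2, smul_smul, smul_smul]
  have hneg : ∀ t : ℤ, t = 1 ∨ t = -1 → -t = 1 ∨ -t = -1 := by
    rintro t (rfl | rfl) <;> simp
  refine ⟨Nat.prime_two, ?_, ?_, ?_, ⟨⟨0, by omega⟩, by simp; omega⟩, ⟨last, by simp [hlast]⟩,
    fun i => by split_ifs <;> norm_num, ?_, ?_⟩
  · have : (0 : ℝ) < inner ℝ (α.root ⟨0, by omega⟩) (α.root ⟨0, by omega⟩) :=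
      real_inner_self_pos.2 (α.root_ne_zero _)
    positivity
  · intro i hi
    rw [α.inner_root_B_long hn i (by omega)]
    push_cast
    ring
  · intro i hi
    rw [not_not] at hi
    rw [← α.inner_root_B_long hn (n - 2) (by omega)]
    have h1 := α.smul_inner_root_comm i ⟨n - 2, by omega⟩
    have e1 : CartanMatrix.B n i ⟨n - 2, by omega⟩ = -1 := by
      simp only [CartanMatrix.B, Matrix.of_apply, Fin.ext_iff]
      split_ifs <;> omega
    have e2 : CartanMatrix.B n ⟨n - 2, by omega⟩ i = -2 := by
      simp only [CartanMatrix.B, Matrix.of_apply, Fin.ext_iff]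
      split_ifs <;> omega
    rw [e1, e2] at h1
    push_cast at h1 ⊢
    linarith
  · rw [hξ]
    have hstep : ∀ (k : Fin n) (x : EuclideanSpace ℝ (Fin n)),
        (∃ w ∈ α.weyl, x = w (α.root ⟨0, by omega⟩)) →
        ∃ w ∈ α.weyl, mirror (α.root k) x = w (α.root ⟨0, by omega⟩) := by
      rintro k _ ⟨w, hw, rfl⟩
      exact ⟨mirror (α.root k) * w, mul_mem (α.mirror_mem_weyl _) hw, rfl⟩
    -- The orbit path is `e_0 - e_1`, up to `e_0 - e_last`, then `e_0 + e_last` by the last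
    -- reflection, then down to `e_0 + e_1`.
    have hsub : ∀ j, 1 ≤ j → j < n → ∃ w ∈ α.weyl, e 0 - e j = w (α.root ⟨0, by omega⟩) := by
      intro j hj
      induction j, hj using Nat.le_induction with
      | base => exact fun _ => ⟨1, one_mem _, (hf.root_lt ⟨0, by omega⟩ (by simp only; omega)).symm⟩
      | succ j hj ih =>
        intro hjn
        have h1 := hstep ⟨j, by omega⟩ _ (ih (by omega))
        rwa [map_sub, hf.mirror_lt _ (by simp only; omega) _ (by omega),
          hf.mirror_lt _ (by simp only; omega) _ (by omega), Equiv.swap_apply_left,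
          Equiv.swap_apply_of_ne_of_ne (by simp only; omega) (by simp)] at h1
    suffices ∀ j ≤ last.val, 1 ≤ j → ∃ w ∈ α.weyl, e 0 + e j = w (α.root ⟨0, by omega⟩) by
      obtain ⟨w, hw, h1⟩ := this 1 (by omega) le_rfl
      exact ⟨w, hw, ⟨0, by omega⟩, by simp only; omega, h1⟩
    intro j hj
    induction hj using Nat.decreasingInduction with
    | self =>
      intro h1
      have h2 := hstep last _ (hsub last h1 last.2)
      rwa [map_sub, hf.mirror_last last hlast _ (by omega), hf.mirror_last last hlast _ (by omega),
        if_pos rfl, if_neg (by omega), sub_neg_eq_add] at h2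
    | of_succ j hj ih =>
      intro h1
      have h2 := hstep ⟨j, by omega⟩ _ (ih (by omega))
      rwa [map_add, hf.mirror_lt _ (by simp only; omega) _ (by omega),
        hf.mirror_lt _ (by simp only; omega) _ (by omega), Equiv.swap_apply_right,
        Equiv.swap_apply_of_ne_of_ne (by simp only; omega) (by simp)] at h2
  · intro β hβ
    apply bounds_of_posCone
    rw [hξ]
    have key : ∀ j l : ℕ, j < l → l < n → ∀ s t : ℤ, (s = 1 ∨ s = -1) → (t = 1 ∨ t = -1) →
        β = s • e j - t • e l → (β ∈ α.posCone ∧ e 0 + e 1 - β ∈ α.posCone) ∨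
          (-β ∈ α.posCone ∧ e 0 + e 1 + β ∈ α.posCone) := by
      rintro j l hjl hl s t hs ht rfl
      rcases hs with rfl | rfl
      · left
        refine ⟨by rw [one_smul]; exact hadd j l hjl.le hl t ht, ?_⟩
        have : e 0 + e 1 - ((1 : ℤ) • e j - t • e l) =
            (e 0 - (1 : ℤ) • e j) + (e 1 - (-t) • e l) := by module
        rw [this]
        exact add_mem (hadd 0 j (by omega) (by omega) _ (by simp))
          (hadd 1 l (by omega) hl _ (hneg t ht))
      · right
        constructor
        · have : -((-1 : ℤ) • e j - t • e l) = e j - (-t) • e l := by module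
          rw [this]
          exact hadd j l hjl.le hl _ (hneg t ht)
        · have : e 0 + e 1 + ((-1 : ℤ) • e j - t • e l) =
              (e 0 - (1 : ℤ) • e j) + (e 1 - t • e l) := by module
          rw [this]
          exact add_mem (hadd 0 j (by omega) (by omega) _ (by simp))
            (hadd 1 l (by omega) hl _ ht)
    rcases hroots β hβ with ⟨j, hj, s, hs, rfl⟩ | ⟨j, hj, l, hl, s, t, hne, hs, ht, e1⟩
    · have h1 : ∀ s : ℤ, s = 1 ∨ s = -1 → e 0 + e 1 - s • e j ∈ α.posCone := by
        intro s hs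
        rw [add_sub_right_comm]
        exact add_mem (hadd 0 j (by omega) hj s hs) (hone 1 (by omega))
      rcases hs with rfl | rfl
      · exact Or.inl ⟨by rw [one_smul]; exact hone j hj, h1 1 (by simp)⟩
      · refine Or.inr ⟨?_, ?_⟩
        · rw [neg_smul, one_smul, neg_neg]; exact hone j hj
        · rw [neg_smul, ← sub_eq_add_neg]; exact h1 1 (by simp)
    rcases lt_or_gt_of_ne hne with hjl | hjl
    · exact key j l hjl hl s t hs ht e1
    · exact key l j hjl hj (-t) (-s) (hneg t ht) (hneg s hs) (by rw [e1]; module)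

end TypeB

end SimpleRoots

/-! ### Types `G₂` and `F₄` by checking explicit root lists -/

/-- The action of the `j`-th simple reflection on the coefficients in the basis of simple roots. -/
def reflectCoeff {n : ℕ} (A : Matrix (Fin n) (Fin n) ℤ) (j : Fin n) (k : Fin n → ℤ) : Fin n → ℤ :=
  fun i => if i = j then k j - ∑ i, k i * A i j else k i

/-- The list `S` of coefficient vectors contains the simple roots and is closed under simple
reflections up to sign, and its entries lie between `0` and `m`. -/
def IsPosRootList {n : ℕ} (A : Matrix (Fin n) (Fin n) ℤ) (m : Fin n → ℕ)
    (S : List (Fin n → ℤ)) : Prop :=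
  (∀ i, (fun j => if j = i then 1 else 0) ∈ S) ∧
    (∀ k ∈ S, ∀ j, reflectCoeff A j k ∈ S ∨ -reflectCoeff A j k ∈ S) ∧
    ∀ k ∈ S, ∀ i, 0 ≤ k i ∧ k i ≤ m i

instance {n : ℕ} (A : Matrix (Fin n) (Fin n) ℤ) (m : Fin n → ℕ) (S : List (Fin n → ℤ)) :
    Decidable (IsPosRootList A m S) := by
  unfold IsPosRootList
  infer_instance

namespace SimpleRoots

variable {n : ℕ} {A : Matrix (Fin n) (Fin n) ℤ} (α : SimpleRoots A)

theorem mirror_comb_eq (k : Fin n → ℤ) (j : Fin n) :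
    mirror (α.root j) (α.comb k) = α.comb (reflectCoeff A j k) := by
  rw [mirror_comb]
  congr 1
  funext i
  rw [reflectCoeff, Pi.sub_apply]
  split_ifs with h
  · subst h; simp
  · simp [h]

theorem root_eq_comb_ite (i : Fin n) : α.root i = α.comb (fun j => if j = i then 1 else 0) := by
  rw [root_eq_comb]
  congr 1
  funext j
  rw [Pi.single_apply]

/-- The set `±S` contains the simple roots and is stable under simple reflections, so it contains
all roots; that each entry of `S` is a root plays no part. -/
theorem bounds_of_isPosRootList {m : Fin n → ℕ} {S : List (Fin n → ℤ)}
    (hS : IsPosRootList A m S) {β : EuclideanSpace ℝ (Fin n)} (hβ : β ∈ α.roots) :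
    ∃ k : Fin n → ℤ, β = α.comb k ∧
      ((∀ i, 0 ≤ k i ∧ k i ≤ m i) ∨ ∀ i, -(m i : ℤ) ≤ k i ∧ k i ≤ 0) := by
  have key : ∃ k ∈ S, β = α.comb k ∨ β = -α.comb k := by
    refine roots_induction (p := fun β => ∃ k ∈ S, β = α.comb k ∨ β = -α.comb k)
      (fun i => ⟨_, hS.1 i, Or.inl (α.root_eq_comb_ite i)⟩) ?_ hβ
    rintro j β - ⟨k, hk, rfl | rfl⟩
    · rw [mirror_comb_eq]
      rcases hS.2.1 k hk j with h | h
      · exact ⟨_, h, Or.inl rfl⟩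
      · exact ⟨_, h, Or.inr (by rw [comb_neg, neg_neg])⟩
    · rw [map_neg, mirror_comb_eq]
      rcases hS.2.1 k hk j with h | h
      · exact ⟨_, h, Or.inr rfl⟩
      · exact ⟨_, h, Or.inl (by rw [comb_neg])⟩
  obtain ⟨k, hk, e⟩ := key
  have h1 := hS.2.2 k hk
  rcases e with rfl | rfl
  · exact ⟨k, rfl, Or.inl h1⟩
  · refine ⟨-k, by rw [comb_neg], Or.inr fun i => ?_⟩
    have := h1 i
    simp only [Pi.neg_apply]
    omega

/-- A word in the simple reflections, applied from its right end, certifies by computation that the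
highest root lies in the orbit of a long simple root. -/
theorem exists_weyl_of_word (w : List (Fin n)) (i : Fin n) :
    ∃ v ∈ α.weyl, α.comb (w.foldr (reflectCoeff A) fun j => if j = i then 1 else 0) =
      v (α.root i) := by
  induction w with
  | nil => exact ⟨1, one_mem _, (α.root_eq_comb_ite i).symm⟩
  | cons j w ih =>
    obtain ⟨v, hv, e⟩ := ih
    refine ⟨mirror (α.root j) * v, mul_mem (α.mirror_mem_weyl j) hv, ?_⟩
    rw [List.foldr_cons, ← mirror_comb_eq, e]
    rfl

theorem hasTwoLengths_G₂ (α : SimpleRoots CartanMatrix.G₂) :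
    α.HasTwoLengths ![2, 3] (fun i => i = 0) 3 (inner ℝ (α.root 1) (α.root 1)) := by
  have h01 := α.smul_inner_root_comm 0 1
  rw [show CartanMatrix.G₂ 0 1 = -3 from rfl, show CartanMatrix.G₂ 1 0 = -1 from rfl] at h01
  refine ⟨Nat.prime_three, real_inner_self_pos.2 (α.root_ne_zero _), ?_, ?_, ⟨0, rfl⟩,
    ⟨1, by decide⟩, by decide, ?_, fun β hβ => α.bounds_of_isPosRootList
      (S := [![1, 0], ![0, 1], ![1, 3], ![1, 1], ![2, 3], ![1, 2]]) (by decide +kernel) hβ⟩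
  · rintro _ rfl
    push_cast at h01 ⊢
    linarith
  · intro i hi
    fin_cases i
    · exact absurd rfl hi
    · rfl
  · obtain ⟨v, hv, e⟩ := α.exists_weyl_of_word [0, 1] 0
    refine ⟨v, hv, 0, rfl, ?_⟩
    rw [← e]
    congr 1
    decide +kernel

theorem hasTwoLengths_F₄ (α : SimpleRoots CartanMatrix.F₄) :
    α.HasTwoLengths ![2, 3, 4, 2] (fun i => i.val < 2) 2 (inner ℝ (α.root 2) (α.root 2)) := by
  have h01 := α.smul_inner_root_comm 0 1
  have h12 := α.smul_inner_root_comm 1 2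
  have h23 := α.smul_inner_root_comm 2 3
  rw [show CartanMatrix.F₄ 0 1 = -1 from rfl, show CartanMatrix.F₄ 1 0 = -1 from rfl] at h01
  rw [show CartanMatrix.F₄ 1 2 = -2 from rfl, show CartanMatrix.F₄ 2 1 = -1 from rfl] at h12
  rw [show CartanMatrix.F₄ 2 3 = -1 from rfl, show CartanMatrix.F₄ 3 2 = -1 from rfl] at h23
  push_cast at h01 h12 h23
  refine ⟨Nat.prime_two, real_inner_self_pos.2 (α.root_ne_zero _), ?_, ?_, ⟨0, by decide⟩,
    ⟨2, by decide⟩, by decide, ?_, fun β hβ => α.bounds_of_isPosRootList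
      (S := [![1, 0, 0, 0], ![0, 1, 0, 0], ![0, 0, 1, 0], ![0, 0, 0, 1], ![1, 1, 0, 0],
        ![0, 1, 2, 0], ![0, 1, 1, 0], ![0, 0, 1, 1], ![1, 1, 2, 0], ![0, 1, 2, 2], ![1, 1, 1, 0],
        ![0, 1, 1, 1], ![1, 2, 2, 0], ![1, 1, 2, 2], ![1, 1, 1, 1], ![0, 1, 2, 1], ![1, 2, 2, 2],
        ![1, 1, 2, 1], ![1, 2, 4, 2], ![1, 2, 2, 1], ![1, 3, 4, 2], ![1, 2, 3, 1], ![2, 3, 4, 2],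
        ![1, 2, 3, 2]]) (by decide +kernel) hβ⟩
  · intro i hi
    push_cast
    fin_cases i
    · simp only [Fin.zero_eta]; linarith
    · simp only [Fin.mk_one]; linarith
    · exact absurd hi (by decide)
    · exact absurd hi (by decide)
  · intro i hi
    fin_cases i
    · exact absurd (by decide) hi
    · exact absurd (by decide) hi
    · rfl
    · simp only [Fin.reduceFinMk]; linarith
  · obtain ⟨v, hv, e⟩ := α.exists_weyl_of_word [0, 1, 2, 3, 1, 2, 1] 0
    refine ⟨v, hv, 0, by decide, ?_⟩
    rw [← e]
    congr 1
    decide +kernel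

end SimpleRoots

/-! ### Recursions for lattice point counts -/

section LatticeCount

variable {n : ℕ}

theorem latticeCount_of_neg (m : Fin n → ℕ) {N : ℤ} (hN : N < 0) : latticeCount m N = 0 := by
  rw [latticeCount]
  convert Set.ncard_empty (Fin n → ℕ)
  refine Set.eq_empty_of_forall_notMem fun s hs => ?_
  have h1 : 0 ≤ ∑ i, (m i : ℤ) * s i := Finset.sum_nonneg fun i _ => by positivity
  have h2 := Set.mem_ofPred.1 hs
  omega

theorem latticeCount_fin_zero (m : Fin 0 → ℕ) {N : ℤ} (hN : 0 ≤ N) : latticeCount m N = 1 := by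
  rw [latticeCount, Set.ncard_eq_one]
  exact ⟨0, by ext s; simp [hN, Subsingleton.elim s 0]⟩

theorem latticeCount_comp_perm (m : Fin n → ℕ) (π : Equiv.Perm (Fin n)) (N : ℤ) :
    latticeCount (m ∘ π) N = latticeCount m N := by
  rw [latticeCount, latticeCount]
  refine Set.ncard_congr (fun s _ => s ∘ π.symm) ?_ ?_ ?_
  · intro s hs
    have h1 := Set.mem_ofPred.1 hs
    rw [← Equiv.sum_comp π.symm] at h1
    simpa using h1
  · intro s t _ _ h
    exact π.symm.surjective.injective_comp_right h
  · intro s hs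
    refine ⟨s ∘ π, ?_, by funext i; simp⟩
    have h1 := Set.mem_ofPred.1 hs
    rw [← Equiv.sum_comp π] at h1
    exact h1

/-- Points with first coordinate `0` are counted by the remaining marks; in the others the first
coordinate can be lowered by one, at cost `w`. -/
theorem latticeCount_cons {m : Fin n → ℕ} (hm : ∀ i, 0 < m i) {w : ℕ} (hw : 0 < w) (N : ℤ) :
    latticeCount (Fin.cons w m : Fin (n + 1) → ℕ) N =
      latticeCount m N + latticeCount (Fin.cons w m : Fin (n + 1) → ℕ) (N - w) := by
  have hpos : ∀ i, 0 < (Fin.cons w m : Fin (n + 1) → ℕ) i := Fin.cases hw hm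
  have h1 := ncard_latticePoints_ge (Fin.cons w m : Fin (n + 1) → ℕ) (Fin.cons 1 0) N
  have h2 : ∑ i, ((Fin.cons w m : Fin (n + 1) → ℕ) i : ℤ) * ((Fin.cons 1 0 : Fin (n + 1) → ℕ) i) =
      w := by
    simp [Fin.sum_univ_succ]
  rw [h2] at h1
  have h3 : {s : Fin n → ℕ | ∑ i, (m i : ℤ) * s i ≤ N}.ncard =
      {s : Fin (n + 1) → ℕ | ∑ i, ((Fin.cons w m : Fin (n + 1) → ℕ) i : ℤ) * s i ≤ N ∧
        s 0 = 0}.ncard := by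
    rw [← Set.ncard_image_of_injective _ (Fin.cons_right_injective (α := fun _ => ℕ) 0)]
    congr 1
    ext s
    simp only [Set.mem_image, Set.mem_ofPred_eq, Fin.sum_univ_succ, Fin.cons_zero, Fin.cons_succ]
    constructor
    · rintro ⟨t, ht, rfl⟩
      simpa using ht
    · rintro ⟨hs, h0⟩
      refine ⟨Fin.tail s, ?_, ?_⟩
      · rw [h0] at hs
        simpa [Fin.tail] using hs
      · rw [← h0]; exact Fin.cons_self_tail s
  have hdisj : Disjoint
      {s : Fin (n + 1) → ℕ | ∑ i, ((Fin.cons w m : Fin (n + 1) → ℕ) i : ℤ) * s i ≤ N ∧ s 0 = 0}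
      {s : Fin (n + 1) → ℕ | ∑ i, ((Fin.cons w m : Fin (n + 1) → ℕ) i : ℤ) * s i ≤ N ∧
        ∀ i, (Fin.cons 1 0 : Fin (n + 1) → ℕ) i ≤ s i} := by
    rw [Set.disjoint_left]
    rintro s ⟨-, h⟩ ⟨-, h'⟩
    have := h' 0
    rw [h] at this
    simp at this
  rw [← h1, latticeCount, latticeCount, h3, ← Set.ncard_union_eq hdisj
    ((finite_latticePoints hpos N).subset fun s hs => hs.1)
    ((finite_latticePoints hpos N).subset fun s hs => hs.1)]
  congr 1
  ext s
  simp only [Set.mem_ofPred_eq, Set.mem_union, ← and_or_left]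
  refine (and_iff_left ?_).symm
  rcases Nat.eq_zero_or_pos (s 0) with h | h
  · exact Or.inl h
  · exact Or.inr (Fin.cases h fun i => Nat.zero_le _)

/-- Solving the recursion for lattice point counts by a quasi-polynomial of period `q`. -/
theorem latticeCount_cons_eq {q : ℕ} {m : Fin n → ℕ} (hm : ∀ i, 0 < m i) {w : ℕ} (hw : 0 < w)
    (hwq : w ≤ q) {G T : ℤ → Fin q → ℚ}
    (hG : ∀ (k : ℤ) (j : Fin q), 0 ≤ k → (latticeCount m (q * k + j.val) : ℚ) = G k j)
    (hT1 : ∀ (k : ℤ) (i j : Fin q), i.val + w = j.val → T k j = G k j + T k i)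
    (hT2 : ∀ (k : ℤ) (i j : Fin q), i.val + w = j.val + q → T k j = G k j + T (k - 1) i)
    (hT0 : ∀ j : Fin q, q ≤ w + j → T (-1) j = 0) (k : ℤ) (j : Fin q) (hk : 0 ≤ k) :
    (latticeCount (Fin.cons w m : Fin (n + 1) → ℕ) (q * k + j.val) : ℚ) = T k j := by
  induction hN : (q * k + j.val).toNat using Nat.strong_induction_on generalizing k j with
  | _ N ih =>
  have hj := j.2
  have hqk : 0 ≤ q * k := by positivity
  rw [latticeCount_cons hm hw, Nat.cast_add, hG k j hk]
  by_cases hjw : w ≤ j.val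
  · have h1 := ih (q * k + (j.val - w : ℕ)).toNat (by omega) k ⟨j.val - w, by omega⟩ hk rfl
    rw [hT1 k ⟨j.val - w, by omega⟩ j (by simp only; omega), ← h1]
    congr 3
    push_cast [hjw]
    ring
  -- Here `j < w`, so subtracting `w` borrows one period: `q k + j - w = q (k - 1) + (j + q - w)`.
  · rw [hT2 k ⟨j.val + q - w, by omega⟩ j (by simp only; omega)]
    congr 1
    rcases hk.eq_or_lt with rfl | hk'
    -- At `k = 0` the argument is negative and the count is zero; the vanishing of `T (-1)` on these
    -- residues is the initial condition of the recursion.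
    · rw [latticeCount_of_neg _ (by omega), zero_sub, hT0 _ (by simp only; omega), Nat.cast_zero]
    · have e : (q : ℤ) * (k - 1) = q * k - q := by ring
      have hqk' : (q : ℤ) * 1 ≤ q * k := by gcongr; omega
      rw [← ih (q * (k - 1) + (j.val + q - w : ℕ)).toNat (by omega) (k - 1)
        ⟨j.val + q - w, by omega⟩ (by omega) rfl]
      congr 2
      simp only [e]
      omega

end LatticeCount

/-- The number of lattice points for the marks of `C_n` and `B_n`. -/
theorem latticeCount_C (n : ℕ) : ∀ a : ℕ,
    latticeCount (fun i : Fin (n + 1) => if i.val + 1 = n + 1 then 1 else 2)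
      (2 * a - 2 * (n + 1)) = a.choose (n + 1) + (a - 1).choose (n + 1) ∧
    latticeCount (fun i : Fin (n + 1) => if i.val + 1 = n + 1 then 1 else 2)
      (2 * a - 2 * (n + 1) + 1) = 2 * a.choose (n + 1) := by
  -- For `a ≤ n` both arguments are negative and both sides vanish.
  have hsmall : ∀ n a : ℕ, a < n + 1 →
    latticeCount (fun i : Fin (n + 1) => if i.val + 1 = n + 1 then 1 else 2)
      (2 * a - 2 * (n + 1)) = a.choose (n + 1) + (a - 1).choose (n + 1) ∧
    latticeCount (fun i : Fin (n + 1) => if i.val + 1 = n + 1 then 1 else 2)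
      (2 * a - 2 * (n + 1) + 1) = 2 * a.choose (n + 1) := by
    intro n a ha
    rw [latticeCount_of_neg _ (by omega), latticeCount_of_neg _ (by omega),
      Nat.choose_eq_zero_of_lt ha, Nat.choose_eq_zero_of_lt (by omega)]
    simp
  induction n with
  | zero =>
    intro a
    have hone : ∀ N : ℕ, latticeCount (fun i : Fin (0 + 1) => if i.val + 1 = 0 + 1 then 1 else 2) N
        = N + 1 := by
      have e : (fun i : Fin (0 + 1) => if i.val + 1 = 0 + 1 then 1 else 2) =
          (Fin.cons 1 Fin.elim0 : Fin 1 → ℕ) := by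
        funext i; fin_cases i; rfl
      intro N
      rw [e]
      induction N with
      | zero =>
        rw [latticeCount_cons (fun i => i.elim0) one_pos, latticeCount_fin_zero _ (by simp),
          latticeCount_of_neg _ (by simp)]
      | succ N ih =>
        rw [latticeCount_cons (fun i => i.elim0) one_pos, latticeCount_fin_zero _ (by positivity)]
        have : ((N + 1 : ℕ) : ℤ) - (1 : ℕ) = N := by push_cast; ring
        rw [this, ih]
        ring
    rcases a with _ | a
    · exact hsmall 0 0 (by omega)
    · have e1 : 2 * ((a + 1 : ℕ) : ℤ) - 2 * ((0 : ℕ) + 1) = (2 * a : ℕ) := by push_cast; ring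
      have e2 : ((2 * a : ℕ) : ℤ) + 1 = (2 * a + 1 : ℕ) := by push_cast; ring
      rw [e1, e2, hone, hone]
      simp
      omega
  | succ n ihn =>
    have e : (fun i : Fin (n + 1 + 1) => if i.val + 1 = n + 1 + 1 then 1 else 2) =
        (Fin.cons 2 (fun i : Fin (n + 1) => if i.val + 1 = n + 1 then 1 else 2) :
          Fin (n + 1 + 1) → ℕ) := by
      funext i
      refine Fin.cases ?_ (fun i => ?_) i
      · simp
      · simp
    intro a
    induction a with
    | zero => exact hsmall (n + 1) 0 (by omega)
    | succ a iha =>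
      have hm : ∀ i : Fin (n + 1), 0 < if i.val + 1 = n + 1 then 1 else 2 := fun i => by
        split_ifs <;> norm_num
      rw [e] at iha ⊢
      rw [latticeCount_cons hm two_pos, latticeCount_cons hm two_pos (_ + 1)]
      have s1 : 2 * ((a + 1 : ℕ) : ℤ) - 2 * ((n + 1 : ℕ) + 1) = 2 * a - 2 * (n + 1) := by
        push_cast; ring
      have s2 : 2 * (a : ℤ) - 2 * (n + 1) - (2 : ℕ) = 2 * a - 2 * ((n + 1 : ℕ) + 1) := by
        push_cast; ring
      have s3 : 2 * (a : ℤ) - 2 * (n + 1) + 1 - (2 : ℕ) = 2 * a - 2 * ((n + 1 : ℕ) + 1) + 1 := by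
        push_cast; ring
      rw [s1, s2, s3, iha.1, iha.2, (ihn a).1, (ihn a).2]
      -- The step is Pascal's rule; `a = 0` is apart because `a - 1` truncates.
      rcases a with _ | a
      · rw [Nat.choose_eq_zero_of_lt (show 0 + 1 < n + 1 + 1 by omega)]
        simp
      · simp only [Nat.choose_succ_succ, Nat.add_sub_cancel]
        constructor <;> ring

/-! ### Quasi-polynomials for `F₄` and `G₂` -/

/-- Lattice point counts for the marks of `F₄`. -/
def latticePolyF₄ (k : ℤ) : Fin 12 → ℚ :=
  ![1 + 8 * k + 26 * k ^ 2 + 36 * k ^ 3 + 18 * k ^ 4,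
    1 + 21/2 * k + 67/2 * k ^ 2 + 42 * k ^ 3 + 18 * k ^ 4,
    3 + 20 * k + 47 * k ^ 2 + 48 * k ^ 3 + 18 * k ^ 4,
    4 + 51/2 * k + 115/2 * k ^ 2 + 54 * k ^ 3 + 18 * k ^ 4,
    8 + 40 * k + 74 * k ^ 2 + 60 * k ^ 3 + 18 * k ^ 4,
    10 + 99/2 * k + 175/2 * k ^ 2 + 66 * k ^ 3 + 18 * k ^ 4,
    17 + 70 * k + 107 * k ^ 2 + 72 * k ^ 3 + 18 * k ^ 4,
    21 + 169/2 * k + 247/2 * k ^ 2 + 78 * k ^ 3 + 18 * k ^ 4,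
    32 + 112 * k + 146 * k ^ 2 + 84 * k ^ 3 + 18 * k ^ 4,
    39 + 265/2 * k + 331/2 * k ^ 2 + 90 * k ^ 3 + 18 * k ^ 4,
    55 + 168 * k + 191 * k ^ 2 + 96 * k ^ 3 + 18 * k ^ 4,
    66 + 391/2 * k + 427/2 * k ^ 2 + 102 * k ^ 3 + 18 * k ^ 4]

/-- Lattice point counts for the last three marks of `F₄`. -/
def latticePolyF₄Tail (k : ℤ) : Fin 12 → ℚ :=
  ![1 + 6 * k + 15 * k ^ 2 + 12 * k ^ 3,
    1 + 8 * k + 18 * k ^ 2 + 12 * k ^ 3,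
    2 + 12 * k + 21 * k ^ 2 + 12 * k ^ 3,
    3 + 15 * k + 24 * k ^ 2 + 12 * k ^ 3,
    5 + 20 * k + 27 * k ^ 2 + 12 * k ^ 3,
    6 + 24 * k + 30 * k ^ 2 + 12 * k ^ 3,
    9 + 30 * k + 33 * k ^ 2 + 12 * k ^ 3,
    11 + 35 * k + 36 * k ^ 2 + 12 * k ^ 3,
    15 + 42 * k + 39 * k ^ 2 + 12 * k ^ 3,
    18 + 48 * k + 42 * k ^ 2 + 12 * k ^ 3,
    23 + 56 * k + 45 * k ^ 2 + 12 * k ^ 3,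
    27 + 63 * k + 48 * k ^ 2 + 12 * k ^ 3]

/-- Lattice point counts for the last two marks of `F₄`. -/
def latticePolyF₄Tail₂ (k : ℤ) : Fin 12 → ℚ :=
  ![1 + 6 * k + 9 * k ^ 2,
    1 + 6 * k + 9 * k ^ 2,
    2 + 9 * k + 9 * k ^ 2,
    2 + 9 * k + 9 * k ^ 2,
    4 + 12 * k + 9 * k ^ 2,
    4 + 12 * k + 9 * k ^ 2,
    6 + 15 * k + 9 * k ^ 2,
    6 + 15 * k + 9 * k ^ 2,
    9 + 18 * k + 9 * k ^ 2,
    9 + 18 * k + 9 * k ^ 2,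
    12 + 21 * k + 9 * k ^ 2,
    12 + 21 * k + 9 * k ^ 2]

/-- Lattice point counts for the last mark of `F₄`. -/
def latticePolyF₄Tail₃ (k : ℤ) : Fin 12 → ℚ :=
  ![1 + 6 * k, 1 + 6 * k, 2 + 6 * k, 2 + 6 * k, 3 + 6 * k, 3 + 6 * k, 4 + 6 * k, 4 + 6 * k,
    5 + 6 * k, 5 + 6 * k, 6 + 6 * k, 6 + 6 * k]

/-- The period 12 is a common multiple of the marks `2, 3, 4, 2`. Starting from the constant count
for no marks, each adjoined mark raises the degree by one; each stage checks the recursion residue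
by residue, over `ℚ` because half-integers occur among the final coefficients. -/
theorem latticeCount_F₄_tail₃ (k : ℤ) (j : Fin 12) (hk : 0 ≤ k) :
    (latticeCount ![2] ((12 : ℕ) * k + j.val) : ℚ) = latticePolyF₄Tail₃ k j := by
  refine latticeCount_cons_eq (G := fun _ _ => 1) (T := latticePolyF₄Tail₃) (fun i => i.elim0)
    two_pos (by norm_num) (fun k j hk => ?_) ?_ ?_ ?_ k j hk
  · rw [latticeCount_fin_zero _ (by positivity), Nat.cast_one]
  · intro k i j h
    fin_cases j <;> fin_cases i <;> first
      | (exfalso; revert h; decide)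
      | (simp [latticePolyF₄Tail₃]; try ring)
  · intro k i j h
    fin_cases j <;> fin_cases i <;> first
      | (exfalso; revert h; decide)
      | (simp [latticePolyF₄Tail₃]; try ring)
  · intro j h
    fin_cases j <;> first | (exfalso; revert h; decide) | norm_num [latticePolyF₄Tail₃]

theorem latticeCount_F₄_tail₂ (k : ℤ) (j : Fin 12) (hk : 0 ≤ k) :
    (latticeCount ![4, 2] ((12 : ℕ) * k + j.val) : ℚ) = latticePolyF₄Tail₂ k j := by
  refine latticeCount_cons_eq (T := latticePolyF₄Tail₂) (by decide) (by norm_num) (by norm_num)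
    latticeCount_F₄_tail₃ ?_ ?_ ?_ k j hk
  · intro k i j h
    fin_cases j <;> fin_cases i <;> first
      | (exfalso; revert h; decide)
      | (simp [latticePolyF₄Tail₂, latticePolyF₄Tail₃]; try ring)
  · intro k i j h
    fin_cases j <;> fin_cases i <;> first
      | (exfalso; revert h; decide)
      | (simp [latticePolyF₄Tail₂, latticePolyF₄Tail₃]; try ring)
  · intro j h
    fin_cases j <;> first | (exfalso; revert h; decide) | norm_num [latticePolyF₄Tail₂]

theorem latticeCount_F₄_tail (k : ℤ) (j : Fin 12) (hk : 0 ≤ k) :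
    (latticeCount ![3, 4, 2] ((12 : ℕ) * k + j.val) : ℚ) = latticePolyF₄Tail k j := by
  refine latticeCount_cons_eq (T := latticePolyF₄Tail) (by decide) (by norm_num) (by norm_num)
    latticeCount_F₄_tail₂ ?_ ?_ ?_ k j hk
  · intro k i j h
    fin_cases j <;> fin_cases i <;> first
      | (exfalso; revert h; decide)
      | (simp [latticePolyF₄Tail, latticePolyF₄Tail₂]; try ring)
  · intro k i j h
    fin_cases j <;> fin_cases i <;> first
      | (exfalso; revert h; decide)
      | (simp [latticePolyF₄Tail, latticePolyF₄Tail₂]; try ring)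
  · intro j h
    fin_cases j <;> first | (exfalso; revert h; decide) | norm_num [latticePolyF₄Tail]

theorem latticeCount_F₄_of_nonneg (k : ℤ) (j : Fin 12) (hk : 0 ≤ k) :
    (latticeCount ![2, 3, 4, 2] ((12 : ℕ) * k + j.val) : ℚ) = latticePolyF₄ k j := by
  refine latticeCount_cons_eq (T := latticePolyF₄) (by decide) (by norm_num) (by norm_num)
    latticeCount_F₄_tail ?_ ?_ ?_ k j hk
  · intro k i j h
    fin_cases j <;> fin_cases i <;> first
      | (exfalso; revert h; decide)
      | (simp [latticePolyF₄, latticePolyF₄Tail]; try ring)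
  · intro k i j h
    fin_cases j <;> fin_cases i <;> first
      | (exfalso; revert h; decide)
      | (simp [latticePolyF₄, latticePolyF₄Tail]; try ring)
  · intro j h
    fin_cases j <;> first | (exfalso; revert h; decide) | norm_num [latticePolyF₄]

/-- Lattice point counts for the marks of `G₂`. -/
def latticePolyG₂ (k : ℤ) : Fin 6 → ℚ :=
  ![1 + 3 * k + 3 * k ^ 2,
    1 + 4 * k + 3 * k ^ 2,
    2 + 5 * k + 3 * k ^ 2,
    3 + 6 * k + 3 * k ^ 2,
    4 + 7 * k + 3 * k ^ 2,
    5 + 8 * k + 3 * k ^ 2]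

/-- Lattice point counts for the last mark of `G₂`. -/
def latticePolyG₂Tail (k : ℤ) : Fin 6 → ℚ :=
  ![1 + 2 * k, 1 + 2 * k, 1 + 2 * k, 2 + 2 * k, 2 + 2 * k, 2 + 2 * k]

theorem latticeCount_G₂_tail (k : ℤ) (j : Fin 6) (hk : 0 ≤ k) :
    (latticeCount ![3] ((6 : ℕ) * k + j.val) : ℚ) = latticePolyG₂Tail k j := by
  refine latticeCount_cons_eq (G := fun _ _ => 1) (T := latticePolyG₂Tail) (fun i => i.elim0)
    three_pos (by norm_num) (fun k j hk => ?_) ?_ ?_ ?_ k j hk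
  · rw [latticeCount_fin_zero _ (by positivity), Nat.cast_one]
  · intro k i j h
    fin_cases j <;> fin_cases i <;> first
      | (exfalso; revert h; decide)
      | (simp [latticePolyG₂Tail]; try ring)
  · intro k i j h
    fin_cases j <;> fin_cases i <;> first
      | (exfalso; revert h; decide)
      | (simp [latticePolyG₂Tail]; try ring)
  · intro j h
    fin_cases j <;> first | (exfalso; revert h; decide) | norm_num [latticePolyG₂Tail]

theorem latticeCount_G₂_of_nonneg (k : ℤ) (j : Fin 6) (hk : 0 ≤ k) :
    (latticeCount ![2, 3] ((6 : ℕ) * k + j.val) : ℚ) = latticePolyG₂ k j := by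
  refine latticeCount_cons_eq (T := latticePolyG₂) (by decide) (by norm_num) (by norm_num)
    latticeCount_G₂_tail ?_ ?_ ?_ k j hk
  · intro k i j h
    fin_cases j <;> fin_cases i <;> first
      | (exfalso; revert h; decide)
      | (simp [latticePolyG₂, latticePolyG₂Tail]; try ring)
  · intro k i j h
    fin_cases j <;> fin_cases i <;> first
      | (exfalso; revert h; decide)
      | (simp [latticePolyG₂, latticePolyG₂Tail]; try ring)
  · intro j h
    fin_cases j <;> first | (exfalso; revert h; decide) | norm_num [latticePolyG₂]

/-- The quasi-polynomial also vanishes for `-12 < N < 0`, where `12` is one plus the sum of the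
marks. At `N = -12` it is `1` while the count is `0`; hence the requirement `M ≥ 1` when `N = M -
12`. -/
theorem latticeCount_F₄ (k : ℤ) (j : Fin 12) (h : -12 < 12 * k + j.val) :
    (latticeCount ![2, 3, 4, 2] (12 * k + j.val) : ℚ) = latticePolyF₄ k j := by
  have hj := j.2
  rcases le_or_gt 0 k with hk | hk
  · exact latticeCount_F₄_of_nonneg k j hk
  · obtain rfl : k = -1 := by omega
    rw [latticeCount_of_neg _ (by omega), Nat.cast_zero]
    fin_cases j <;> first | (exfalso; revert h; decide) | norm_num [latticePolyF₄]

theorem cardF₄_eq {M k : ℕ} {j : Fin 12} (hM : M = 12 * k + j.val) (h : 1 ≤ M) :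
    (latticeCount ![2, 3, 4, 2] M : ℤ) + latticeCount ![2, 3, 4, 2] (M - 6) = cardF₄OneShort k j ∧
    (latticeCount ![2, 3, 4, 2] M : ℤ) + latticeCount ![2, 3, 4, 2] (M - 6 - 6) =
      cardF₄OneDet k j ∧
    (latticeCount ![2, 3, 4, 2] (M - 6) : ℤ) + latticeCount ![2, 3, 4, 2] (M - 6 - 6) =
      cardF₄LongShort k j ∧
    (latticeCount ![2, 3, 4, 2] (M - 6) : ℤ) + latticeCount ![2, 3, 4, 2] (M - 6) =
      cardF₄LongDet k j := by
  have hj := j.2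
  have e1 := latticeCount_F₄ k j (by omega)
  -- `M - 6` has residue `j + 6` modulo 12, with quotient `k` or `k - 1` according to whether `j ≥
  -- 6`; addition in `Fin 12` wraps around accordingly.
  have e2 := latticeCount_F₄ (if 6 ≤ j.val then k else k - 1) (j + 6) (by
    rw [Fin.val_add]
    split_ifs <;> simp <;> omega)
  have e3 := latticeCount_F₄ (k - 1) j (by omega)
  have a1 : (12 * k + j.val : ℤ) = M := by rw [hM]; push_cast; ring
  have a2 : (12 * (if 6 ≤ j.val then (k : ℤ) else k - 1) + (j + 6 : Fin 12).val : ℤ) =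
      M - 6 := by
    rw [← a1, Fin.val_add]
    split_ifs <;> simp <;> omega
  have a3 : (12 * (k - 1) + j.val : ℤ) = M - 6 - 6 := by rw [← a1]; ring
  rw [a1] at e1
  rw [a2] at e2
  rw [a3] at e3
  generalize latticeCount ![2, 3, 4, 2] M = x at *
  generalize latticeCount ![2, 3, 4, 2] (M - 6) = y at *
  generalize latticeCount ![2, 3, 4, 2] (M - 6 - 6) = z at *
  clear a1 a2 a3 hM h hj
  have q1 : ∀ {u v : ℕ} {w : ℤ}, (u : ℚ) + v = w → (u : ℤ) + v = w := by
    intro u v w h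
    exact_mod_cast h
  refine ⟨q1 ?_, q1 ?_, q1 ?_, q1 ?_⟩ <;> simp only [e1, e2, e3] <;> clear e1 e2 e3 q1 <;>
    fin_cases j <;>
    simp [latticePolyF₄, cardF₄OneShort, cardF₄OneDet, cardF₄LongShort, cardF₄LongDet] <;>
    ring

/-- As for `F₄`, with `6 = 1 + 2 + 3`: the quasi-polynomial vanishes for `-6 < N < 0`. -/
theorem latticeCount_G₂ (k : ℤ) (j : Fin 6) (h : -6 < 6 * k + j.val) :
    (latticeCount ![2, 3] (6 * k + j.val) : ℚ) = latticePolyG₂ k j := by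
  have hj := j.2
  rcases le_or_gt 0 k with hk | hk
  · exact latticeCount_G₂_of_nonneg k j hk
  · obtain rfl : k = -1 := by omega
    rw [latticeCount_of_neg _ (by omega), Nat.cast_zero]
    fin_cases j <;> first | (exfalso; revert h; decide) | norm_num [latticePolyG₂]

theorem cardG₂_eq {M k : ℕ} {j : Fin 6} (hM : M = 6 * k + j.val) (h : 1 ≤ M) :
    (latticeCount ![2, 3] M : ℤ) + latticeCount ![2, 3] (M - 3) = cardG₂OneShort k j ∧
    (latticeCount ![2, 3] M : ℤ) + latticeCount ![2, 3] (M - 3 - 3) =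
      cardG₂OneDet k j ∧
    (latticeCount ![2, 3] (M - 3) : ℤ) + latticeCount ![2, 3] (M - 3 - 3) =
      cardG₂LongShort k j ∧
    (latticeCount ![2, 3] (M - 3) : ℤ) + latticeCount ![2, 3] (M - 3) =
      cardG₂LongDet k j := by
  have hj := j.2
  have e1 := latticeCount_G₂ k j (by omega)
  have e2 := latticeCount_G₂ (if 3 ≤ j.val then k else k - 1) (j + 3) (by
    rw [Fin.val_add]
    split_ifs <;> simp <;> omega)
  have e3 := latticeCount_G₂ (k - 1) j (by omega)
  have a1 : (6 * k + j.val : ℤ) = M := by rw [hM]; push_cast; ring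
  have a2 : (6 * (if 3 ≤ j.val then (k : ℤ) else k - 1) + (j + 3 : Fin 6).val : ℤ) =
      M - 3 := by
    rw [← a1, Fin.val_add]
    split_ifs <;> simp <;> omega
  have a3 : (6 * (k - 1) + j.val : ℤ) = M - 3 - 3 := by rw [← a1]; ring
  rw [a1] at e1
  rw [a2] at e2
  rw [a3] at e3
  generalize latticeCount ![2, 3] M = x at *
  generalize latticeCount ![2, 3] (M - 3) = y at *
  generalize latticeCount ![2, 3] (M - 3 - 3) = z at *
  clear a1 a2 a3 hM h hj
  have q1 : ∀ {u v : ℕ} {w : ℤ}, (u : ℚ) + v = w → (u : ℤ) + v = w := by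
    intro u v w h
    exact_mod_cast h
  refine ⟨q1 ?_, q1 ?_, q1 ?_, q1 ?_⟩ <;> simp only [e1, e2, e3] <;> clear e1 e2 e3 q1 <;>
    fin_cases j <;>
    simp [latticePolyG₂, cardG₂OneShort, cardG₂OneDet, cardG₂LongShort, cardG₂LongDet] <;>
    ring

theorem latticeCount_C_even {n a b : ℕ} {N : ℤ} (hn : 1 ≤ n) (hN : N = 2 * a - 2 * n)
    (hb : b = a - 1) : latticeCount (fun i : Fin n => if i.val + 1 = n then 1 else 2) N =
      a.choose n + b.choose n := by
  obtain ⟨d, rfl⟩ : ∃ d, n = d + 1 := ⟨n - 1, by omega⟩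
  rw [hN, hb, ← (latticeCount_C d a).1]
  push_cast
  rfl

theorem latticeCount_C_odd {n a : ℕ} {N : ℤ} (hn : 1 ≤ n) (hN : N = 2 * a - 2 * n + 1) :
    latticeCount (fun i : Fin n => if i.val + 1 = n then 1 else 2) N = 2 * a.choose n := by
  obtain ⟨d, rfl⟩ : ∃ d, n = d + 1 := ⟨n - 1, by omega⟩
  rw [hN, ← (latticeCount_C d a).2]
  push_cast
  rfl

/-- Reversing the order of the simple roots exchanges the marks `1, 2, …, 2` and `2, …, 2, 1`. -/
theorem latticeCount_B (n : ℕ) (N : ℤ) :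
    latticeCount (fun i : Fin n => if i.val = 0 then 1 else 2) N =
      latticeCount (fun i : Fin n => if i.val + 1 = n then 1 else 2) N := by
  rw [← latticeCount_comp_perm _ Fin.revPerm]
  congr 1
  funext i
  have := i.2
  simp only [Function.comp_apply, Fin.revPerm_apply, Fin.val_rev]
  split_ifs <;> omega

/-! ### Cardinalities type by type -/

namespace SimpleRoots

/-- The cardinalities of the grid fragments of type `C_n`. -/
theorem gridCounts_C {n : ℕ} (hn : 2 ≤ n) (α : SimpleRoots (CartanMatrix.C n)) {M : ℕ}
    (hM : 1 ≤ M) {c : ℤ → ℕ}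
    (hc : c = latticeCount (fun i : Fin n => if i.val + 1 = n then 1 else 2)) :
    α.GridCount 1 α.signShort M (c M + c (M - 2 * (n - 1))) ∧
    α.GridCount 1 α.signLong M (c M + c (M - 2)) ∧
    α.GridCount 1 α.signDet M (c M + c (M - 2 * n)) ∧
    α.GridCount α.signDet α.signShort M (c (M - 2) + c (M - 2 * n)) ∧
    α.GridCount α.signDet α.signLong M (c (M - 2 * (n - 1)) + c (M - 2 * n)) ∧
    α.GridCount α.signLong α.signDet M (c (M - 2 * (n - 1)) + c (M - 2)) := by
  -- There are `n - 1` short marks equal to `2`, and one long mark `1` besides the affine wall.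
  have h := (α.hasTwoLengths_C hn).gridCounts hM (hs := 2 * (n - 1)) (hl := 2)
    (by
      obtain ⟨d, rfl⟩ : ∃ d, n = d + 1 := ⟨n - 1, by omega⟩
      rw [Fin.sum_univ_castSucc, Finset.sum_congr rfl (g := fun _ => (2 : ℤ)) fun i _ => by
        have := i.2
        simp only [Fin.val_castSucc]
        rw [if_neg (by omega), if_neg (by omega)]
        norm_num]
      simp
      ring)
    (by
      obtain ⟨d, rfl⟩ : ∃ d, n = d + 1 := ⟨n - 1, by omega⟩
      rw [Fin.sum_univ_castSucc, Finset.sum_congr rfl (g := fun _ => (0 : ℤ)) fun i _ => by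
        have := i.2
        simp only [Fin.val_castSucc]
        rw [if_neg (by omega), if_neg (by omega)]
        norm_num]
      simp)
  rw [← hc, show (M : ℤ) - 2 * (n - 1) - 2 = M - 2 * n by ring] at h
  exact ⟨h.1, h.2.1, h.2.2.1, h.2.2.2.1, h.2.2.2.2.1, h.2.2.2.2.2.2.2⟩

/-- The cardinalities of the grid fragments of type `B_n`, in terms of the marks of `C_n`. -/
theorem gridCounts_B {n : ℕ} (hn : 2 ≤ n) (α : SimpleRoots (CartanMatrix.B n)) {M : ℕ}
    (hM : 1 ≤ M) {c : ℤ → ℕ}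
    (hc : c = latticeCount (fun i : Fin n => if i.val + 1 = n then 1 else 2)) :
    α.GridCount 1 α.signShort M (c M + c (M - 2)) ∧
    α.GridCount 1 α.signLong M (c M + c (M - 2 * (n - 1))) ∧
    α.GridCount 1 α.signDet M (c M + c (M - 2 * n)) ∧
    α.GridCount α.signDet α.signShort M (c (M - 2 * (n - 1)) + c (M - 2 * n)) ∧
    α.GridCount α.signDet α.signLong M (c (M - 2) + c (M - 2 * n)) ∧
    α.GridCount α.signLong α.signDet M (c (M - 2 * (n - 1)) + c (M - 2)) := by
  have hc' : c = latticeCount (fun i : Fin n => if i.val = 0 then 1 else 2) := by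
    funext N
    rw [hc, latticeCount_B]
  -- The only short mark is `2`; the long marks are one `1` and `n - 2` times `2`, besides the
  -- affine wall. Hence the two shifts of `C_n` change places.
  have h := (α.hasTwoLengths_B hn).gridCounts hM (hs := 2) (hl := 2 * (n - 1))
    (by
      obtain ⟨d, rfl⟩ : ∃ d, n = d + 1 := ⟨n - 1, by omega⟩
      rw [Fin.sum_univ_castSucc, Finset.sum_congr rfl (g := fun _ => (0 : ℤ)) fun i _ => by
        have := i.2.ne
        simp [this]]
      have : d ≠ 0 := by omega
      simp [this])
    (by
      obtain ⟨d, rfl⟩ : ∃ d, n = d + 2 := ⟨n - 2, by omega⟩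
      rw [Fin.sum_univ_succ, Fin.sum_univ_castSucc,
        Finset.sum_congr rfl (g := fun _ => (2 : ℤ)) fun i _ => by
          have := i.2.ne
          simp [this]]
      simp
      ring)
  rw [← hc', show (M : ℤ) - 2 - 2 * (n - 1) = M - 2 * n by ring] at h
  refine ⟨h.1, h.2.1, h.2.2.1, h.2.2.2.1, h.2.2.2.2.1, ?_⟩
  rw [add_comm]
  exact h.2.2.2.2.2.2.2

/-- Writing the arguments `M`, `M - hs`, `M - hl`, `M - hs - hl` for `M = 2k` as `2a - 2n` gives `a
= k + n`, `k + 1`, `n + k - 1`, `k`. -/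
theorem gridCounts_C_even {n : ℕ} (hn : 2 ≤ n) (α : SimpleRoots (CartanMatrix.C n)) {k : ℕ}
    (hk : 1 ≤ k) :
    α.GridCount 1 α.signShort (2 * k)
      ((k + n).choose n + (k + n - 1).choose n + (k + 1).choose n + k.choose n) ∧
    α.GridCount 1 α.signLong (2 * k)
      ((k + n).choose n + 2 * (n + k - 1).choose n + (n + k - 2).choose n) ∧
    α.GridCount 1 α.signDet (2 * k)
      ((k + n).choose n + (k + n - 1).choose n + k.choose n + (k - 1).choose n) ∧
    α.GridCount α.signDet α.signShort (2 * k)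
      ((n + k - 1).choose n + (n + k - 2).choose n + k.choose n + (k - 1).choose n) ∧
    α.GridCount α.signDet α.signLong (2 * k)
      ((k + 1).choose n + 2 * k.choose n + (k - 1).choose n) ∧
    α.GridCount α.signLong α.signDet (2 * k)
      ((k + 1).choose n + k.choose n + (n + k - 1).choose n + (n + k - 2).choose n) := by
  obtain ⟨h1, h2, h3, h4, h5, h6⟩ := α.gridCounts_C hn (M := 2 * k) (by omega) rfl
  have c1 := latticeCount_C_even (n := n) (a := k + n) (N := (2 * k : ℕ)) (by omega)
    (by push_cast; ring) rfl
  have cs := latticeCount_C_even (n := n) (a := k + 1) (N := (2 * k : ℕ) - 2 * (n - 1)) (by omega)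
    (by push_cast; ring) (Nat.add_sub_cancel (n := k) (m := 1)).symm
  have cl := latticeCount_C_even (n := n) (a := n + k - 1) (b := n + k - 2)
    (N := (2 * k : ℕ) - 2) (by omega) (by omega) (by omega)
  have ce := latticeCount_C_even (n := n) (a := k) (N := (2 * k : ℕ) - 2 * n) (by omega)
    (by push_cast; ring) rfl
  have e : n + k - 1 = k + n - 1 := by omega
  rw [c1, cs] at h1
  rw [c1, cl, e] at h2
  rw [c1, ce] at h3
  rw [cl, ce] at h4
  rw [cs, ce] at h5
  rw [cs, cl] at h6
  push_cast at h1 h2 h3 h4 h5 h6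
  rw [e] at h4 h6 ⊢
  refine ⟨?_, ?_, ?_, ?_, ?_, ?_⟩
  · convert h1 using 1; ring
  · convert h2 using 1; ring
  · convert h3 using 1; ring
  · convert h4 using 1; ring
  · convert h5 using 1; ring
  · convert h6 using 1; ring

theorem gridCounts_C_odd {n : ℕ} (hn : 2 ≤ n) (α : SimpleRoots (CartanMatrix.C n)) (k : ℕ) :
    α.GridCount 1 α.signShort (2 * k + 1) (2 * (k + n).choose n + 2 * (k + 1).choose n) ∧
    α.GridCount 1 α.signLong (2 * k + 1) (2 * (k + n).choose n + 2 * (n + k - 1).choose n) ∧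
    α.GridCount 1 α.signDet (2 * k + 1) (2 * (k + n).choose n + 2 * k.choose n) ∧
    α.GridCount α.signDet α.signShort (2 * k + 1)
      (2 * (n + k - 1).choose n + 2 * k.choose n) ∧
    α.GridCount α.signDet α.signLong (2 * k + 1) (2 * (k + 1).choose n + 2 * k.choose n) ∧
    α.GridCount α.signLong α.signDet (2 * k + 1)
      (2 * (n + k - 1).choose n + 2 * (k + 1).choose n) := by
  obtain ⟨h1, h2, h3, h4, h5, h6⟩ := α.gridCounts_C hn (M := 2 * k + 1) (by omega) rfl
  have c1 := latticeCount_C_odd (n := n) (a := k + n) (N := (2 * k + 1 : ℕ)) (by omega)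
    (by push_cast; ring)
  have cs := latticeCount_C_odd (n := n) (a := k + 1) (N := (2 * k + 1 : ℕ) - 2 * (n - 1))
    (by omega) (by push_cast; ring)
  have cl := latticeCount_C_odd (n := n) (a := n + k - 1) (N := (2 * k + 1 : ℕ) - 2) (by omega)
    (by omega)
  have ce := latticeCount_C_odd (n := n) (a := k) (N := (2 * k + 1 : ℕ) - 2 * n) (by omega)
    (by push_cast; ring)
  rw [c1, cs] at h1
  rw [c1, cl] at h2
  rw [c1, ce] at h3
  rw [cl, ce] at h4
  rw [cs, ce] at h5
  rw [cs, cl] at h6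
  push_cast at h1 h2 h3 h4 h5 h6
  refine ⟨h1, h2, h3, h4, h5, ?_⟩
  convert h6 using 1
  ring

/-- The short mark is `3` and the long mark `2`, so both shifts are `3`; exchanging short and long
changes no count. -/
theorem gridCounts_G₂ (α : SimpleRoots CartanMatrix.G₂) {M : ℕ} (hM : 1 ≤ M) {c : ℤ → ℕ}
    (hc : c = latticeCount ![2, 3]) :
    α.GridCount 1 α.signShort M (c M + c (M - 3)) ∧
    α.GridCount 1 α.signLong M (c M + c (M - 3)) ∧
    α.GridCount 1 α.signDet M (c M + c (M - 3 - 3)) ∧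
    α.GridCount α.signLong α.signShort M (c (M - 3) + c (M - 3 - 3)) ∧
    α.GridCount α.signShort α.signLong M (c (M - 3) + c (M - 3 - 3)) ∧
    α.GridCount α.signLong α.signDet M (c (M - 3) + c (M - 3)) := by
  have h := α.hasTwoLengths_G₂.gridCounts hM (hs := 3) (hl := 3) (by decide) (by decide)
  rw [← hc] at h
  exact ⟨h.1, h.2.1, h.2.2.1, h.2.2.2.2.2.1, h.2.2.2.2.2.2.1, h.2.2.2.2.2.2.2⟩

/-- The short marks `4, 2` and the long marks `2, 3` with the affine wall both give the shift `6`.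
-/
theorem gridCounts_F₄ (α : SimpleRoots CartanMatrix.F₄) {M : ℕ} (hM : 1 ≤ M) {c : ℤ → ℕ}
    (hc : c = latticeCount ![2, 3, 4, 2]) :
    α.GridCount 1 α.signShort M (c M + c (M - 6)) ∧
    α.GridCount 1 α.signLong M (c M + c (M - 6)) ∧
    α.GridCount 1 α.signDet M (c M + c (M - 6 - 6)) ∧
    α.GridCount α.signLong α.signShort M (c (M - 6) + c (M - 6 - 6)) ∧
    α.GridCount α.signShort α.signLong M (c (M - 6) + c (M - 6 - 6)) ∧
    α.GridCount α.signLong α.signDet M (c (M - 6) + c (M - 6)) := by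
  have h := α.hasTwoLengths_F₄.gridCounts hM (hs := 6) (hl := 6) (by decide) (by decide)
  rw [← hc] at h
  exact ⟨h.1, h.2.1, h.2.2.1, h.2.2.2.2.2.1, h.2.2.2.2.2.2.1, h.2.2.2.2.2.2.2⟩

end SimpleRoots

end

theorem mainTheorem10 :
    -- type C_n, n ≥ 2, for resolutions M = 2k (k ≥ 1) and M = 2k + 1 (k ≥ 0)
    (∀ n : ℕ, 2 ≤ n → ∀ α : SimpleRoots (CartanMatrix.C n),
      (∀ k : ℕ, 1 ≤ k →
        α.GridCount 1 α.signShort (2 * k)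
          ((k + n).choose n + (k + n - 1).choose n + (k + 1).choose n + k.choose n) ∧
        α.GridCount 1 α.signLong (2 * k)
          ((k + n).choose n + 2 * (n + k - 1).choose n + (n + k - 2).choose n) ∧
        α.GridCount 1 α.signDet (2 * k)
          ((k + n).choose n + (k + n - 1).choose n + k.choose n + (k - 1).choose n) ∧
        α.GridCount α.signDet α.signShort (2 * k)
          ((n + k - 1).choose n + (n + k - 2).choose n + k.choose n + (k - 1).choose n) ∧
        α.GridCount α.signDet α.signLong (2 * k)
          ((k + 1).choose n + 2 * k.choose n + (k - 1).choose n) ∧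
        α.GridCount α.signLong α.signDet (2 * k)
          ((k + 1).choose n + k.choose n + (n + k - 1).choose n + (n + k - 2).choose n)) ∧
      (∀ k : ℕ,
        α.GridCount 1 α.signShort (2 * k + 1) (2 * (k + n).choose n + 2 * (k + 1).choose n) ∧
        α.GridCount 1 α.signLong (2 * k + 1) (2 * (k + n).choose n + 2 * (n + k - 1).choose n) ∧
        α.GridCount 1 α.signDet (2 * k + 1) (2 * (k + n).choose n + 2 * k.choose n) ∧
        α.GridCount α.signDet α.signShort (2 * k + 1)
          (2 * (n + k - 1).choose n + 2 * k.choose n) ∧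
        α.GridCount α.signDet α.signLong (2 * k + 1) (2 * (k + 1).choose n + 2 * k.choose n) ∧
        α.GridCount α.signLong α.signDet (2 * k + 1)
          (2 * (n + k - 1).choose n + 2 * (k + 1).choose n))) ∧
    -- type B_n, n ≥ 3, compared with type C_n
    (∀ n : ℕ, 3 ≤ n → ∀ (β : SimpleRoots (CartanMatrix.B n)) (α : SimpleRoots (CartanMatrix.C n)),
      ∀ M : ℕ, 1 ≤ M →
        SameGridCount β 1 β.signShort α 1 α.signLong M ∧
        SameGridCount β 1 β.signLong α 1 α.signShort M ∧
        SameGridCount β 1 β.signDet α 1 α.signDet M ∧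
        SameGridCount β β.signDet β.signShort α α.signDet α.signLong M ∧
        SameGridCount β β.signDet β.signLong α α.signDet α.signShort M ∧
        SameGridCount β β.signLong β.signDet α α.signLong α.signDet M) ∧
    -- type G_2, for resolutions M = 6k + j ≥ 1 with 0 ≤ j ≤ 5
    (∀ α : SimpleRoots CartanMatrix.G₂,
      (∀ (k : ℕ) (j : Fin 6), 1 ≤ 6 * k + (j : ℕ) →
        α.GridCount 1 α.signShort (6 * k + j) (cardG₂OneShort k j) ∧
        α.GridCount 1 α.signDet (6 * k + j) (cardG₂OneDet k j) ∧
        α.GridCount α.signLong α.signShort (6 * k + j) (cardG₂LongShort k j) ∧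
        α.GridCount α.signLong α.signDet (6 * k + j) (cardG₂LongDet k j)) ∧
      ∀ M : ℕ, 1 ≤ M →
        SameGridCount α 1 α.signLong α 1 α.signShort M ∧
        SameGridCount α α.signShort α.signLong α α.signLong α.signShort M) ∧
    -- type F_4, for resolutions M = 12k + j ≥ 1 with 0 ≤ j ≤ 11
    (∀ α : SimpleRoots CartanMatrix.F₄,
      (∀ (k : ℕ) (j : Fin 12), 1 ≤ 12 * k + (j : ℕ) →
        α.GridCount 1 α.signShort (12 * k + j) (cardF₄OneShort k j) ∧
        α.GridCount 1 α.signDet (12 * k + j) (cardF₄OneDet k j) ∧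
        α.GridCount α.signLong α.signShort (12 * k + j) (cardF₄LongShort k j) ∧
        α.GridCount α.signLong α.signDet (12 * k + j) (cardF₄LongDet k j)) ∧
      ∀ M : ℕ, 1 ≤ M →
        SameGridCount α 1 α.signLong α 1 α.signShort M ∧
        SameGridCount α α.signShort α.signLong α α.signLong α.signShort M) := by
  refine ⟨fun n hn α => ⟨fun k hk => α.gridCounts_C_even hn hk, fun k => α.gridCounts_C_odd hn k⟩,
    fun n hn β α M hM => ?_, fun α => ⟨fun k j hM => ?_, fun M hM => ?_⟩,
    fun α => ⟨fun k j hM => ?_, fun M hM => ?_⟩⟩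
  · obtain ⟨a1, a2, a3, a4, a5, a6⟩ := α.gridCounts_C (by omega) hM rfl
    obtain ⟨b1, b2, b3, b4, b5, b6⟩ := β.gridCounts_B (by omega) hM rfl
    -- Short for `B_n` is paired with long for `C_n`, except that `σ^l` with `σ^e` is symmetric in
    -- the two shifts.
    exact ⟨b1.sameGridCount a2, b2.sameGridCount a1, b3.sameGridCount a3, b4.sameGridCount a5,
      b5.sameGridCount a4, b6.sameGridCount a6⟩
  · obtain ⟨a1, -, a3, a4, -, a6⟩ := α.gridCounts_G₂ hM rfl
    obtain ⟨e1, e3, e4, e6⟩ := cardG₂_eq rfl hM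
    exact ⟨e1 ▸ a1, e3 ▸ a3, e4 ▸ a4, e6 ▸ a6⟩
  · obtain ⟨a1, a2, -, a4, a5, -⟩ := α.gridCounts_G₂ hM rfl
    exact ⟨a2.sameGridCount a1, a5.sameGridCount a4⟩
  · obtain ⟨a1, -, a3, a4, -, a6⟩ := α.gridCounts_F₄ hM rfl
    obtain ⟨e1, e3, e4, e6⟩ := cardF₄_eq rfl hM
    exact ⟨e1 ▸ a1, e3 ▸ a3, e4 ▸ a4, e6 ▸ a6⟩
  · obtain ⟨a1, a2, -, a4, a5, -⟩ := α.gridCounts_F₄ hM rfl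
    exact ⟨a2.sameGridCount a1, a5.sameGridCount a4⟩
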